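/- \textbf{Conventions.} Let $D$ be a densely defined (unbounded) operator and $T$ a bounded operator on a complex Hilbert space $\mathcal H$. "$[D,T]$ is bounded" means that $T\,\mathrm{Dom}(D)\subset \mathrm{Dom}(D)$ and that $DT-TD$ extends from $\mathrm{Dom}(D)$ to a bounded operator, again written $[D,T]$; a relation or a bound on $[D,T]$ includes that it is bounded. Consider the relations $$UU^*=U^*U=1,\qquad D=D^*,\qquad U^*[D,U]=1, \tag{$*$}$$ with $U$ bounded and $D$ unbounded self-adjoint on $\mathcal H$. Write $ds=D^{-1}$ (with value $0$ on $\ker D$). For a compact operator $T\ge 0$ with characteristic values $\mu_0(T)\ge\mu_1(T)\ge\cdots$, one says that $\int\!\!\!\!\!\!-\, T=c$ if $\frac1{\log N}\sum_{n<N}\mu_n(T)\to c$ as $N\to\infty$; then the Dixmier trace $\mathrm{Tr}_\omega(T)$ exists and equals $c$ for every choice of the generalized limit $\omega$. \textbf{Theorem.} \begin{enumerate} \item Suppose that $(*)$ holds and that $ds$ is infinitesimal, i.e. $ds$ is a compact operator. Then $\int\!\!\!\!\!\!-\,|ds|$ exists and $\int\!\!\!\!\!\!-\,|ds|\in\mathbb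 N$. \item Suppose that $(*)$ holds on $\mathcal H\neq 0$. Then the spectrum of $U$ is the unit circle $S^1=\{z\in\mathbb C: |z|=1\}$. Let $\mathcal A$ be any $*$-subalgebra of $C(S^1)$ containing the constants and the coordinate function $z$, acting on $\mathcal H$ by $f\mapsto f(U)$. Then for all $a,b\in S^1$ the supremum $$d(a,b)=\sup\{\,|f(a)-f(b)| \;:\; f\in\mathcal A,\ \|[D,f]\|\le 1\,\}$$ is the standard (arc length) distance between $a$ and $b$ on the unit circle, i.e. the angle in $[0,\pi]$ between $a$ and $b$. \item Let $M$ be a connected compact Riemannian manifold of dimension $1$ (without boundary), with an orientation, given by the smooth unit vector field $e$, and a spin structure. Let $(\mathcal A,\mathcal H,D)$ be the associated spectral triple: $\mathcal A=C^\infty(M,\mathbb C)$ acts by multiplication on the space $\mathcal H$ of $L^2$-spinors, and $D$ is the Dirac operator. After a smooth unitary trivialization of the spinor bundle (a Hermitian line bundle), $\mathcal H=L^2(M,\mathbb C)$, the spin connection is $\nabla_e=\partial_e+i\alpha$ with $\alpha$ a smooth real function, and $D$ is the closure of $-i\nabla_e=-i\partial_e+\alpha$ on $C^\infty(M,\mathbb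 C)$. Then a solution $U\in\mathcal A$ of $(*)$ exists if and only if the length $|M|$ lies in $2\pi\mathbb N$. (The same holds for every smooth real function $\alpha$, whatever the holonomy of the connection.) \end{enumerate} -/

import Mathlib

open Filter Topology MeasureTheory Bundle
open scoped ContDiff Manifold ENNReal BoundedContinuousFunction InnerProductSpace

noncomputable section

namespace ConnesCircle

/-! ### Unbounded operators, commutators and the relations -/

section Operators

variable {H : Type*} [NormedAddCommGroup H] [InnerProductSpace ℂ H]

/-- `B` is the bounded operator given by the commutator `[D, T]`: the bounded operator `T` maps the
domain of `D` to itself, and `B` agrees there with `D T - T D`. When `D` is densely defined there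
is at most one such `B`, and "`[D, T]` is bounded" means that there is one. -/
def IsCommutator (D : H →ₗ.[ℂ] H) (T B : H →L[ℂ] H) : Prop :=
  ∀ x : D.domain, ∃ hx : T x ∈ D.domain, D ⟨T x, hx⟩ - T (D x) = B x

/-- The relations `U U* = U* U = 1`, `D = D*`, `U* [D, U] = 1` for an unbounded (densely defined)
operator `D` and a bounded operator `U` on a Hilbert space. -/
structure IsHeisenbergPair [CompleteSpace H] (D : H →ₗ.[ℂ] H) (U : H →L[ℂ] H) : Prop where
  unitary_left : star U * U = 1
  unitary_right : U * star U = 1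
  selfAdjoint : IsSelfAdjoint D
  commutation : ∃ B : H →L[ℂ] H, IsCommutator D U B ∧ star U * B = 1

theorem IsHeisenbergPair.isStarNormal [CompleteSpace H] {D : H →ₗ.[ℂ] H} {U : H →L[ℂ] H}
    (h : IsHeisenbergPair D U) : IsStarNormal U :=
  ⟨h.unitary_left.trans h.unitary_right.symm⟩

/-- The kernel of an unbounded operator, as a subspace of the Hilbert space. -/
def kernel (D : H →ₗ.[ℂ] H) : Submodule ℂ H :=
  (LinearMap.ker D.toFun).map D.domain.subtype

/-- `ds` is the bounded operator `D⁻¹`, with the value `0` on the kernel of `D` and with values in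
the orthogonal complement of this kernel. For self-adjoint `D` there is at most one such `ds`. -/
structure IsLineElement (D : H →ₗ.[ℂ] H) (ds : H →L[ℂ] H) : Prop where
  apply_kernel : ∀ x ∈ kernel D, ds x = 0
  mem_orthogonal : ∀ x ∈ (kernel D)ᗮ, ds x ∈ (kernel D)ᗮ
  right_inv : ∀ x ∈ (kernel D)ᗮ, ∃ hx : ds x ∈ D.domain, D ⟨ds x, hx⟩ = x

/-! ### The noncommutative integral of a positive infinitesimal -/

/-- The characteristic value `μ_n(T)`: the infimum of the norms of the restrictions of `T` to the
orthogonal complements of the subspaces of dimension at most `n`. -/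
def charValue (T : H →L[ℂ] H) (n : ℕ) : ℝ :=
  sInf {r : ℝ | ∃ E : Submodule ℂ H, FiniteDimensional ℂ E ∧ Module.finrank ℂ E ≤ n ∧
    r = ‖T ∘L (Eᗮ).subtypeL‖}

/-- The logarithmic means `(1 / log N) ∑_{n < N} μ_n(T)`. -/
def logMean (T : H →L[ℂ] H) (N : ℕ) : ℝ :=
  (∑ n ∈ Finset.range N, charValue T n) / Real.log N

/-- The sequence `(s₀, s₀, s₁, s₁, s₂, s₂, …)`. -/
def doubled (s : ℕ →ᵇ ℝ) : ℕ →ᵇ ℝ :=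
  s.compContinuous ⟨fun n => n / 2, continuous_of_discreteTopology⟩

/-- The generalized limits used for Dixmier traces: positive linear forms on bounded sequences that
extend the limit of convergent sequences and are scale invariant. -/
structure IsDixmierLimit (lim : (ℕ →ᵇ ℝ) →ₗ[ℝ] ℝ) : Prop where
  nonneg : ∀ s : ℕ →ᵇ ℝ, (∀ n, 0 ≤ s n) → 0 ≤ lim s
  limit : ∀ (s : ℕ →ᵇ ℝ) (l : ℝ), Tendsto s atTop (𝓝 l) → lim s = l
  scale : ∀ s : ℕ →ᵇ ℝ, lim (doubled s) = lim s

/-- For a positive operator `T`, the statement `⨍ T = c`: `T` is an infinitesimal (a compact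
operator), the sums of its first `N` characteristic values have `c` as their coefficient of
`log N`, and `c` is the Dixmier trace of `T` (the value of `lim` on the bounded sequence of logarithmic
means) for every choice of the generalized limit `lim`. -/
structure HasNCIntegral (T : H →L[ℂ] H) (c : ℝ) : Prop where
  compact : IsCompactOperator T
  log_coefficient : Tendsto (logMean T) atTop (𝓝 c)
  dixmier : ∀ lim : (ℕ →ᵇ ℝ) →ₗ[ℝ] ℝ, IsDixmierLimit lim →
    ∃ s : ℕ →ᵇ ℝ, (∀ N, s N = logMean T N) ∧ lim s = c

/-! ### The spectral distance -/

/-- The numbers `|f a - f b|` with `f ∈ 𝒜`, `‖[D, f]‖ ≤ 1`, where `𝒜` is an algebra of continuous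
functions on the spectrum of `U` acting on the Hilbert space by `f ↦ f(U)`. -/
def spectralDifferences [CompleteSpace H] (D : H →ₗ.[ℂ] H) (U : H →L[ℂ] H)
    (hU : IsStarNormal U) (𝒜 : StarSubalgebra ℂ C(spectrum ℂ U, ℂ)) (a b : spectrum ℂ U) : Set ℝ :=
  {r : ℝ | ∃ f ∈ 𝒜, (∃ B : H →L[ℂ] H, IsCommutator D (cfcHom hU f) B ∧ ‖B‖ ≤ 1) ∧
    r = ‖f a - f b‖}

/-- The coordinate function on the spectrum of `U`, which acts as `U` itself. -/
def coordinate [CompleteSpace H] (U : H →L[ℂ] H) : C(spectrum ℂ U, ℂ) :=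
  ⟨fun z => z, continuous_subtype_val⟩

end Operators

/-! ### The spectral triple of an oriented compact Riemannian manifold of dimension one -/

section Manifold

/-- The model space of manifolds of dimension one. -/
abbrev Line : Type := EuclideanSpace ℝ (Fin 1)

variable {M : Type*} [MetricSpace M] [ChartedSpace Line M]

/-- The derivative `∂_e f` of a complex function along a vector field `e`. -/
def derivAlong (e : ∀ x : M, TangentSpace (𝓡 1) x) (f : M → ℂ) (x : M) : ℂ :=
  mfderiv (𝓡 1) 𝓘(ℝ, ℂ) f x (e x)

/-- The differential operator `-i (∂_e + i α) = -i ∂_e + α` on functions. -/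
def diracExpr (e : ∀ x : M, TangentSpace (𝓡 1) x) (α : C^∞⟮𝓡 1, M; 𝓘(ℝ, ℝ), ℝ⟯)
    (f : M → ℂ) (x : M) : ℂ :=
  -Complex.I * derivAlong e f x + (α x : ℂ) * f x

theorem diracExpr_zero (e : ∀ x : M, TangentSpace (𝓡 1) x) (α : C^∞⟮𝓡 1, M; 𝓘(ℝ, ℝ), ℝ⟯) :
    diracExpr e α (fun _ => 0) = 0 := by
  funext x
  have h : derivAlong e (fun _ => 0) x = 0 :=
    congrArg (fun L : Line →L[ℝ] ℂ => L (e x))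
      (mfderiv_const (I := 𝓡 1) (I' := 𝓘(ℝ, ℂ)) (x := x) (c := (0 : ℂ)))
  simp [diracExpr, h]

theorem diracExpr_add (e : ∀ x : M, TangentSpace (𝓡 1) x) (α : C^∞⟮𝓡 1, M; 𝓘(ℝ, ℝ), ℝ⟯)
    (f g : C^∞⟮𝓡 1, M; 𝓘(ℝ, ℂ), ℂ⟯) :
    diracExpr e α (fun x => f x + g x) = diracExpr e α f + diracExpr e α g := by
  funext x
  have hf := (f.contMDiff x).mdifferentiableAt (by simp)
  have hg := (g.contMDiff x).mdifferentiableAt (by simp)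
  have h : derivAlong e (fun x => f x + g x) x = derivAlong e f x + derivAlong e g x :=
    congrArg (fun L : Line →L[ℝ] ℂ => L (e x)) (mfderiv_add hf hg)
  simp only [diracExpr, Pi.add_apply, h]
  ring

theorem diracExpr_smul (e : ∀ x : M, TangentSpace (𝓡 1) x) (α : C^∞⟮𝓡 1, M; 𝓘(ℝ, ℝ), ℝ⟯)
    (c : ℂ) (f : C^∞⟮𝓡 1, M; 𝓘(ℝ, ℂ), ℂ⟯) :
    diracExpr e α (fun x => c * f x) = c • diracExpr e α f := by
  funext x
  have hf := (f.contMDiff x).mdifferentiableAt (by simp)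
  have h0 := ((ContinuousLinearMap.mul ℝ ℂ c).hasMFDerivAt (x := f x)).comp x hf.hasMFDerivAt
  have h : derivAlong e (fun x => c * f x) x = c * derivAlong e f x :=
    congrArg (fun L : Line →L[ℝ] ℂ => L (e x)) h0.mfderiv
  simp only [diracExpr, Pi.smul_apply, h, smul_eq_mul]
  ring

variable [MeasurableSpace M] [BorelSpace M]

variable (M) in
/-- The Riemannian length measure of a Riemannian manifold of dimension one: the one-dimensional
Hausdorff measure of the Riemannian distance. -/
def lengthMeasure : Measure M := Measure.hausdorffMeasure 1

variable (M) in
/-- The Hilbert space of square integrable spinors. In dimension one the spinor bundle is a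
Hermitian complex line bundle, hence isomorphic to the trivial one. -/
abbrev Spinors : Type _ := Lp ℂ 2 (lengthMeasure M)

/-- The graph, in `L² × L²`, of `-i ∂_e + α` on smooth functions. -/
def smoothGraph (e : ∀ x : M, TangentSpace (𝓡 1) x) (α : C^∞⟮𝓡 1, M; 𝓘(ℝ, ℝ), ℝ⟯) :
    Submodule ℂ (Spinors M × Spinors M) where
  carrier := {p | ∃ f : C^∞⟮𝓡 1, M; 𝓘(ℝ, ℂ), ℂ⟯,
    p.1 =ᵐ[lengthMeasure M] f ∧ p.2 =ᵐ[lengthMeasure M] diracExpr e α f}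
  zero_mem' := by
    refine ⟨⟨fun _ => 0, contMDiff_const⟩, Lp.coeFn_zero _ _ _, ?_⟩
    exact (Lp.coeFn_zero _ _ _).trans (.of_eq (diracExpr_zero e α).symm)
  add_mem' := by
    rintro p q ⟨f, hf, hf'⟩ ⟨g, hg, hg'⟩
    refine ⟨⟨fun x => f x + g x, f.contMDiff.add g.contMDiff⟩, ?_, ?_⟩
    · exact (Lp.coeFn_add _ _).trans (hf.add hg)
    · exact ((Lp.coeFn_add _ _).trans (hf'.add hg')).trans (.of_eq (diracExpr_add e α f g).symm)
  smul_mem' := by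
    rintro c p ⟨f, hf, hf'⟩
    refine ⟨⟨fun x => c * f x,
      (ContinuousLinearMap.mul ℝ ℂ c).contMDiff.comp f.contMDiff⟩, ?_, ?_⟩
    · exact (Lp.coeFn_smul _ _).trans (hf.const_smul c)
    · exact ((Lp.coeFn_smul _ _).trans (hf'.const_smul c)).trans
        (.of_eq (diracExpr_smul e α c f).symm)

/-- The Dirac operator of a compact Riemannian manifold of dimension one, with orientation given by
the unit vector field `e`: the closure in `L²` of `-i ∇_e` on smooth spinors, where in a smooth
unitary trivialization of the spinor bundle the (unitary) spin connection is `∇_e = ∂_e + i α`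
with `α` a smooth real function. (The two spin structures of a circle are told apart by the
holonomy of this connection, which is `1` or `-1`.) -/
def dirac (e : ∀ x : M, TangentSpace (𝓡 1) x) (α : C^∞⟮𝓡 1, M; 𝓘(ℝ, ℝ), ℝ⟯) :
    Spinors M →ₗ.[ℂ] Spinors M :=
  (smoothGraph e α).toLinearPMap.closure

/-- A smooth function on a compact manifold, acting by multiplication on `L²`. -/
def mulOp [CompactSpace M] (f : C^∞⟮𝓡 1, M; 𝓘(ℝ, ℂ), ℂ⟯) : Spinors M →L[ℂ] Spinors M :=
  have hf : MemLp (f : M → ℂ) ∞ (lengthMeasure M) := by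
    have hc : Continuous f := f.contMDiff.continuous
    obtain ⟨C, hC⟩ := isCompact_univ.exists_bound_of_continuousOn hc.continuousOn
    exact memLp_top_of_bound hc.aestronglyMeasurable C (Eventually.of_forall fun x => hC x trivial)
  (ContinuousLinearMap.mul ℂ ℂ).holderL (lengthMeasure M) ∞ 2 2 hf.toLp

end Manifold

end ConnesCircle

end

/-! Multiplying `U* [D, U] = 1` by `U` gives `[D, U] = U`: conjugation by `U` shifts `D` by one. All
three statements exploit this shift.

Integrality. `U` carries the eigenspace of `D` for `t` onto the one for `t + 1`. If `ds` is compact,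
the eigenvalues of `D` in `[1, 2)` have finite total multiplicity `n`; by the shift every interval
`[j, j + 1)` has the same multiplicity, and `[-k, k)` has `2 * k * n`
(`IsHeisenbergPair.eigenSpan_Ico`). Min-max bounds then squeeze the characteristic values of `ds` so
that `(m + 1) * μ_m` tends to `2 * n` (`tendsto_mul_of_block_bounds`), and `2 * n` is the
coefficient of `log N`.

Spectrum and distance. Without compactness, unit vectors `x_n` with `(D - l) x_n → 0` replace
eigenvectors. Their vector states tend to zero on commutators with `D`; since `[D, U^k] = k U^k`,
they converge on functions of `U` to the Haar mean of the circle (`IsHeisenbergPair.tendsto_mean`).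
The Haar measure has full support, so the spectrum is the whole circle. Testing the same states on
`q(U)* f(U) q(U)` for trigonometric polynomials `q` turns `‖[D, f]‖ ≤ 1` into a weak bound on the
derivative of `f` (`IsHeisenbergPair.norm_mean_le_of_isCommutator`). With `|q|²` a peak kernel this
bounds the derivative of a smoothing of `f`, so `f` is 1-Lipschitz for arc length. Conversely, the
same smoothing applied to the distance from `b` yields trigonometric polynomials, which lie in every
admissible algebra, with derivative at most one (`exists_approximate_angle`).

Dimension one. An integral curve `γ` of `e` is an arc length parametrization with a minimal period
`L`, and `L` is the Hausdorff measure of the manifold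
(`IsPeriodicParametrization.lengthMeasure_eq_map`). The Dirac operator has a Hilbert basis of smooth
eigenfunctions, hence is self-adjoint. For a function `U`, the relation says `-i ∂_e U = U`, so `U`
is a multiple of `exp (i s)` along `γ`; this has period `L` exactly when `L` is a multiple of `2 π`.
-/

noncomputable section

namespace ConnesCircle

/-! ### Unbounded operators handled through their graphs. -/

section Graph

variable {H : Type*} [NormedAddCommGroup H] [InnerProductSpace ℂ H]

/-- In graph form no proofs of domain membership have to be carried along, commutators compose by
chaining memberships, and the condition passes to closures. -/
theorem isCommutator_iff_graph {D : H →ₗ.[ℂ] H} {T B : H →L[ℂ] H} :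
    IsCommutator D T B ↔ ∀ x y : H, (x, y) ∈ D.graph → (T x, T y + B x) ∈ D.graph := by
  constructor
  · intro h x y hxy
    obtain ⟨⟨x', hx'⟩, rfl, rfl⟩ := (LinearPMap.mem_graph_iff D).1 hxy
    obtain ⟨hx, hB⟩ := h ⟨x', hx'⟩
    refine (LinearPMap.mem_graph_iff D).2 ⟨⟨T x', hx⟩, rfl, ?_⟩
    simp only at hB ⊢
    rw [← hB]; abel
  · intro h x
    obtain ⟨⟨x', hx'⟩, h1, h2⟩ := (LinearPMap.mem_graph_iff D).1 (h x (D x) (D.mem_graph x))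
    simp only at h1 h2
    subst h1
    exact ⟨hx', by rw [h2]; abel⟩

variable [CompleteSpace H]

theorem inner_graph_symm {D : H →ₗ.[ℂ] H} (hD : IsSelfAdjoint D) {x y x' y' : H}
    (h : (x, y) ∈ D.graph) (h' : (x', y') ∈ D.graph) : ⟪x, y'⟫_ℂ = ⟪y, x'⟫_ℂ := by
  have hf := LinearPMap.adjoint_isFormalAdjoint hD.dense_domain
  rw [LinearPMap.isSelfAdjoint_def.1 hD] at hf
  obtain ⟨a, rfl, rfl⟩ := (LinearPMap.mem_graph_iff D).1 h
  obtain ⟨b, rfl, rfl⟩ := (LinearPMap.mem_graph_iff D).1 h'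
  exact (hf a b).symm

/-- The hypothesis says that the pair lies in the graph of the adjoint. This maximality is how
vectors are shown to belong to the domain of `D`. -/
theorem mem_graph_of_inner {D : H →ₗ.[ℂ] H} (hD : IsSelfAdjoint D) {x y : H}
    (h : ∀ x' y' : H, (x', y') ∈ D.graph → ⟪y, x'⟫_ℂ = ⟪x, y'⟫_ℂ) : (x, y) ∈ D.graph := by
  have key : ∀ b : D.domain, ⟪y, (b : H)⟫_ℂ = ⟪x, D b⟫_ℂ := fun b => h b (D b) (D.mem_graph b)
  have hx : x ∈ D.adjoint.domain := LinearPMap.mem_adjoint_domain_of_exists x ⟨y, key⟩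
  have hy : D.adjoint ⟨x, hx⟩ = y := LinearPMap.adjoint_apply_eq hD.dense_domain ⟨x, hx⟩ key
  rw [← LinearPMap.isSelfAdjoint_def.1 hD]
  exact (LinearPMap.mem_graph_iff _).2 ⟨⟨x, hx⟩, rfl, hy⟩

theorem isSelfAdjoint_of_graph {D : H →ₗ.[ℂ] H} (hd : Dense (D.domain : Set H))
    (hs : ∀ x y x' y' : H, (x, y) ∈ D.graph → (x', y') ∈ D.graph → ⟪x, y'⟫_ℂ = ⟪y, x'⟫_ℂ)
    (hm : ∀ x y : H, (∀ x' y' : H, (x', y') ∈ D.graph → ⟪y, x'⟫_ℂ = ⟪x, y'⟫_ℂ) →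
      (x, y) ∈ D.graph) : IsSelfAdjoint D := by
  rw [LinearPMap.isSelfAdjoint_def]
  apply le_antisymm
  · apply LinearPMap.le_of_le_graph
    rintro ⟨x, y⟩ hxy
    obtain ⟨a, rfl, rfl⟩ := (LinearPMap.mem_graph_iff _).1 hxy
    refine hm _ _ fun x' y' h' => ?_
    obtain ⟨b, rfl, rfl⟩ := (LinearPMap.mem_graph_iff D).1 h'
    exact LinearPMap.adjoint_isFormalAdjoint hd a b
  · apply LinearPMap.IsFormalAdjoint.le_adjoint hd
    intro a b
    exact (hs _ _ _ _ (D.mem_graph a) (D.mem_graph b)).symm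

theorem graph_isClosed {D : H →ₗ.[ℂ] H} (hD : IsSelfAdjoint D) :
    IsClosed (D.graph : Set (H × H)) := hD.isClosed

namespace IsHeisenbergPair

variable {D : H →ₗ.[ℂ] H} {U : H →L[ℂ] H} (h : IsHeisenbergPair D U)
include h

theorem star_apply_apply (x : H) : star U (U x) = x :=
  congrArg (fun T : H →L[ℂ] H => T x) h.unitary_left

theorem apply_star_apply (x : H) : U (star U x) = x :=
  congrArg (fun T : H →L[ℂ] H => T x) h.unitary_right

theorem norm_apply (x : H) : ‖U x‖ = ‖x‖ := by
  have h1 : ⟪U x, U x⟫_ℂ = ⟪x, x⟫_ℂ := by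
    rw [← ContinuousLinearMap.adjoint_inner_right, ← ContinuousLinearMap.star_eq_adjoint,
      h.star_apply_apply]
  rw [@norm_eq_sqrt_re_inner ℂ, @norm_eq_sqrt_re_inner ℂ, h1]

theorem graph_apply {x y : H} (hxy : (x, y) ∈ D.graph) : (U x, U y + U x) ∈ D.graph := by
  obtain ⟨B, hB, hUB⟩ := h.commutation
  have : B = U := by
    calc B = (U * star U) * B := by rw [h.unitary_right, one_mul]
      _ = U := by rw [mul_assoc, hUB, mul_one]
  subst this
  exact isCommutator_iff_graph.1 hB x y hxy

/-- The relations do not assume that `U*` preserves the domain; this follows from self-adjointness,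
by moving `U*` to the other side of the inner product. -/
theorem graph_star_apply {x y : H} (hxy : (x, y) ∈ D.graph) :
    (star U x, star U y - star U x) ∈ D.graph := by
  refine mem_graph_of_inner h.selfAdjoint fun x' y' h' => ?_
  have := inner_graph_symm h.selfAdjoint hxy (h.graph_apply h')
  simp only [inner_add_right] at this
  simp only [inner_sub_left, ContinuousLinearMap.star_eq_adjoint,
    ContinuousLinearMap.adjoint_inner_left]
  rw [← this]; ring

end IsHeisenbergPair
end Graph

/-! ### Eigenspaces of a self-adjoint operator and their spans. -/

section Eigenspaces

variable {H : Type*} [NormedAddCommGroup H] [InnerProductSpace ℂ H]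

/-- The eigenspace of an unbounded operator for a real number. -/
def eigen (D : H →ₗ.[ℂ] H) (t : ℝ) : Submodule ℂ H :=
  D.graph.comap (LinearMap.id.prod ((t : ℂ) • LinearMap.id))

theorem mem_eigen {D : H →ₗ.[ℂ] H} {t : ℝ} {x : H} :
    x ∈ eigen D t ↔ (x, (t : ℂ) • x) ∈ D.graph := Iff.rfl

/-- The span of the eigenspaces for the eigenvalues in a set. -/
def eigenSpan (D : H →ₗ.[ℂ] H) (I : Set ℝ) : Submodule ℂ H := ⨆ t : I, eigen D t

theorem eigen_le_eigenSpan {D : H →ₗ.[ℂ] H} {I : Set ℝ} {t : ℝ} (ht : t ∈ I) :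
    eigen D t ≤ eigenSpan D I := le_iSup (fun t : I => eigen D t) ⟨t, ht⟩

theorem eigenSpan_le {D : H →ₗ.[ℂ] H} {I : Set ℝ} {V : Submodule ℂ H}
    (h : ∀ t ∈ I, eigen D t ≤ V) : eigenSpan D I ≤ V := iSup_le fun t => h t t.2

theorem eigenSpan_mono {D : H →ₗ.[ℂ] H} {I J : Set ℝ} (h : I ⊆ J) :
    eigenSpan D I ≤ eigenSpan D J := eigenSpan_le fun _ ht => eigen_le_eigenSpan (h ht)

theorem eigenSpan_union (D : H →ₗ.[ℂ] H) (I J : Set ℝ) :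
    eigenSpan D (I ∪ J) = eigenSpan D I ⊔ eigenSpan D J := by
  apply le_antisymm
  · refine eigenSpan_le fun t ht => ?_
    rcases ht with ht | ht
    · exact (eigen_le_eigenSpan ht).trans le_sup_left
    · exact (eigen_le_eigenSpan ht).trans le_sup_right
  · exact sup_le (eigenSpan_mono Set.subset_union_left) (eigenSpan_mono Set.subset_union_right)

theorem kernel_eq_eigen (D : H →ₗ.[ℂ] H) : kernel D = eigen D 0 := by
  ext x
  simp only [kernel, Submodule.mem_map, LinearMap.mem_ker, mem_eigen, Complex.ofReal_zero,
    zero_smul, LinearPMap.mem_graph_iff, Submodule.subtype_apply]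
  constructor
  · rintro ⟨y, hy, rfl⟩; exact ⟨y, rfl, hy⟩
  · rintro ⟨y, hy, hy'⟩; exact ⟨y, hy', hy⟩

variable [CompleteSpace H]

theorem inner_eigen_eq_zero {D : H →ₗ.[ℂ] H} (hD : IsSelfAdjoint D) {s t : ℝ} (hst : s ≠ t)
    {x y : H} (hx : x ∈ eigen D s) (hy : y ∈ eigen D t) : ⟪x, y⟫_ℂ = 0 := by
  have := inner_graph_symm hD (mem_eigen.1 hx) (mem_eigen.1 hy)
  rw [inner_smul_left, inner_smul_right, Complex.conj_ofReal] at this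
  have h2 : ((t : ℂ) - s) * ⟪x, y⟫_ℂ = 0 := by rw [sub_mul, this, sub_self]
  rcases mul_eq_zero.1 h2 with h3 | h3
  · exact absurd (by exact_mod_cast (sub_eq_zero.1 h3).symm) hst
  · exact h3

theorem eigenSpan_isOrtho {D : H →ₗ.[ℂ] H} (hD : IsSelfAdjoint D) {I J : Set ℝ}
    (hIJ : Disjoint I J) : eigenSpan D I ⟂ eigenSpan D J := by
  refine Submodule.isOrtho_iSup_left.2 fun s => Submodule.isOrtho_iSup_right.2 fun t => ?_
  rw [Submodule.isOrtho_iff_inner_eq]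
  intro x hx y hy
  exact inner_eigen_eq_zero hD (hIJ.ne_of_mem s.2 t.2) hx hy

theorem finrank_eigenSpan_union {D : H →ₗ.[ℂ] H} (hD : IsSelfAdjoint D) {I J : Set ℝ}
    (hIJ : Disjoint I J) [FiniteDimensional ℂ (eigenSpan D I)]
    [FiniteDimensional ℂ (eigenSpan D J)] :
    Module.finrank ℂ (eigenSpan D (I ∪ J)) =
      Module.finrank ℂ (eigenSpan D I) + Module.finrank ℂ (eigenSpan D J) := by
  have h := Submodule.finrank_sup_add_finrank_inf_eq (eigenSpan D I) (eigenSpan D J)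
  rw [(eigenSpan_isOrtho hD hIJ).disjoint.eq_bot, finrank_bot, add_zero] at h
  rw [eigenSpan_union, h]

theorem kernel_isClosed {D : H →ₗ.[ℂ] H} (hD : IsSelfAdjoint D) :
    IsClosed (kernel D : Set H) := by
  rw [kernel_eq_eigen]
  have : Continuous fun x : H => (x, ((0 : ℝ) : ℂ) • x) := by fun_prop
  exact (graph_isClosed hD).preimage this

/-- A sum of eigenvectors on which a bounded operator acts by factors at least `r`. -/
theorem le_norm_of_mem_eigenSpan {D : H →ₗ.[ℂ] H} (hD : IsSelfAdjoint D) {I : Set ℝ}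
    {T : H →L[ℂ] H} {g : ℝ → ℝ} (hT : ∀ t ∈ I, ∀ x ∈ eigen D t, T x = (g t : ℂ) • x) {r : ℝ}
    (hr : 0 ≤ r) (hg : ∀ t ∈ I, r ≤ |g t|) {x : H} (hx : x ∈ eigenSpan D I) :
    r * ‖x‖ ≤ ‖T x‖ := by
  classical
  -- Eigenspaces are orthogonal, so Pythagoras reduces the inequality to one component at a time.
  have hO : OrthogonalFamily ℂ (fun t : I => eigen D t) fun t => (eigen D t).subtypeₗᵢ := by
    intro s t hst x y
    exact inner_eigen_eq_zero hD (fun e => hst (Subtype.ext e)) x.2 y.2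
  obtain ⟨f, hf⟩ := (Submodule.mem_iSup_iff_exists_dfinsupp' _ x).1 hx
  have h1 : ‖x‖ ^ 2 = ∑ t ∈ f.support, ‖f t‖ ^ 2 := by
    rw [← hf]; exact hO.norm_sum f f.support
  have h2 : ‖T x‖ ^ 2 = ∑ t ∈ f.support, ‖(g t : ℂ) • f t‖ ^ 2 := by
    rw [← hO.norm_sum (fun t => (g t : ℂ) • f t) f.support, ← hf, DFinsupp.sum, map_sum]
    congr 2
    exact Finset.sum_congr rfl fun t _ => hT t t.2 _ (f t).2
  refine le_of_sq_le_sq ?_ (norm_nonneg _)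
  rw [mul_pow, h1, h2, Finset.mul_sum]
  refine Finset.sum_le_sum fun t _ => ?_
  rw [norm_smul, mul_pow, Complex.norm_real, Real.norm_eq_abs]
  gcongr
  exact hg t t.2

end Eigenspaces

/-! ### Characteristic values: min-max bounds and dependence on norms only. -/

section CharValue

variable {H : Type*} [NormedAddCommGroup H] [InnerProductSpace ℂ H]

theorem charValue_bddBelow (T : H →L[ℂ] H) (n : ℕ) :
    BddBelow {r : ℝ | ∃ E : Submodule ℂ H, FiniteDimensional ℂ E ∧ Module.finrank ℂ E ≤ n ∧
      r = ‖T ∘L (Eᗮ).subtypeL‖} :=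
  ⟨0, by rintro _ ⟨E, -, -, rfl⟩; exact ContinuousLinearMap.opNorm_nonneg _⟩

theorem charValue_nonneg (T : H →L[ℂ] H) (n : ℕ) : 0 ≤ charValue T n :=
  Real.sInf_nonneg (by rintro _ ⟨E, -, -, rfl⟩; exact ContinuousLinearMap.opNorm_nonneg _)

theorem charValue_le {T : H →L[ℂ] H} {n : ℕ} (E : Submodule ℂ H) [FiniteDimensional ℂ E]
    (hE : Module.finrank ℂ E ≤ n) {r : ℝ} (hr : 0 ≤ r) (h : ∀ x ∈ Eᗮ, ‖T x‖ ≤ r * ‖x‖) :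
    charValue T n ≤ r := by
  refine (csInf_le (charValue_bddBelow T n) ⟨E, ‹_›, hE, rfl⟩).trans ?_
  exact ContinuousLinearMap.opNorm_le_bound _ hr fun x => h x x.2

/-- Dimension count: `F` is too large to project injectively to a competitor `E`, so it contains a
nonzero vector orthogonal to `E`, where the lower bound applies. -/
theorem le_charValue {T : H →L[ℂ] H} {n : ℕ} (F : Submodule ℂ H) [FiniteDimensional ℂ F]
    (hF : n < Module.finrank ℂ F) {r : ℝ} (h : ∀ x ∈ F, r * ‖x‖ ≤ ‖T x‖) :
    r ≤ charValue T n := by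
  refine le_csInf ⟨_, ⊥, inferInstance, by simp, rfl⟩ ?_
  rintro _ ⟨E, hfin, hE, rfl⟩
  have hne : F ⊓ Eᗮ ≠ ⊥ := by
    intro hbot
    let p : F →ₗ[ℂ] E := E.orthogonalProjectionOnto.toLinearMap ∘ₗ F.subtype
    have hinj : Function.Injective p := by
      rw [← LinearMap.ker_eq_bot, LinearMap.ker_eq_bot']
      intro x hx
      have : (x : H) ∈ F ⊓ Eᗮ := ⟨x.2, Submodule.orthogonalProjectionOnto_eq_zero_iff.1 hx⟩
      rw [hbot] at this
      exact Subtype.ext ((Submodule.mem_bot ℂ).1 this)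
    have := LinearMap.finrank_le_finrank_of_injective hinj
    omega
  obtain ⟨x, hx, hx0⟩ := Submodule.exists_mem_ne_zero_of_ne_bot hne
  have h1 := (T ∘L (Eᗮ).subtypeL).le_opNorm ⟨x, hx.2⟩
  have h2 := h x hx.1
  exact le_of_mul_le_mul_right (h2.trans h1) (norm_pos_iff.2 hx0)

/-- Together with `norm_abs_apply`, this replaces `|ds|` by `ds`, whose action on eigenvectors of
`D` is explicit. -/
theorem charValue_congr {S T : H →L[ℂ] H} (h : ∀ x, ‖S x‖ = ‖T x‖) (n : ℕ) :
    charValue S n = charValue T n := by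
  have : ∀ E : Submodule ℂ H, ‖S ∘L (Eᗮ).subtypeL‖ = ‖T ∘L (Eᗮ).subtypeL‖ := by
    intro E
    apply le_antisymm <;> refine ContinuousLinearMap.opNorm_le_bound _ (ContinuousLinearMap.opNorm_nonneg _) fun x => ?_
    · exact (h x).trans_le ((T ∘L (Eᗮ).subtypeL).le_opNorm x)
    · exact (h x).symm.trans_le ((S ∘L (Eᗮ).subtypeL).le_opNorm x)
  simp only [charValue, this]

theorem norm_abs_apply [CompleteSpace H] (T : H →L[ℂ] H) (x : H) : ‖CFC.abs T x‖ = ‖T x‖ := by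
  have key : ⟪CFC.abs T x, CFC.abs T x⟫_ℂ = ⟪T x, T x⟫_ℂ := by
    have h := congrArg (fun S : H →L[ℂ] H => S x) (CFC.abs_mul_abs T)
    have hs : ContinuousLinearMap.adjoint (CFC.abs T) = CFC.abs T :=
      (CFC.abs_nonneg T).isSelfAdjoint
    rw [← ContinuousLinearMap.adjoint_inner_right, hs, ← ContinuousLinearMap.adjoint_inner_right T]
    exact congrArg _ h
  rw [@norm_eq_sqrt_re_inner ℂ, @norm_eq_sqrt_re_inner ℂ, key]

/-- Compactness of an operator on a Hilbert space depends only on the norms of its values. -/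
theorem isCompactOperator_of_norm_eq [CompleteSpace H] {S T : H →L[ℂ] H}
    (h : ∀ x, ‖S x‖ = ‖T x‖) (hT : IsCompactOperator T) : IsCompactOperator S := by
  have key : TotallyBounded (S '' Metric.closedBall 0 1) := by
    have h1 : TotallyBounded (T '' Metric.closedBall 0 1) :=
      ((isCompactOperator_iff_isCompact_closure_image_closedBall
        (T : H →ₗ[ℂ] H) one_pos).1 hT).totallyBounded.subset subset_closure
    refine Metric.totallyBounded_iff.2 fun ε hε => ?_
    obtain ⟨t, hts, htf, hcov⟩ := Metric.finite_approx_of_totallyBounded h1 ε hε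
    obtain ⟨u, -, huf, rfl⟩ := Set.exists_subset_image_finite_and.1 ⟨t, hts, htf, rfl⟩
    refine ⟨S '' u, huf.image S, ?_⟩
    rintro _ ⟨x, hx, rfl⟩
    have := hcov ⟨x, hx, rfl⟩
    simp only [Set.mem_iUnion, Metric.mem_ball, dist_eq_norm, Set.exists_mem_image, exists_prop]
      at this ⊢
    obtain ⟨y, hy, hxy⟩ := this
    exact ⟨y, hy, by rwa [← map_sub, h, map_sub]⟩
  exact (isCompactOperator_iff_isCompact_closure_image_closedBall (S : H →ₗ[ℂ] H) one_pos).2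
    ((TotallyBounded.closure key).isCompact_of_isClosed isClosed_closure)

end CharValue

/-! ### Asymptotics of logarithmic means. -/

section Asymptotics

/-- The terms differ from `a / (n + 1)` by `o(1 / (n + 1))`. As the harmonic series diverges, the
partial sums of the error are negligible against harmonic sums, which grow like `log N`. -/
theorem tendsto_sum_div_log {c : ℕ → ℝ} {a : ℝ}
    (h : Tendsto (fun n : ℕ => ((n : ℝ) + 1) * c n) atTop (𝓝 a)) :
    Tendsto (fun N : ℕ => (∑ n ∈ Finset.range N, c n) / Real.log N) atTop (𝓝 a) := by
  have hlog : Tendsto (fun N : ℕ => Real.log N) atTop atTop :=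
    Real.tendsto_log_atTop.comp tendsto_natCast_atTop_atTop
  have hharm : Tendsto (fun N : ℕ => (∑ n ∈ Finset.range N, ((n : ℝ) + 1)⁻¹) / Real.log N) atTop
      (𝓝 1) := by
    have h1 := Real.tendsto_harmonic_sub_log.div_atTop hlog
    have h2 := h1.add_const 1
    rw [zero_add] at h2
    refine h2.congr' ?_
    filter_upwards [hlog.eventually_gt_atTop 0] with N hN
    have e : ((harmonic N : ℚ) : ℝ) = ∑ n ∈ Finset.range N, ((n : ℝ) + 1)⁻¹ := by
      simp [harmonic]
    rw [← e, sub_div, div_self hN.ne', sub_add_cancel]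
  have hdiv : Tendsto (fun N : ℕ => ∑ n ∈ Finset.range N, ((n : ℝ) + 1)⁻¹) atTop atTop := by
    refine (hharm.pos_mul_atTop one_pos hlog).congr' ?_
    filter_upwards [hlog.eventually_gt_atTop 0] with N hN
    field_simp
  have ho : (fun n : ℕ => c n - a * ((n : ℝ) + 1)⁻¹) =o[atTop] fun n : ℕ => ((n : ℝ) + 1)⁻¹ := by
    rw [Asymptotics.isLittleO_iff_tendsto' (Eventually.of_forall fun n hn => by
      exact absurd hn (by positivity))]
    have := h.sub_const a
    rw [sub_self] at this
    refine this.congr fun n => ?_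
    field_simp
  have ho2 := (ho.sum_range (fun n => by positivity) hdiv).tendsto_div_nhds_zero
  have h3 := (ho2.mul hharm).add (hharm.const_mul a)
  rw [zero_mul, zero_add, mul_one] at h3
  refine h3.congr' ?_
  filter_upwards [hlog.eventually_gt_atTop 0, hdiv.eventually_gt_atTop 0] with N hN hN'
  rw [Finset.sum_sub_distrib, ← Finset.mul_sum]
  set S := ∑ n ∈ Finset.range N, ((n : ℝ) + 1)⁻¹
  field_simp
  ring

/-- Asymptotics of a sequence from two-sided bounds on blocks of length `2 n`. -/
theorem tendsto_mul_of_block_bounds {c : ℕ → ℝ} (n : ℕ) (hc : ∀ m, 0 ≤ c m)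
    (hu : ∀ m k : ℕ, 1 ≤ k → 2 * k * n ≤ m → c m ≤ 1 / k)
    (hl : ∀ m k : ℕ, 1 ≤ k → m + 1 + n ≤ 2 * k * n → 1 / k ≤ c m) :
    Tendsto (fun m : ℕ => ((m : ℝ) + 1) * c m) atTop (𝓝 ((2 * n : ℕ) : ℝ)) := by
  rcases Nat.eq_zero_or_pos n with rfl | hn
  · have h0 : ∀ m, c m = 0 := by
      intro m
      refine le_antisymm (ge_of_tendsto' tendsto_one_div_add_atTop_nhds_zero_nat fun k => ?_) (hc m)
      exact_mod_cast hu m (k + 1) (by omega) (by simp)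
    simp [h0]
  have hn' : (0 : ℝ) < n := by exact_mod_cast hn
  -- The constants `3 * n` here and `-1 - 2 * n` in `e2` absorb the rounding of `m` to a multiple of
  -- the block length `2 * n`; they do not affect the limit.
  have e1 : Tendsto (fun m : ℕ => (2 * n : ℝ) * (((m : ℝ) + 1) / (m + 1 + 3 * n))) atTop
      (𝓝 ((2 * n : ℕ) : ℝ)) := by
    have : Tendsto (fun m : ℕ => ((m + 1 : ℕ) : ℝ) / ((m + 1 : ℕ) + 3 * (n : ℝ))) atTop (𝓝 1) :=
      (tendsto_natCast_div_add_atTop (3 * (n : ℝ))).comp (tendsto_add_atTop_nat 1)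
    simpa using this.const_mul (2 * n : ℝ)
  have e2 : Tendsto (fun m : ℕ => (2 * n : ℝ) * (((m : ℝ) + 1) / (m + 1 + (- 1 - 2 * n))))
      atTop (𝓝 ((2 * n : ℕ) : ℝ)) := by
    have : Tendsto (fun m : ℕ => ((m + 1 : ℕ) : ℝ) / ((m + 1 : ℕ) + (- 1 - 2 * n : ℝ)))
        atTop (𝓝 1) :=
      (tendsto_natCast_div_add_atTop (- 1 - 2 * n : ℝ)).comp (tendsto_add_atTop_nat 1)
    simpa using this.const_mul (2 * n : ℝ)
  refine tendsto_of_tendsto_of_tendsto_of_le_of_le' e1 e2 (Eventually.of_forall fun m => ?_) ?_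
  -- Rounding up, so that `2 * k * n` is at least `m + 1 + n` and exceeds it by at most one block.
  · set k := (m + 1 + n) / (2 * n) + 1 with hk
    have hk1 : m + 1 + n ≤ 2 * k * n := by
      have := Nat.lt_div_mul_add (a := m + 1 + n) (b := 2 * n) (by omega)
      nlinarith
    have hk2 : 2 * k * n ≤ m + 1 + 3 * n := by
      have := Nat.div_mul_le_self (m + 1 + n) (2 * n)
      rw [hk]
      linarith
    have h1 := hl m k (Nat.le_add_left 1 _) hk1
    have hkpos : (0 : ℝ) < k := by positivity
    have hk2' : (2 * k * n : ℝ) ≤ m + 1 + 3 * n := by exact_mod_cast hk2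
    calc (2 * n : ℝ) * (((m : ℝ) + 1) / (m + 1 + 3 * n)) = (m + 1) * (2 * n / (m + 1 + 3 * n)) := by
          ring
      _ ≤ (m + 1) * (1 / k) := by
          refine mul_le_mul_of_nonneg_left ?_ (by positivity)
          rw [div_le_div_iff₀ (by positivity) hkpos]; linarith
      _ ≤ _ := by gcongr
  · filter_upwards [eventually_ge_atTop (2 * n + 1)] with m hm
    set k := m / (2 * n) with hk
    have hk0 : 1 ≤ k := (Nat.one_le_div_iff (by omega)).2 (le_trans (Nat.le_succ _) hm)
    have hk1 : 2 * k * n ≤ m := by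
      have := Nat.div_mul_le_self m (2 * n)
      nlinarith
    have hk2 : m ≤ 2 * k * n + 2 * n := by
      have := Nat.lt_div_mul_add (a := m) (b := 2 * n) (by omega)
      nlinarith
    have h1 := hu m k hk0 hk1
    have hkpos : (0 : ℝ) < k := by exact_mod_cast hk0
    have hk2' : (m : ℝ) ≤ 2 * k * n + 2 * n := by exact_mod_cast hk2
    have hm' : (2 * n + 1 : ℝ) ≤ m := by exact_mod_cast hm
    calc ((m : ℝ) + 1) * c m ≤ (m + 1) * (1 / k) := by gcongr
      _ ≤ (m + 1) * (2 * n / (m + 1 + (-1 - 2 * n))) := by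
          refine mul_le_mul_of_nonneg_left ?_ (by positivity)
          rw [div_le_div_iff₀ hkpos (by linarith)]; linarith
      _ = _ := by ring

end Asymptotics

/-! ### Two facts about compact operators. -/

section Compact

variable {H : Type*} [NormedAddCommGroup H] [InnerProductSpace ℂ H] [CompleteSpace H]

/-- A subspace on which a compact operator is bounded below has finite dimension. -/
theorem finiteDimensional_of_isCompactOperator {T : H →L[ℂ] H} (hT : IsCompactOperator T)
    (V : Submodule ℂ H) {r : ℝ} (hr : 0 < r) (hV : ∀ x ∈ V, r * ‖x‖ ≤ ‖T x‖) :
    FiniteDimensional ℂ V := by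
  -- The lower bound persists on the closure, which is complete; there the operator is a closed
  -- embedding, and the unit ball is closed in the preimage of a compact set.
  let W := V.topologicalClosure
  have hW : ∀ x ∈ W, r * ‖x‖ ≤ ‖T x‖ := by
    have hc : IsClosed {x : H | r * ‖x‖ ≤ ‖T x‖} := isClosed_le (by fun_prop) (by fun_prop)
    exact fun x hx => closure_minimal hV hc hx
  have : CompleteSpace W := V.isClosed_topologicalClosure.completeSpace_coe
  let S : W →L[ℂ] H := T ∘L W.subtypeL
  have hS : AntilipschitzWith (Real.toNNReal r⁻¹) S := by
    refine AddMonoidHomClass.antilipschitz_of_bound S fun x => ?_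
    rw [Real.coe_toNNReal _ (by positivity), ← div_eq_inv_mul, le_div_iff₀ hr, mul_comm]
    exact hW x x.2
  have hemb : IsClosedEmbedding S := hS.isClosedEmbedding S.uniformContinuous
  obtain ⟨K, hK, hKr⟩ := (isCompactOperator_iff_image_closedBall_subset_compact
    (T : H →ₗ[ℂ] H) one_pos).1 hT
  have hball : IsCompact (Metric.closedBall (0 : W) 1) := by
    refine (hemb.isCompact_preimage hK).of_isClosed_subset Metric.isClosed_closedBall ?_
    intro x hx
    exact hKr ⟨x, by simpa using hx, rfl⟩
  have : FiniteDimensional ℂ W :=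
    FiniteDimensional.of_isCompact_closedBall ℂ one_pos hball
  exact Submodule.finiteDimensional_of_le V.le_topologicalClosure

/-- A compact symmetric operator is bounded on an invariant closed subspace by any bound for its
eigenvalues there. -/
theorem norm_le_of_eigenvalues {T : H →L[ℂ] H} (hT : IsCompactOperator T)
    (hs : (T : H →ₗ[ℂ] H).IsSymmetric) {V : Submodule ℂ H} (hVc : IsClosed (V : Set H))
    (hV : ∀ x ∈ V, T x ∈ V) {r : ℝ} (hr : 0 ≤ r)
    (he : ∀ x ∈ V, x ≠ 0 → ∀ μ : ℂ, T x = μ • x → ‖μ‖ ≤ r) {x : H} (hx : x ∈ V) :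
    ‖T x‖ ≤ r * ‖x‖ := by
  have : CompleteSpace V := hVc.completeSpace_coe
  let S : V →L[ℂ] V := T.restrict hV
  have hSc : IsCompactOperator S := hT.restrict' hV
  have hSs : (S : V →ₗ[ℂ] V).IsSymmetric := hs.restrict_invariant hV
  -- The norm of a self-adjoint operator is its spectral radius, and nonzero spectral values of a
  -- compact operator are eigenvalues.
  have hnorm : (‖S‖₊ : ℝ≥0∞) ≤ ENNReal.ofReal r := by
    rw [← S.spectralRadius_eq_nnnorm hSs.isSelfAdjoint]
    refine iSup₂_le fun μ hμ => ?_
    rcases eq_or_ne μ 0 with rfl | hμ0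
    · simp
    obtain ⟨v, hv⟩ := ((hSc.hasEigenvalue_iff_mem_spectrum hμ0).2 hμ).exists_hasEigenvector
    have h1 := he v v.2 (fun e => hv.2 (Subtype.ext e)) μ (congrArg Subtype.val hv.apply_eq_smul)
    rw [← enorm_eq_nnnorm, ← ofReal_norm]
    exact ENNReal.ofReal_le_ofReal h1
  have h2 : ‖S‖ ≤ r := by
    rw [← enorm_eq_nnnorm, ← ofReal_norm] at hnorm
    exact (ENNReal.ofReal_le_ofReal_iff hr).1 hnorm
  exact S.le_of_opNorm_le h2 ⟨x, hx⟩

end Compact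

/-! ### The line element and the integrality of its integral. -/

section LineElement

variable {H : Type*} [NormedAddCommGroup H] [InnerProductSpace ℂ H] [CompleteSpace H]
  {D : H →ₗ.[ℂ] H} {ds : H →L[ℂ] H}

namespace IsLineElement

variable (h : IsLineElement D ds) (hD : IsSelfAdjoint D)
include h hD

theorem exists_decomposition (x : H) : ∃ y ∈ (kernel D)ᗮ, x - y ∈ kernel D ∧ ds x = ds y := by
  have : CompleteSpace (kernel D) := (kernel_isClosed hD).completeSpace_coe
  obtain ⟨a, ha, b, hb, rfl⟩ := (kernel D).exists_add_mem_mem_orthogonal x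
  exact ⟨b, hb, by simpa using ha, by rw [map_add, h.apply_kernel a ha, zero_add]⟩

omit hD [CompleteSpace H] in
theorem graph_apply {x : H} (hx : x ∈ (kernel D)ᗮ) : (ds x, x) ∈ D.graph := by
  obtain ⟨h1, h2⟩ := h.right_inv x hx
  exact (LinearPMap.mem_graph_iff D).2 ⟨⟨ds x, h1⟩, rfl, h2⟩

theorem apply_mem_orthogonal (x : H) : ds x ∈ (kernel D)ᗮ := by
  obtain ⟨y, hy, -, e⟩ := h.exists_decomposition hD x
  rw [e]; exact h.mem_orthogonal y hy

theorem isSymmetric : (ds : H →ₗ[ℂ] H).IsSymmetric := by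
  intro x x'
  obtain ⟨y, hy, hxy, e⟩ := h.exists_decomposition hD x
  obtain ⟨y', hy', hxy', e'⟩ := h.exists_decomposition hD x'
  have h1 := inner_graph_symm hD (h.graph_apply hy) (h.graph_apply hy')
  have h2 : ⟪ds y, x' - y'⟫_ℂ = 0 :=
    Submodule.inner_left_of_mem_orthogonal hxy' (h.mem_orthogonal y hy)
  have h3 : ⟪x - y, ds y'⟫_ℂ = 0 :=
    Submodule.inner_right_of_mem_orthogonal hxy (h.mem_orthogonal y' hy')
  rw [inner_sub_right, sub_eq_zero] at h2
  rw [inner_sub_left, sub_eq_zero] at h3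
  simp only [ContinuousLinearMap.coe_coe, e, e', h2, h1, h3]

/-- `D` sends both sides to `x`, so their difference lies in the kernel; it also lies in the
orthogonal complement of the kernel, hence vanishes. -/
theorem apply_eigen {t : ℝ} (ht : t ≠ 0) {x : H} (hx : x ∈ eigen D t) :
    ds x = ((t⁻¹ : ℝ) : ℂ) • x := by
  have ht' : (t : ℂ) ≠ 0 := by exact_mod_cast ht
  have hxk : x ∈ (kernel D)ᗮ := by
    rw [kernel_eq_eigen, Submodule.mem_orthogonal]
    exact fun y hy => inner_eigen_eq_zero hD ht.symm hy hx
  have h1 : (ds x - (t : ℂ)⁻¹ • x, (0 : H)) ∈ D.graph := by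
    have h2 := D.graph.smul_mem (t : ℂ)⁻¹ (mem_eigen.1 hx)
    have h3 := D.graph.sub_mem (h.graph_apply hxk) h2
    rw [Prod.smul_mk, Prod.mk_sub_mk, smul_smul, inv_mul_cancel₀ ht', one_smul, sub_self] at h3
    exact h3
  have h4 : ds x - (t : ℂ)⁻¹ • x ∈ kernel D := by
    rw [kernel_eq_eigen, mem_eigen]; simpa using h1
  have h5 : ds x - (t : ℂ)⁻¹ • x ∈ (kernel D)ᗮ :=
    Submodule.sub_mem _ (h.mem_orthogonal x hxk) (Submodule.smul_mem _ _ hxk)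
  have h6 : ds x - (t : ℂ)⁻¹ • x = 0 :=
    inner_self_eq_zero.1 (Submodule.inner_right_of_mem_orthogonal h4 h5)
  rw [sub_eq_zero.1 h6, Complex.ofReal_inv]

/-- Symmetry of `ds` makes the eigenvalue real; being in the range of `ds`, the vector is orthogonal
to the kernel, where `D` inverts `ds`. -/
theorem mem_eigen_of_apply {μ : ℂ} (hμ : μ ≠ 0) {x : H} (hx0 : x ≠ 0) (hx : ds x = μ • x) :
    ∃ t : ℝ, μ = ((t⁻¹ : ℝ) : ℂ) ∧ x ∈ eigen D t := by
  have hsymm := h.isSymmetric hD x x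
  simp only [ContinuousLinearMap.coe_coe, hx, inner_smul_left, inner_smul_right] at hsymm
  have hμr : (starRingEnd ℂ) μ = μ := mul_right_cancel₀ (inner_self_ne_zero.2 hx0) hsymm
  obtain ⟨r, rfl⟩ := Complex.conj_eq_iff_real.1 hμr
  have hxk : x ∈ (kernel D)ᗮ := by
    have : x = (r : ℂ)⁻¹ • ds x := by rw [hx, smul_smul, inv_mul_cancel₀ hμ, one_smul]
    rw [this]; exact Submodule.smul_mem _ _ (h.apply_mem_orthogonal hD x)
  refine ⟨r⁻¹, by rw [inv_inv], ?_⟩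
  have h2 := D.graph.smul_mem (r : ℂ)⁻¹ (h.graph_apply hxk)
  rw [hx, Prod.smul_mk, smul_smul, inv_mul_cancel₀ hμ, one_smul] at h2
  rw [mem_eigen, Complex.ofReal_inv]
  exact h2

theorem map_eigenSpan_orthogonal (I : Set ℝ) {x : H} (hx : x ∈ (eigenSpan D I)ᗮ) :
    ds x ∈ (eigenSpan D I)ᗮ := by
  have hinv : eigenSpan D I ≤ (eigenSpan D I).comap (ds : H →ₗ[ℂ] H) := by
    refine eigenSpan_le fun t ht y hy => ?_
    rw [Submodule.mem_comap, ContinuousLinearMap.coe_coe]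
    rcases eq_or_ne t 0 with rfl | ht0
    · rw [h.apply_kernel y (by rwa [kernel_eq_eigen])]; exact Submodule.zero_mem _
    · rw [h.apply_eigen hD ht0 hy]
      exact Submodule.smul_mem _ _ (eigen_le_eigenSpan ht hy)
  rw [Submodule.mem_orthogonal] at hx ⊢
  intro y hy
  have := h.isSymmetric hD y x
  simp only [ContinuousLinearMap.coe_coe] at this
  rw [← this]
  exact hx _ (hinv hy)

theorem finiteDimensional_eigenSpan (hc : IsCompactOperator ds) {I : Set ℝ} {r : ℝ} (hr : 0 < r)
    (hI : ∀ t ∈ I, t ≠ 0 ∧ |t| ≤ r) : FiniteDimensional ℂ (eigenSpan D I) := by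
  refine finiteDimensional_of_isCompactOperator hc _ (inv_pos.2 hr) fun x hx => ?_
  refine le_norm_of_mem_eigenSpan (g := fun t => t⁻¹) hD
    (fun t ht x hx => h.apply_eigen hD (hI t ht).1 hx) (inv_nonneg.2 hr.le) (fun t ht => ?_) hx
  rw [abs_inv]
  exact inv_anti₀ (abs_pos.2 (hI t ht).1) (hI t ht).2

/-- On the complement of the span, which `ds` preserves, an eigenvalue `1 / t` of `ds` with `|t| <
k` would have its eigenvector inside the span. -/
theorem charValue_le_of_eigenSpan (hc : IsCompactOperator ds) {I : Set ℝ} {k : ℕ}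
    (hI : ∀ t : ℝ, |t| < k → t ∈ I) (hk : 1 ≤ k) [FiniteDimensional ℂ (eigenSpan D I)] {m : ℕ}
    (hm : Module.finrank ℂ (eigenSpan D I) ≤ m) : charValue ds m ≤ 1 / k := by
  have hkpos : (0 : ℝ) < k := by exact_mod_cast hk
  refine charValue_le (eigenSpan D I) hm (by positivity) fun x hx => ?_
  refine norm_le_of_eigenvalues hc (h.isSymmetric hD) (Submodule.isClosed_orthogonal _)
    (fun y hy => h.map_eigenSpan_orthogonal hD I hy) (by positivity) ?_ hx
  intro y hy hy0 μ hμ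
  rcases eq_or_ne μ 0 with rfl | hμ0
  · rw [norm_zero]; positivity
  obtain ⟨t, rfl, ht⟩ := h.mem_eigen_of_apply hD hμ0 hy0 hμ
  rw [Complex.norm_real, Real.norm_eq_abs, abs_inv, ← one_div]
  refine one_div_le_one_div_of_le hkpos ?_
  by_contra hlt
  have := Submodule.inner_right_of_mem_orthogonal
    (eigen_le_eigenSpan (hI t (not_le.1 hlt)) ht) hy
  exact hy0 (inner_self_eq_zero.1 this)

theorem le_charValue_of_eigenSpan (hc : IsCompactOperator ds) {I : Set ℝ} {k : ℕ}
    (hI : ∀ t ∈ I, t ≠ 0 ∧ |t| ≤ k) (hk : 1 ≤ k) {m : ℕ}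
    (hm : m < Module.finrank ℂ (eigenSpan D I)) : 1 / k ≤ charValue ds m := by
  have hkpos : (0 : ℝ) < k := by exact_mod_cast hk
  have := h.finiteDimensional_eigenSpan hD hc hkpos hI
  refine le_charValue (eigenSpan D I) hm fun x hx => ?_
  refine le_norm_of_mem_eigenSpan (g := fun t => t⁻¹) hD
    (fun t ht x hx => h.apply_eigen hD (hI t ht).1 hx) (by positivity) (fun t ht => ?_) hx
  rw [abs_inv, ← one_div]
  exact one_div_le_one_div_of_le (abs_pos.2 (hI t ht).1) (hI t ht).2

end IsLineElement

namespace IsHeisenbergPair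

variable {U : H →L[ℂ] H} (hU : IsHeisenbergPair D U)
include hU

theorem map_eigen {t : ℝ} {x : H} (hx : x ∈ eigen D t) : U x ∈ eigen D (t + 1) := by
  have := hU.graph_apply (mem_eigen.1 hx)
  rw [mem_eigen, Complex.ofReal_add, Complex.ofReal_one, add_smul, one_smul]
  rwa [map_smul] at this

theorem star_map_eigen {t : ℝ} {x : H} (hx : x ∈ eigen D (t + 1)) : star U x ∈ eigen D t := by
  have := hU.graph_star_apply (mem_eigen.1 hx)
  rw [map_smul, Complex.ofReal_add, Complex.ofReal_one, add_smul, one_smul, add_sub_cancel_right]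
    at this
  exact this

theorem map_eigenSpan {I J : Set ℝ} (hIJ : ∀ t, t ∈ I ↔ t + 1 ∈ J) :
    (eigenSpan D I).map (U : H →ₗ[ℂ] H) = eigenSpan D J := by
  apply le_antisymm
  · rw [Submodule.map_le_iff_le_comap]
    exact eigenSpan_le fun t ht x hx => eigen_le_eigenSpan ((hIJ t).1 ht) (hU.map_eigen hx)
  · refine eigenSpan_le fun t ht x hx => ?_
    refine ⟨star U x, ?_, hU.apply_star_apply x⟩
    have ht' : t - 1 + 1 = t := sub_add_cancel t 1
    refine eigen_le_eigenSpan ((hIJ (t - 1)).2 (by rwa [ht'])) (hU.star_map_eigen ?_)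
    rwa [ht']

theorem injective : Function.Injective (U : H →ₗ[ℂ] H) := fun x y hxy => by
  rw [← hU.star_apply_apply x, ← hU.star_apply_apply y]
  exact congrArg (fun z => (star U) z) hxy

/-- The span of the eigenspaces for the eigenvalues in `[j, j + k)`. -/
theorem eigenSpan_Ico {ds : H →L[ℂ] H} (h : IsLineElement D ds) (hc : IsCompactOperator ds) :
    ∃ n : ℕ, ∀ (j : ℤ) (k : ℕ), FiniteDimensional ℂ (eigenSpan D (Set.Ico (j : ℝ) (j + k))) ∧
      Module.finrank ℂ (eigenSpan D (Set.Ico (j : ℝ) (j + k))) = k * n := by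
  have hD := hU.selfAdjoint
  -- The base interval avoids `0`: compactness of `ds` gives no information on the kernel of `D`,
  -- whose finite dimension comes from the shift by `U`.
  set n := Module.finrank ℂ (eigenSpan D (Set.Ico (1 : ℝ) (1 + 1))) with hn
  have step : ∀ j : ℤ, (eigenSpan D (Set.Ico (j : ℝ) (j + 1))).map (U : H →ₗ[ℂ] H) =
      eigenSpan D (Set.Ico ((j + 1 : ℤ) : ℝ) ((j + 1 : ℤ) + 1)) := fun j =>
    hU.map_eigenSpan fun t => by simp
  have unit : ∀ j : ℤ, FiniteDimensional ℂ (eigenSpan D (Set.Ico (j : ℝ) (j + 1))) ∧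
      Module.finrank ℂ (eigenSpan D (Set.Ico (j : ℝ) (j + 1))) = n := by
    intro j
    induction j using Int.inductionOn' (b := 1) with
    | zero =>
      refine ⟨?_, by rw [hn, Int.cast_one]⟩
      refine h.finiteDimensional_eigenSpan hD hc two_pos fun t ht => ?_
      rw [Int.cast_one] at ht
      exact ⟨by linarith [ht.1], abs_le.2 ⟨by linarith [ht.1], by linarith [ht.2]⟩⟩
    | succ j _ ih =>
      have := ih.1
      rw [← step j]
      exact ⟨inferInstance,
        (LinearEquiv.finrank_eq (Submodule.equivMapOfInjective _ hU.injective _)).symm.trans ih.2⟩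
    | pred j _ ih =>
      have e := step (j - 1)
      rw [sub_add_cancel] at e
      rw [← e] at ih
      have := ih.1
      let E := Submodule.equivMapOfInjective _ hU.injective
        (eigenSpan D (Set.Ico ((j - 1 : ℤ) : ℝ) ((j - 1 : ℤ) + 1)))
      exact ⟨E.symm.finiteDimensional, E.finrank_eq.trans ih.2⟩
  refine ⟨n, fun j k => ?_⟩
  induction k with
  | zero =>
    have : eigenSpan D (Set.Ico (j : ℝ) (j + (0 : ℕ))) = ⊥ := by
      rw [Nat.cast_zero, add_zero, Set.Ico_self]
      exact le_bot_iff.1 (eigenSpan_le fun t ht => absurd ht (Set.notMem_empty t))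
    rw [this]
    exact ⟨inferInstance, by simp⟩
  | succ k ih =>
    have := ih.1
    obtain ⟨h1, h2⟩ := unit (j + k)
    rw [Int.cast_add, Int.cast_natCast] at h1 h2
    have hun : Set.Ico (j : ℝ) (j + (k + 1 : ℕ)) =
        Set.Ico (j : ℝ) (j + k) ∪ Set.Ico ((j : ℝ) + k) (j + k + 1) := by
      rw [Set.Ico_union_Ico_eq_Ico (by simp) (by simp)]; push_cast; rw [add_assoc]
    have hdis : Disjoint (Set.Ico (j : ℝ) (j + k)) (Set.Ico ((j : ℝ) + k) (j + k + 1)) :=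
      Set.Ico_disjoint_Ico_same
    rw [hun]
    refine ⟨?_, by rw [finrank_eigenSpan_union hD hdis, ih.2, h2]; ring⟩
    rw [eigenSpan_union]; infer_instance

theorem hasNCIntegral {ds : H →L[ℂ] H} (h : IsLineElement D ds) (hc : IsCompactOperator ds) :
    ∃ n : ℕ, HasNCIntegral (CFC.abs ds) n := by
  have hD := hU.selfAdjoint
  obtain ⟨n, hn⟩ := hU.eigenSpan_Ico h hc
  have hlim : Tendsto (logMean (CFC.abs ds)) atTop (𝓝 ((2 * n : ℕ) : ℝ)) := by
    refine tendsto_sum_div_log (tendsto_mul_of_block_bounds n (charValue_nonneg _) ?_ ?_)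
    · intro m k hk hm
      rw [charValue_congr (norm_abs_apply ds)]
      -- The interval `[-k, k)`, made of `2 * k` unit intervals.
      obtain ⟨h1, h2⟩ := hn (-k) (2 * k)
      refine h.charValue_le_of_eigenSpan hD hc (I := Set.Ico _ _) ?_ hk (h2.trans_le hm)
      intro t ht
      obtain ⟨h3, h4⟩ := abs_lt.1 ht
      push_cast
      exact ⟨h3.le, by linarith⟩
    · intro m k hk hm
      rw [charValue_congr (norm_abs_apply ds)]
      obtain ⟨h1, h2⟩ := hn (-k) (2 * k)
      -- The kernel, where `ds` vanishes, must be removed from the span for `[-k, k)`. It is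
      -- contained in the span for `[0, 1)`, so this costs at most `n` dimensions.
      obtain ⟨h3, h4⟩ := hn 0 1
      set J : Set ℝ := Set.Ico ((-k : ℤ) : ℝ) ((-k : ℤ) + (2 * k : ℕ)) with hJ
      have hJ0 : ∀ t ∈ J \ {0}, t ≠ 0 ∧ |t| ≤ k := by
        rintro t ⟨ht, ht0⟩
        rw [hJ] at ht
        push_cast at ht
        exact ⟨ht0, abs_le.2 ⟨ht.1, by linarith [ht.2]⟩⟩
      refine h.le_charValue_of_eigenSpan hD hc hJ0 hk ?_
      have hkpos : (0 : ℝ) < k := by exact_mod_cast hk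
      have := h.finiteDimensional_eigenSpan hD hc hkpos hJ0
      have h0le : eigenSpan D {0} ≤ eigenSpan D (Set.Ico ((0 : ℤ) : ℝ) ((0 : ℤ) + (1 : ℕ))) :=
        eigenSpan_mono (by rw [Set.singleton_subset_iff]; norm_num)
      have : FiniteDimensional ℂ (eigenSpan D {0}) := Submodule.finiteDimensional_of_le h0le
      have h5 := Submodule.finrank_mono h0le
      have hunion : J \ {0} ∪ {0} = J := by
        rw [Set.sdiff_union_self, Set.union_eq_left, Set.singleton_subset_iff, hJ]
        push_cast
        constructor <;> linarith
      have h6 := finrank_eigenSpan_union hD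
        (Set.disjoint_sdiff_left : Disjoint (J \ {0}) ({0} : Set ℝ))
      rw [hunion, h2] at h6
      omega
  refine ⟨2 * n, isCompactOperator_of_norm_eq (norm_abs_apply ds) hc, hlim, fun lim hlim' => ?_⟩
  obtain ⟨C, hC⟩ := (Metric.isBounded_range_of_tendsto _ hlim).exists_norm_le
  let s : ℕ →ᵇ ℝ := BoundedContinuousFunction.ofNormedAddCommGroupDiscrete
    (logMean (CFC.abs ds)) C fun n => hC _ ⟨n, rfl⟩
  exact ⟨s, fun _ => rfl, hlim'.limit s _ hlim⟩

end IsHeisenbergPair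
end LineElement

/-! ### Existence of approximate eigenvalues. -/

section ApproximateEigenvectors

variable {H : Type*} [NormedAddCommGroup H] [InnerProductSpace ℂ H] [CompleteSpace H]

/-- A normal operator that is bounded below is invertible. -/
theorem isUnit_of_le_norm {T : H →L[ℂ] H} (hT : IsStarNormal T) {c : ℝ} (hc : 0 < c)
    (h : ∀ x, c * ‖x‖ ≤ ‖T x‖) : IsUnit T := by
  rw [ContinuousLinearMap.isUnit_iff_bijective]
  have hS : AntilipschitzWith (Real.toNNReal c⁻¹) T := by
    refine AddMonoidHomClass.antilipschitz_of_bound T fun x => ?_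
    rw [Real.coe_toNNReal _ (by positivity), ← div_eq_inv_mul, le_div_iff₀ hc, mul_comm]
    exact h x
  refine ⟨hS.injective, ?_⟩
  have hcl : IsClosed (T.range : Set H) := hS.isClosed_range T.uniformContinuous
  have hker : T.ker = ⊥ := LinearMap.ker_eq_bot.2 hS.injective
  have h1 : T.rangeᗮ = ⊥ := by rw [ContinuousLinearMap.IsStarNormal.orthogonal_range hT, hker]
  have : CompleteSpace T.range := hcl.completeSpace_coe
  exact LinearMap.range_eq_top.1 (Submodule.orthogonal_eq_bot_iff.1 h1)

/-- A self-adjoint operator that is bounded below has a bounded everywhere defined inverse. -/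
theorem exists_inverse_of_le_norm {D : H →ₗ.[ℂ] H} (hD : IsSelfAdjoint D) {c : ℝ} (hc : 0 < c)
    (h : ∀ x y : H, (x, y) ∈ D.graph → c * ‖x‖ ≤ ‖y‖) :
    ∃ R : H →L[ℂ] H, ∀ y, (R y, y) ∈ D.graph := by
  let p : D.graph →L[ℂ] H := (ContinuousLinearMap.snd ℂ H H) ∘L D.graph.subtypeL
  have : CompleteSpace D.graph := (graph_isClosed hD).completeSpace_coe
  have hp : AntilipschitzWith (Real.toNNReal (max c⁻¹ 1)) p := by
    refine AddMonoidHomClass.antilipschitz_of_bound p fun z => ?_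
    rw [Real.coe_toNNReal _ (by positivity)]
    refine max_le ?_ ?_
    · calc ‖(z : H × H).1‖ ≤ c⁻¹ * ‖(z : H × H).2‖ := by
            rw [← div_eq_inv_mul, le_div_iff₀ hc, mul_comm]; exact h _ _ z.2
        _ ≤ _ := mul_le_mul_of_nonneg_right (le_max_left _ _) (norm_nonneg _)
    · calc ‖(z : H × H).2‖ = 1 * ‖(z : H × H).2‖ := (one_mul _).symm
        _ ≤ _ := mul_le_mul_of_nonneg_right (le_max_right _ _) (norm_nonneg _)
  have hcl : IsClosed (p.range : Set H) := hp.isClosed_range p.uniformContinuous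
  have : CompleteSpace p.range := hcl.completeSpace_coe
  have hbot : p.rangeᗮ = ⊥ := by
    -- A vector orthogonal to the range of `D` lies in the kernel of the adjoint, which is `D`; the
    -- lower bound then kills it.
    rw [eq_bot_iff]
    intro z hz
    have hz0 : (z, (0 : H)) ∈ D.graph := mem_graph_of_inner hD fun x' y' h' => by
      rw [inner_zero_left]
      exact (Submodule.inner_left_of_mem_orthogonal (K := p.range) ⟨⟨(x', y'), h'⟩, rfl⟩ hz).symm
    have := h z 0 hz0
    rw [norm_zero] at this
    rw [Submodule.mem_bot, ← norm_le_zero_iff]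
    nlinarith [norm_nonneg z]
  have hsurj : Function.Surjective p :=
    LinearMap.range_eq_top.1 (Submodule.orthogonal_eq_bot_iff.1 hbot)
  let E := LinearEquiv.ofBijective (p : D.graph →ₗ[ℂ] H) ⟨hp.injective, hsurj⟩
  have hE : ∀ y, ((E.symm y : H × H)).2 = y := fun y => E.apply_symm_apply y
  let R0 : H →ₗ[ℂ] H := LinearMap.fst ℂ H H ∘ₗ D.graph.subtype ∘ₗ E.symm.toLinearMap
  have hR0 : ∀ y, (R0 y, y) ∈ D.graph := fun y => by
    have := (E.symm y).2
    have e : ((E.symm y : H × H)) = (R0 y, y) := Prod.ext rfl (hE y)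
    rwa [e] at this
  exact ⟨R0.mkContinuous c⁻¹ fun y => by
    rw [← div_eq_inv_mul, le_div_iff₀ hc, mul_comm]; exact h _ _ (hR0 y), hR0⟩

/-- The spectrum of a self-adjoint operator is not empty. -/
theorem exists_approximate_eigenvalue [Nontrivial H] {D : H →ₗ.[ℂ] H} (hD : IsSelfAdjoint D) :
    ∃ l : ℝ, ∀ ε > 0, ∃ x y : H, (x, y) ∈ D.graph ∧ ‖x‖ = 1 ∧ ‖y - (l : ℂ) • x‖ < ε := by
  by_contra hcon
  push Not at hcon
  have hlow : ∀ l : ℝ, ∃ c > 0, ∀ x y : H, (x, y) ∈ D.graph → c * ‖x‖ ≤ ‖y - (l : ℂ) • x‖ := by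
    intro l
    obtain ⟨c, hc, hl⟩ := hcon l
    refine ⟨c, hc, fun x y hxy => ?_⟩
    rcases eq_or_ne x 0 with rfl | hx
    · simp
    have hn : ‖x‖ ≠ 0 := norm_ne_zero_iff.2 hx
    have h1 := hl _ _ (D.graph.smul_mem ((‖x‖⁻¹ : ℝ) : ℂ) hxy) (by
      rw [norm_smul, Complex.norm_real, norm_inv, norm_norm, inv_mul_cancel₀ hn])
    simp only at h1
    rw [smul_comm, ← smul_sub, norm_smul, Complex.norm_real, norm_inv, norm_norm,
      ← div_eq_inv_mul, le_div_iff₀ (norm_pos_iff.2 hx)] at h1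
    exact h1
  obtain ⟨c, hc, h0⟩ := hlow 0
  obtain ⟨R, hR⟩ := exists_inverse_of_le_norm hD hc fun x y hxy => by simpa using h0 x y hxy
  have hRs : IsSelfAdjoint R := by
    rw [ContinuousLinearMap.isSelfAdjoint_iff_isSymmetric]
    exact fun x y => (inner_graph_symm hD (hR x) (hR y))
  -- If no real number is an approximate eigenvalue, `R = D⁻¹` is bounded and self-adjoint, and for
  -- real `r ≠ 0` the operator `r - R = r (D - r⁻¹) R` is bounded below, hence invertible. So the
  -- spectral radius is zero and `R = 0`, which is absurd.
  have hspec : ∀ μ ∈ spectrum ℂ R, μ = 0 := by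
    intro μ hμ
    by_contra hμ0
    have hre : μ = (μ.re : ℂ) := hRs.mem_spectrum_eq_re hμ
    set r := μ.re
    have hr0 : r ≠ 0 := fun e => hμ0 (by rw [hre, e]; rfl)
    have hrc : (r : ℂ) ≠ 0 := by exact_mod_cast hr0
    rw [hre] at hμ
    obtain ⟨d, hd, hdl⟩ := hlow r⁻¹
    -- With `z = (r - R) y`, the constant combines `|r| ‖y‖ ≤ ‖z‖ + ‖R y‖` with `‖R y‖ ≤ ‖z‖ / (d
    -- |r|)`.
    refine hμ (isUnit_of_le_norm (c := |r| / (1 / (d * |r|) + 1)) ?_ (by positivity) fun y => ?_)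
    · exact ((IsSelfAdjoint.algebraMap _ (Complex.conj_ofReal r)).sub hRs).isStarNormal
    · have e : (algebraMap ℂ (H →L[ℂ] H) r - R) y = (r : ℂ) • (y - ((r⁻¹ : ℝ) : ℂ) • R y) := by
        rw [smul_sub, smul_smul, Complex.ofReal_inv, mul_inv_cancel₀ hrc, one_smul,
          sub_apply, Algebra.algebraMap_eq_smul_one,
          smul_apply, one_apply_eq_self]
      set z := (algebraMap ℂ (H →L[ℂ] H) r - R) y with hz
      have h1 := hdl _ _ (hR y)
      have h2 : ‖z‖ = |r| * ‖y - ((r⁻¹ : ℝ) : ℂ) • R y‖ := by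
        rw [e, norm_smul, Complex.norm_real, Real.norm_eq_abs]
      have h3 : |r| * ‖y‖ ≤ ‖z‖ + ‖R y‖ := by
        have : (r : ℂ) • y = z + R y := by
          rw [hz, sub_apply, Algebra.algebraMap_eq_smul_one,
            smul_apply, one_apply_eq_self, sub_add_cancel]
        rw [← Real.norm_eq_abs, ← Complex.norm_real, ← norm_smul, this]
        exact norm_add_le _ _
      have hrpos : 0 < |r| := abs_pos.2 hr0
      have h4 : ‖R y‖ ≤ 1 / (d * |r|) * ‖z‖ := by
        rw [h2, div_mul_eq_mul_div, one_mul, le_div_iff₀ (by positivity)]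
        calc ‖R y‖ * (d * |r|) = |r| * (d * ‖R y‖) := by ring
          _ ≤ _ := by gcongr
      rw [div_mul_eq_mul_div, div_le_iff₀ (by positivity)]
      calc |r| * ‖y‖ ≤ ‖z‖ + ‖R y‖ := h3
        _ ≤ ‖z‖ + 1 / (d * |r|) * ‖z‖ := by gcongr
        _ = _ := by ring
  have hR0 : R = 0 := by
    have h1 := R.spectralRadius_eq_nnnorm hRs
    have h2 : spectralRadius ℂ R = 0 := by
      refine le_antisymm (iSup₂_le fun μ hμ => ?_) zero_le
      rw [hspec μ hμ]; simp
    rw [h2] at h1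
    exact nnnorm_eq_zero.1 (by exact_mod_cast h1.symm)
  obtain ⟨y, hy⟩ := exists_ne (0 : H)
  have := hR y
  rw [hR0] at this
  exact hy (D.graph_fst_eq_zero_snd this rfl)

end ApproximateEigenvectors

/-! ### Trigonometric polynomials paired with their derivatives. -/

section TrigonometricPolynomials

instance two_pi_pos_fact : Fact (0 < 2 * Real.pi) := ⟨Real.two_pi_pos⟩

/-- The circle of length `2 π`. -/
abbrev Angles : Type := AddCircle (2 * Real.pi)

/-- The pairs `(P, -i P')` for trigonometric polynomials `P`. -/
def trigPairs : Submodule ℂ (C(Angles, ℂ) × C(Angles, ℂ)) :=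
  Submodule.span ℂ (Set.range fun k : ℤ => (fourier k, (k : ℂ) • fourier k))

theorem fourier_mem_trigPairs (k : ℤ) : (fourier k, (k : ℂ) • fourier k) ∈ trigPairs :=
  Submodule.subset_span ⟨k, rfl⟩

/-- Induction for pairs of trigonometric polynomials. -/
theorem trigPairs_induction {p : C(Angles, ℂ) → C(Angles, ℂ) → Prop}
    (hf : ∀ k : ℤ, p (fourier k) ((k : ℂ) • fourier k))
    (hz : p 0 0) (ha : ∀ P Q P' Q', p P Q → p P' Q' → p (P + P') (Q + Q'))
    (hs : ∀ (c : ℂ) P Q, p P Q → p (c • P) (c • Q)) {P Q : C(Angles, ℂ)}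
    (h : (P, Q) ∈ trigPairs) : p P Q := by
  refine Submodule.span_induction (p := fun z _ => p z.1 z.2) ?_ hz
    (fun x y _ _ hx hy => ha _ _ _ _ hx hy) (fun c x _ hx => hs c _ _ hx) h
  rintro _ ⟨k, rfl⟩
  exact hf k

theorem hasDerivAt_of_mem_trigPairs {P Q : C(Angles, ℂ)} (h : (P, Q) ∈ trigPairs) (t : ℝ) :
    HasDerivAt (fun s : ℝ => P (s : Angles)) (Complex.I * Q (t : Angles)) t := by
  refine trigPairs_induction (p := fun P Q =>
    HasDerivAt (fun s : ℝ => P (s : Angles)) (Complex.I * Q (t : Angles)) t) ?_ ?_ ?_ ?_ h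
  · intro k
    have := hasDerivAt_fourier (2 * Real.pi) k t
    convert! this using 1
    simp only [ContinuousMap.smul_apply, smul_eq_mul]
    push_cast
    field_simp
  · simpa using hasDerivAt_const t (0 : ℂ)
  · intro P Q P' Q' h h'
    rw [ContinuousMap.add_apply, mul_add]
    exact h.add h'
  · intro c P Q h
    have := h.const_mul c
    simp only [ContinuousMap.smul_apply, smul_eq_mul]
    rwa [mul_left_comm]

theorem star_mem_trigPairs {P Q : C(Angles, ℂ)} (h : (P, Q) ∈ trigPairs) :
    (star P, -star Q) ∈ trigPairs := by
  refine trigPairs_induction (p := fun P Q => (star P, -star Q) ∈ trigPairs) ?_ ?_ ?_ ?_ h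
  · intro k
    convert! fourier_mem_trigPairs (-k) using 1
    ext x
    · simp
    · simp
  · convert! trigPairs.zero_mem using 1
    ext x <;> simp
  · intro P Q P' Q' h h'
    convert! trigPairs.add_mem h h' using 1
    simp [add_comm]
  · intro c P Q h
    convert! trigPairs.smul_mem (star c) h using 1
    simp

theorem mul_mem_trigPairs {P Q P' Q' : C(Angles, ℂ)} (h : (P, Q) ∈ trigPairs)
    (h' : (P', Q') ∈ trigPairs) : (P * P', P * Q' + Q * P') ∈ trigPairs := by
  refine trigPairs_induction (p := fun P Q => (P * P', P * Q' + Q * P') ∈ trigPairs)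
    ?_ ?_ ?_ ?_ h
  · intro k
    refine trigPairs_induction (p := fun P' Q' =>
      (fourier k * P', fourier k * Q' + ((k : ℂ) • fourier k) * P') ∈ trigPairs) ?_ ?_ ?_ ?_ h'
    · intro l
      convert! fourier_mem_trigPairs (k + l) using 1
      ext x
      · simp only [ContinuousMap.mul_apply, fourier_add]
      · simp only [ContinuousMap.mul_apply, ContinuousMap.add_apply, ContinuousMap.smul_apply,
          fourier_add, smul_eq_mul]
        push_cast; ring
    · convert! trigPairs.zero_mem using 1
      ext x <;> simp
    · intro P Q P' Q' h h'
      convert! trigPairs.add_mem h h' using 1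
      rw [Prod.mk_add_mk]; congr 1 <;> ring
    · intro c P Q h
      convert! trigPairs.smul_mem c h using 1
      rw [Prod.smul_mk, mul_smul_comm, mul_smul_comm, mul_smul_comm, smul_add]
  · convert! trigPairs.zero_mem using 1
    ext x <;> simp
  · intro P Q P'' Q'' h h'
    convert! trigPairs.add_mem h h' using 1
    rw [Prod.mk_add_mk]; congr 1 <;> ring
  · intro c P Q h
    convert! trigPairs.smul_mem c h using 1
    rw [Prod.smul_mk, smul_mul_assoc, smul_mul_assoc, smul_mul_assoc, smul_add]

theorem exists_pow_mem_trigPairs {P Q : C(Angles, ℂ)} (h : (P, Q) ∈ trigPairs) (n : ℕ) :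
    ∃ R, (P ^ n, R) ∈ trigPairs := by
  induction n with
  | zero =>
    refine ⟨0, ?_⟩
    convert! fourier_mem_trigPairs 0 using 1
    ext x <;> simp
  | succ n ih =>
    obtain ⟨R, hR⟩ := ih
    exact ⟨_, by rw [pow_succ]; exact mul_mem_trigPairs hR h⟩

/-- The translate of a function on the circle. -/
def translate (t : Angles) (P : C(Angles, ℂ)) : C(Angles, ℂ) :=
  P.comp ⟨fun x => x - t, by fun_prop⟩

@[simp] theorem translate_apply (t : Angles) (P : C(Angles, ℂ)) (x : Angles) :
    translate t P x = P (x - t) := rfl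

theorem fourier_sub_apply (k : ℤ) (x t : Angles) :
    fourier k (x - t) = (fourier k x : ℂ) * fourier (-k) t := by
  rw [fourier_apply, fourier_apply, fourier_apply, smul_sub, neg_smul, sub_eq_add_neg,
    AddCircle.toCircle_add, Circle.coe_mul]

theorem translate_mem_trigPairs (t : Angles) {P Q : C(Angles, ℂ)} (h : (P, Q) ∈ trigPairs) :
    (translate t P, translate t Q) ∈ trigPairs := by
  refine trigPairs_induction (p := fun P Q => (translate t P, translate t Q) ∈ trigPairs)
    ?_ ?_ ?_ ?_ h
  · intro k
    convert! trigPairs.smul_mem (fourier (-k) t : ℂ) (fourier_mem_trigPairs k) using 1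
    ext x
    · simp only [translate_apply, fourier_sub_apply, Prod.smul_mk, ContinuousMap.smul_apply,
        smul_eq_mul]
      ring
    · simp only [translate_apply, fourier_sub_apply, Prod.smul_mk, ContinuousMap.smul_apply,
        smul_eq_mul]
      ring
  · exact trigPairs.zero_mem
  · intro P Q P' Q' h h'
    exact trigPairs.add_mem h h'
  · intro c P Q h
    exact trigPairs.smul_mem c h

/-- The mean value of a continuous function on the circle. -/
def mean (P : C(Angles, ℂ)) : ℂ := ∫ x, P x ∂AddCircle.haarAddCircle

theorem integrable_angles {E : Type*} [NormedAddCommGroup E] {f : Angles → E}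
    (hf : Continuous f) : Integrable f AddCircle.haarAddCircle := by
  rw [← integrableOn_univ]
  exact hf.continuousOn.integrableOn_compact isCompact_univ

theorem mean_add (P Q : C(Angles, ℂ)) : mean (P + Q) = mean P + mean Q :=
  integral_add (integrable_angles P.continuous) (integrable_angles Q.continuous)

theorem mean_smul (c : ℂ) (P : C(Angles, ℂ)) : mean (c • P) = c * mean P :=
  integral_const_mul c _

theorem mean_zero : mean 0 = 0 := integral_zero _ _

theorem norm_mean_le (P : C(Angles, ℂ)) : ‖mean P‖ ≤ ‖P‖ := by
  refine (norm_integral_le_integral_norm _).trans ?_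
  calc ∫ x, ‖P x‖ ∂AddCircle.haarAddCircle ≤ ∫ _, ‖P‖ ∂AddCircle.haarAddCircle :=
        integral_mono (integrable_angles (by fun_prop)) (integrable_const _) fun x =>
          P.norm_coe_le_norm x
    _ = ‖P‖ := by simp

theorem mean_fourier (k : ℤ) : mean (fourier k) = if k = 0 then 1 else 0 := by
  have h := congrFun (fourierCoeff_fourier (T := 2 * Real.pi) k) 0
  simp only [fourierCoeff, neg_zero, fourier_zero, one_smul, Pi.single_apply] at h
  rw [mean, h]
  simp only [eq_comm]

/-- The correlation of a continuous function with the translates of another one. -/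
theorem correlation_mem_trigPairs (F : C(Angles, ℂ)) {P Q : C(Angles, ℂ)}
    (h : (P, Q) ∈ trigPairs) : ∃ P' Q', (P', Q') ∈ trigPairs ∧
      (∀ t, P' t = mean (F * translate t P)) ∧ ∀ t, Q' t = -mean (F * translate t Q) := by
  refine trigPairs_induction (p := fun P Q => ∃ P' Q', (P', Q') ∈ trigPairs ∧
      (∀ t, P' t = mean (F * translate t P)) ∧ ∀ t, Q' t = -mean (F * translate t Q))
    ?_ ?_ ?_ ?_ h
  · intro k
    -- Translation only multiplies a character by a scalar, so its correlation is a multiple of the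
    -- character of index `-k`. The change from `k` to `-k` is the minus sign in the statement on
    -- `Q'`.
    have e : ∀ t, F * translate t (fourier k) = (fourier (-k) t : ℂ) • (F * fourier k) := by
      intro t
      ext x
      simp only [ContinuousMap.mul_apply, translate_apply, fourier_sub_apply,
        ContinuousMap.smul_apply, smul_eq_mul]
      ring
    have e' : ∀ t, F * translate t ((k : ℂ) • fourier k) =
        (k * fourier (-k) t : ℂ) • (F * fourier k) := by
      intro t
      ext x
      simp only [ContinuousMap.mul_apply, translate_apply, fourier_sub_apply,
        ContinuousMap.smul_apply, smul_eq_mul]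
      ring
    refine ⟨_, _, trigPairs.smul_mem (mean (F * fourier k)) (fourier_mem_trigPairs (-k)), ?_, ?_⟩
    · intro t
      rw [e, mean_smul, ContinuousMap.smul_apply, smul_eq_mul, mul_comm]
    · intro t
      rw [e', mean_smul]
      simp only [ContinuousMap.smul_apply, smul_eq_mul]
      push_cast
      ring
  · refine ⟨0, 0, trigPairs.zero_mem, fun t => ?_, fun t => ?_⟩
    · have : F * translate t 0 = 0 := by ext x; simp
      rw [this, mean_zero]; rfl
    · have : F * translate t 0 = 0 := by ext x; simp
      rw [this, mean_zero, neg_zero]; rfl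
  · rintro P Q P' Q' ⟨A, B, hAB, hA, hB⟩ ⟨A', B', hAB', hA', hB'⟩
    refine ⟨_, _, trigPairs.add_mem hAB hAB', fun t => ?_, fun t => ?_⟩
    · have : F * translate t (P + P') = F * translate t P + F * translate t P' := by
        ext x; simp [mul_add]
      rw [this, mean_add, ContinuousMap.add_apply, hA, hA']
    · have : F * translate t (Q + Q') = F * translate t Q + F * translate t Q' := by
        ext x; simp [mul_add]
      rw [this, mean_add, ContinuousMap.add_apply, hB, hB', neg_add]
  · rintro c P Q ⟨A, B, hAB, hA, hB⟩
    refine ⟨_, _, trigPairs.smul_mem c hAB, fun t => ?_, fun t => ?_⟩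
    · have : F * translate t (c • P) = c • (F * translate t P) := by
        ext x; simp [mul_left_comm]
      rw [this, mean_smul, ContinuousMap.smul_apply, hA, smul_eq_mul]
    · have : F * translate t (c • Q) = c • (F * translate t Q) := by
        ext x; simp [mul_left_comm]
      rw [this, mean_smul, ContinuousMap.smul_apply, hB, smul_eq_mul, mul_neg]

end TrigonometricPolynomials

/-! ### A peak kernel that is the square modulus of a trigonometric polynomial. -/

section PeakKernel

/-- The function `((1 + z) / 2) ^ n` on the circle. -/
def peakRoot (n : ℕ) : C(Angles, ℂ) := ((2⁻¹ : ℂ) • (fourier 0 + fourier 1)) ^ n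

theorem exists_peakRoot_mem_trigPairs (n : ℕ) : ∃ R, (peakRoot n, R) ∈ trigPairs :=
  exists_pow_mem_trigPairs (trigPairs.smul_mem (2⁻¹ : ℂ)
    (trigPairs.add_mem (fourier_mem_trigPairs 0) (fourier_mem_trigPairs 1))) n

/-- The function `|(1 + z) / 2| ^ 2` on the circle. -/
def peak (x : Angles) : ℝ := ‖(2⁻¹ : ℂ) * (1 + fourier 1 x)‖ ^ 2

theorem continuous_peak : Continuous peak := by unfold peak; fun_prop

/-- The kernel is needed in the form `q* q`, because the operator estimate is obtained by
sandwiching between `q(U)*` and `q(U)`. -/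
theorem star_mul_peakRoot_apply (n : ℕ) (x : Angles) :
    (star (peakRoot n) * peakRoot n) x = ((peak x ^ n : ℝ) : ℂ) := by
  have : (peakRoot n) x = ((2⁻¹ : ℂ) * (1 + fourier 1 x)) ^ n := by
    simp [peakRoot, mul_add]
  rw [ContinuousMap.mul_apply, ContinuousMap.star_apply, this, RCLike.star_def, Complex.conj_mul',
    norm_pow, peak]
  push_cast
  ring

theorem peak_zero : peak 0 = 1 := by
  simp [peak]; norm_num

theorem peak_lt {x : Angles} (hx : x ≠ 0) : peak x < 1 := by
  have hz : (fourier 1 x : ℂ) ≠ 1 := by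
    rw [fourier_one, ← Circle.coe_one, ne_eq, Circle.coe_inj,
      ← AddCircle.toCircle_zero (T := 2 * Real.pi)]
    exact fun h => hx (AddCircle.injective_toCircle Real.two_pi_pos.ne' h)
  have h1 : ‖(fourier 1 x : ℂ)‖ = 1 := by rw [fourier_one, Circle.norm_coe]
  have h2 : ‖(1 : ℂ) + fourier 1 x‖ < 2 := by
    generalize (fourier 1 x : ℂ) = z at hz h1
    have h3 : z.re * z.re + z.im * z.im = 1 := by
      rw [← Complex.normSq_apply, Complex.normSq_eq_norm_sq, h1, one_pow]
    have h4 : z.re < 1 := by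
      refine lt_of_le_of_ne (by nlinarith) fun e => hz (Complex.ext e ?_)
      rw [e] at h3
      simpa using h3
    refine lt_of_pow_lt_pow_left₀ 2 two_pos.le ?_
    rw [← Complex.normSq_eq_norm_sq, Complex.normSq_apply]
    simp only [Complex.add_re, Complex.one_re, Complex.add_im, Complex.one_im]
    nlinarith
  rw [peak, norm_mul, norm_inv]
  have : ‖(2 : ℂ)‖⁻¹ * ‖(1 : ℂ) + fourier 1 x‖ < 1 := by
    rw [← div_eq_inv_mul, div_lt_one (by simp)]; simpa using h2
  exact pow_lt_one₀ (by positivity) this two_ne_zero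

/-- Normalized powers of a function with a unique maximum concentrate at that maximum. -/
theorem tendsto_peak_average {F : Angles → ℂ} (hF : Continuous F) :
    Tendsto (fun n : ℕ => (∫ x, peak x ^ n ∂AddCircle.haarAddCircle)⁻¹ •
      ∫ x, peak x ^ n • F x ∂AddCircle.haarAddCircle) atTop (𝓝 (F 0)) := by
  have := tendsto_setIntegral_pow_smul_of_unique_maximum_of_isCompact_of_continuousOn
    (μ := (AddCircle.haarAddCircle : Measure Angles)) (s := Set.univ) (x₀ := 0) isCompact_univ
    continuous_peak.continuousOn (fun y _ hy => by rw [peak_zero]; exact peak_lt hy)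
    (fun x _ => by unfold peak; positivity) (by rw [peak_zero]; exact one_pos) (by simp)
    hF.continuousOn
  simpa only [Measure.restrict_univ] using this

theorem integral_peak_pos (n : ℕ) : 0 < ∫ x, peak x ^ n ∂AddCircle.haarAddCircle := by
  refine (continuous_peak.pow n).integral_pos_of_hasCompactSupport_nonneg_nonzero
    (HasCompactSupport.of_compactSpace _) (fun x => ?_) (x := 0) ?_
  · simp only [Pi.zero_apply]; unfold peak; positivity
  · simp [peak_zero]

end PeakKernel

/-! ### Functional calculus on the circle, limiting vector states and the spectrum. -/

section Spectrum

variable {H : Type*} [NormedAddCommGroup H] [InnerProductSpace ℂ H] [CompleteSpace H]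
  {D : H →ₗ.[ℂ] H} {U : H →L[ℂ] H}

namespace IsHeisenbergPair

variable (h : IsHeisenbergPair D U)
include h

theorem spectrum_subset : spectrum ℂ U ⊆ Metric.sphere 0 1 :=
  Unitary.spectrum_subset_circle ⟨U, h.unitary_left, h.unitary_right⟩

/-- The angular coordinate on the spectrum. -/
def angleMap : C(spectrum ℂ U, Angles) where
  toFun z := (AddCircle.homeomorphCircle Real.two_pi_pos.ne').symm ⟨z, h.spectrum_subset z.2⟩
  continuous_toFun := (AddCircle.homeomorphCircle Real.two_pi_pos.ne').symm.continuous.comp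
    (continuous_subtype_val.subtype_mk _)

theorem toCircle_angleMap (z : spectrum ℂ U) : ((h.angleMap z).toCircle : ℂ) = z := by
  have e := (AddCircle.homeomorphCircle Real.two_pi_pos.ne').apply_symm_apply
    (⟨z, h.spectrum_subset z.2⟩ : Circle)
  rw [AddCircle.homeomorphCircle_apply] at e
  exact congrArg Subtype.val e

/-- The action of the functions of the angular coordinate. -/
def action : C(Angles, ℂ) →⋆ₐ[ℂ] (H →L[ℂ] H) :=
  (cfcHom h.isStarNormal).comp (ContinuousMap.compStarAlgHom' ℂ ℂ h.angleMap)

theorem action_apply (P : C(Angles, ℂ)) :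
    h.action P = cfcHom h.isStarNormal (P.comp h.angleMap) := rfl

theorem norm_action_le (P : C(Angles, ℂ)) : ‖h.action P‖ ≤ ‖P‖ := by
  have := h.isStarNormal
  rw [action_apply, norm_cfcHom (𝕜 := ℂ) U _]
  exact (ContinuousMap.norm_le _ (norm_nonneg _)).2 fun z => P.norm_coe_le_norm _

theorem fourier_one_comp_angleMap : (fourier 1).comp h.angleMap = coordinate U := by
  ext z
  rw [ContinuousMap.comp_apply, fourier_one, h.toCircle_angleMap]; rfl

theorem action_fourier_one : h.action (fourier 1) = U := by
  rw [action_apply, fourier_one_comp_angleMap]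
  exact cfcHom_id h.isStarNormal

/-- By linearity this is `[D, U^k] = k U^k`, by induction in both directions; negative powers use
`graph_star_apply`. -/
theorem action_graph {P Q : C(Angles, ℂ)} (hPQ : (P, Q) ∈ trigPairs) {x y : H}
    (hxy : (x, y) ∈ D.graph) : (h.action P x, h.action P y + h.action Q x) ∈ D.graph := by
  have hone : fourier 0 = (1 : C(Angles, ℂ)) := by ext; simp
  have hadd : ∀ k l : ℤ, fourier (k + l) = (fourier k * fourier l : C(Angles, ℂ)) := by
    intro k l; ext x; simp
  have hstar : fourier (-1) = star (fourier 1 : C(Angles, ℂ)) := by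
    ext x; rw [fourier_neg]; rfl
  refine trigPairs_induction (p := fun P Q =>
    (h.action P x, h.action P y + h.action Q x) ∈ D.graph) ?_ ?_ ?_ ?_ hPQ
  · intro k
    induction k with
    | zero => simpa [hone] using hxy
    | succ k ih =>
      convert! h.graph_apply ih using 2
      · rw [add_comm, hadd, map_mul, action_fourier_one]; rfl
      · rw [add_comm (k : ℤ) 1, hadd, map_mul, map_smul, map_mul, map_smul, action_fourier_one]
        simp only [mul_apply_eq_comp, smul_apply, map_add, map_smul]
        push_cast; module
    | pred k ih =>
      convert! h.graph_star_apply ih using 2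
      · rw [sub_eq_neg_add, hadd, map_mul, hstar, map_star, action_fourier_one]; rfl
      · rw [sub_eq_neg_add, hadd, map_mul, map_smul, map_mul, map_smul, hstar, map_star,
          action_fourier_one]
        simp only [mul_apply_eq_comp, smul_apply, map_add, map_smul]
        push_cast; module
  · simp
  · intro P Q P' Q' h1 h2
    convert! D.graph.add_mem h1 h2 using 1
    simp only [map_add, add_apply, Prod.mk_add_mk]
    congr 1; abel
  · intro c P Q h1
    convert! D.graph.smul_mem c h1 using 1
    simp only [map_smul, smul_apply, Prod.smul_mk, smul_add]

theorem isCommutator_action {P Q : C(Angles, ℂ)} (hPQ : (P, Q) ∈ trigPairs) :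
    IsCommutator D (h.action P) (h.action Q) :=
  isCommutator_iff_graph.2 fun _ _ hxy => h.action_graph hPQ hxy

end IsHeisenbergPair

/-- A sequence of approximate eigenvectors of an unbounded operator. -/
structure IsApproximateEigenvector (D : H →ₗ.[ℂ] H) (l : ℝ) (x y : ℕ → H) : Prop where
  mem_graph : ∀ n, (x n, y n) ∈ D.graph
  norm_eq : ∀ n, ‖x n‖ = 1
  tendsto : Tendsto (fun n => y n - (l : ℂ) • x n) atTop (𝓝 0)

theorem exists_isApproximateEigenvector [Nontrivial H] (hD : IsSelfAdjoint D) :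
    ∃ l x y, IsApproximateEigenvector D l x y := by
  obtain ⟨l, hl⟩ := exists_approximate_eigenvalue hD
  choose x y hxy hx hy using fun n : ℕ => hl (1 / ((n : ℝ) + 1)) (by positivity)
  refine ⟨l, x, y, hxy, hx, ?_⟩
  exact squeeze_zero_norm (fun n => (hy n).le) tendsto_one_div_add_atTop_nhds_zero_nat

omit [CompleteSpace H] in
/-- A matrix coefficient with a null sequence tends to zero. -/
theorem tendsto_inner_zero_right {u v : ℕ → H} {C : ℝ} (hu : ∀ n, ‖u n‖ ≤ C)
    (hv : Tendsto v atTop (𝓝 0)) : Tendsto (fun n => ⟪u n, v n⟫_ℂ) atTop (𝓝 0) := by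
  refine squeeze_zero_norm (fun n => (norm_inner_le_norm _ _).trans
    (mul_le_mul_of_nonneg_right (hu n) (norm_nonneg _))) ?_
  simpa using hv.norm.const_mul C

omit [CompleteSpace H] in
theorem tendsto_inner_zero_left {u v : ℕ → H} {C : ℝ} (hv : ∀ n, ‖v n‖ ≤ C)
    (hu : Tendsto u atTop (𝓝 0)) : Tendsto (fun n => ⟪u n, v n⟫_ℂ) atTop (𝓝 0) := by
  refine squeeze_zero_norm (fun n => (norm_inner_le_norm _ _).trans
    (mul_le_mul_of_nonneg_left (hv n) (norm_nonneg _))) ?_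
  simpa using hu.norm.mul_const C

namespace IsHeisenbergPair

variable (h : IsHeisenbergPair D U) {l : ℝ} {x y : ℕ → H} (hx : IsApproximateEigenvector D l x y)
include h hx

/-- Vector states at approximate eigenvectors converge to zero on commutators. -/
theorem tendsto_commutator {S B : H →L[ℂ] H}
    (hS : ∀ x y, (x, y) ∈ D.graph → (S x, S y + B x) ∈ D.graph) :
    Tendsto (fun n => ⟪x n, B (x n)⟫_ℂ) atTop (𝓝 0) := by
  -- Symmetry of `D` moves it to the left vector, and the two contributions of the real number `l`
  -- cancel.
  have e : ∀ n, ⟪x n, B (x n)⟫_ℂ =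
      ⟪y n - (l : ℂ) • x n, S (x n)⟫_ℂ - ⟪x n, S (y n - (l : ℂ) • x n)⟫_ℂ := by
    intro n
    have := inner_graph_symm h.selfAdjoint (hx.mem_graph n) (hS _ _ (hx.mem_graph n))
    rw [inner_add_right] at this
    rw [map_sub, map_smul, inner_sub_left, inner_sub_right, inner_smul_left, inner_smul_right,
      ← this, Complex.conj_ofReal]
    ring
  simp only [e]
  have h1 : ∀ n, ‖S (x n)‖ ≤ ‖S‖ := fun n => by simpa [hx.norm_eq n] using S.le_opNorm (x n)
  have h2 : Tendsto (fun n => S (y n - (l : ℂ) • x n)) atTop (𝓝 0) := by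
    have := (S.continuous.tendsto 0).comp hx.tendsto
    rwa [map_zero] at this
  simpa using (tendsto_inner_zero_left h1 hx.tendsto).sub
    (tendsto_inner_zero_right (fun n => (hx.norm_eq n).le) h2)

/-- The vector states at approximate eigenvectors converge to the mean value on the circle. -/
theorem tendsto_mean (g : C(Angles, ℂ)) :
    Tendsto (fun n => ⟪x n, h.action g (x n)⟫_ℂ) atTop (𝓝 (mean g)) := by
  have hdense : g ∈ closure (Submodule.span ℂ (Set.range (@fourier (2 * Real.pi))) :
      Set C(Angles, ℂ)) := by
    have := span_fourier_closure_eq_top (T := 2 * Real.pi)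
    rw [← Submodule.topologicalClosure_coe, this]; trivial
  have hspan : ∀ P ∈ Submodule.span ℂ (Set.range (@fourier (2 * Real.pi))),
      Tendsto (fun n => ⟪x n, h.action P (x n)⟫_ℂ) atTop (𝓝 (mean P)) := by
    intro P hP
    induction hP using Submodule.span_induction with
    | mem P hP =>
      obtain ⟨k, rfl⟩ := hP
      rw [mean_fourier]
      rcases eq_or_ne k 0 with rfl | hk
      · have hone : fourier 0 = (1 : C(Angles, ℂ)) := by ext; simp
        simp [hone, hx.norm_eq]
      -- For `k ≠ 0` the operator `U^k` is itself a commutator, up to the factor `k`.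
      · have h1 := h.tendsto_commutator hx fun x y hxy => h.action_graph (fourier_mem_trigPairs k) hxy
        have h2 := h1.const_mul (k : ℂ)⁻¹
        have hk' : (k : ℂ) ≠ 0 := by exact_mod_cast hk
        simpa [hk, inner_smul_right, hk'] using h2
    | zero => simp [mean_zero]
    | add P Q _ _ hP hQ => simpa [mean_add, inner_add_right] using hP.add hQ
    | smul c P _ hP => simpa [mean_smul, inner_smul_right] using hP.const_mul c
  rw [Metric.tendsto_atTop]
  intro ε hε
  obtain ⟨P, hP, hgP⟩ := Metric.mem_closure_iff.1 hdense (ε / 3) (by positivity)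
  obtain ⟨N, hN⟩ := Metric.tendsto_atTop.1 (hspan P hP) (ε / 3) (by positivity)
  refine ⟨N, fun n hn => ?_⟩
  have h1 := hN n hn
  rw [dist_eq_norm] at h1 hgP ⊢
  have h2 : ‖⟪x n, h.action (g - P) (x n)⟫_ℂ‖ ≤ ‖g - P‖ := by
    refine (norm_inner_le_norm _ _).trans ?_
    rw [hx.norm_eq n, one_mul]
    refine ((h.action (g - P)).le_opNorm _).trans ?_
    rw [hx.norm_eq n, mul_one]
    exact h.norm_action_le _
  have h3 := norm_mean_le (g - P)
  have h4 : mean (g - P) = mean g - mean P :=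
    integral_sub (integrable_angles g.continuous) (integrable_angles P.continuous)
  have h5 : ⟪x n, h.action g (x n)⟫_ℂ - mean g = ⟪x n, h.action (g - P) (x n)⟫_ℂ +
      (⟪x n, h.action P (x n)⟫_ℂ - mean P) - mean (g - P) := by
    rw [h4, map_sub, sub_apply, inner_sub_right]; ring
  rw [h5]
  calc _ ≤ ‖⟪x n, h.action (g - P) (x n)⟫_ℂ‖ + ‖⟪x n, h.action P (x n)⟫_ℂ - mean P‖ +
        ‖mean (g - P)‖ := (norm_sub_le _ _).trans (add_le_add_left (norm_add_le _ _) _)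
    _ < ε := by linarith

end IsHeisenbergPair

namespace IsHeisenbergPair

variable (h : IsHeisenbergPair D U)
include h

/-- The distance to the spectrum acts as zero, so its Haar mean, a limit of vector states, is zero;
at a missing point of the circle it would be positive. -/
theorem spectrum_eq [Nontrivial H] : spectrum ℂ U = Metric.sphere (0 : ℂ) 1 := by
  refine Set.Subset.antisymm h.spectrum_subset fun z hz => ?_
  obtain ⟨l, x, y, hx⟩ := exists_isApproximateEigenvector h.selfAdjoint
  let g : C(Angles, ℂ) :=
    ⟨fun t => (Metric.infDist (t.toCircle : ℂ) (spectrum ℂ U) : ℂ), by fun_prop⟩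
  have hg : h.action g = 0 := by
    have : g.comp h.angleMap = 0 := by
      ext w
      simp only [g, ContinuousMap.comp_apply, ContinuousMap.coe_mk, h.toCircle_angleMap,
        Metric.infDist_zero_of_mem w.2]
      simp
    rw [action_apply, this, map_zero]
  have h1 := h.tendsto_mean hx g
  simp only [hg, zero_apply, inner_zero_right] at h1
  have h2 := tendsto_nhds_unique h1 tendsto_const_nhds
  obtain ⟨t, ht⟩ := (AddCircle.homeomorphCircle Real.two_pi_pos.ne').surjective
    (⟨z, hz⟩ : Circle)
  rw [AddCircle.homeomorphCircle_apply] at ht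
  by_contra hzs
  have hcl : IsClosed (spectrum ℂ U) := spectrum.isClosed U
  have hpos : 0 < Metric.infDist z (spectrum ℂ U) :=
    (hcl.notMem_iff_infDist_pos (spectrum.nonempty U)).1 hzs
  have hc : Continuous fun t : Angles => Metric.infDist (t.toCircle : ℂ) (spectrum ℂ U) := by
    fun_prop
  have h3 : 0 < ∫ t : Angles, Metric.infDist (t.toCircle : ℂ) (spectrum ℂ U)
      ∂AddCircle.haarAddCircle := by
    refine hc.integral_pos_of_hasCompactSupport_nonneg_nonzero
      (HasCompactSupport.of_compactSpace _) (fun x => Metric.infDist_nonneg) (x := t) ?_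
    rw [ht]; exact hpos.ne'
  have h4 : mean g = ((∫ t : Angles, Metric.infDist (t.toCircle : ℂ) (spectrum ℂ U)
      ∂AddCircle.haarAddCircle : ℝ) : ℂ) := integral_ofReal
  rw [h4] at h2
  exact h3.ne' (by exact_mod_cast h2)

/-- The weak form of the Lipschitz bound. -/
theorem norm_mean_le_of_isCommutator [Nontrivial H] {F : C(Angles, ℂ)} {B : H →L[ℂ] H}
    (hB : IsCommutator D (h.action F) B) {q q' : C(Angles, ℂ)} (hq : (q, q') ∈ trigPairs) :
    ‖mean (F * (star q * q' - star q' * q))‖ ≤ ‖B‖ * ‖mean (star q * q)‖ := by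
  obtain ⟨l, x, y, hx⟩ := exists_isApproximateEigenvector h.selfAdjoint
  have h1 : Tendsto (fun n => ⟪x n, (h.action (star q) * B * h.action q) (x n)⟫_ℂ) atTop
      (𝓝 (-mean (F * (star q * q' - star q' * q)))) := by
    -- Leibniz rule for `q* F q`, where `q*` has commutator `-q'*`. As vector states vanish in the
    -- limit on the total, the term with `B` tends to minus the mean of the other term.
    have hc := h.tendsto_commutator hx (S := h.action (star q) * h.action F * h.action q)
      (B := h.action (star q) * B * h.action q +
        h.action (F * (star q * q' - star q' * q))) (by
        intro u v huv
        have e1 := h.action_graph hq huv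
        have e2 := isCommutator_iff_graph.1 hB _ _ e1
        have e3 := h.action_graph (star_mem_trigPairs hq) e2
        convert! e3 using 2
        have e4 : F * (star q * q' - star q' * q) =
          star q * F * q' - star q' * F * q := by ring
        rw [e4]
        simp only [map_sub, map_mul, map_neg, mul_apply_eq_comp, map_add, add_apply,
          sub_apply, neg_apply]
        abel)
    have h2 := hc.sub (h.tendsto_mean hx (F * (star q * q' - star q' * q)))
    rw [zero_sub] at h2
    refine h2.congr fun n => ?_
    rw [add_apply, inner_add_right, add_sub_cancel_right]
  have h2 := (h.tendsto_mean hx (star q * q)).norm.const_mul ‖B‖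
  have h3 := h1.norm
  rw [norm_neg] at h3
  refine le_of_tendsto_of_tendsto' h3 h2 fun n => ?_
  have e5 : ∀ T : H →L[ℂ] H, ⟪x n, (h.action (star q) * T * h.action q) (x n)⟫_ℂ =
      ⟪h.action q (x n), T (h.action q (x n))⟫_ℂ := by
    intro T
    rw [map_star, ContinuousLinearMap.star_eq_adjoint, mul_apply_eq_comp,
      mul_apply_eq_comp, ContinuousLinearMap.adjoint_inner_right]
  have e6 : h.action (star q * q) = h.action (star q) * 1 * h.action q := by
    rw [map_mul, mul_one]
  rw [e5, e6, e5, one_apply_eq_self, inner_self_eq_norm_sq_to_K, norm_pow, RCLike.norm_ofReal,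
    abs_norm]
  calc _ ≤ ‖h.action q (x n)‖ * (‖B‖ * ‖h.action q (x n)‖) :=
        (norm_inner_le_norm _ _).trans (by gcongr; exact B.le_opNorm _)
    _ = _ := by ring

end IsHeisenbergPair

end Spectrum

/-! ### Smoothing by the peak kernel. -/

section Smoothing

theorem coe_toCircle (t : ℝ) :
    (AddCircle.toCircle (t : Angles) : ℂ) = Complex.exp (t * Complex.I) := by
  rw [AddCircle.toCircle_apply_mk, Circle.coe_exp, div_self Real.two_pi_pos.ne', one_mul]

theorem mean_translate (P : C(Angles, ℂ)) (t : Angles) : mean (translate t P) = mean P :=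
  integral_sub_right_eq_self (μ := AddCircle.haarAddCircle) P t

/-- The smoothing of a continuous function on the circle by the peak kernel. -/
theorem exists_smoothing (F : C(Angles, ℂ)) (n : ℕ) : ∃ P Q, (P, Q) ∈ trigPairs ∧
    (∀ t, P t = (∫ x, peak x ^ n ∂AddCircle.haarAddCircle)⁻¹ •
      ∫ x, peak x ^ n • F (x + t) ∂AddCircle.haarAddCircle) ∧
    ∀ t, ∃ q q', (q, q') ∈ trigPairs ∧
      ‖mean (star q * q)‖ = ∫ x, peak x ^ n ∂AddCircle.haarAddCircle ∧
      ‖Q t‖ = (∫ x, peak x ^ n ∂AddCircle.haarAddCircle)⁻¹ *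
        ‖mean (F * (star q * q' - star q' * q))‖ := by
  obtain ⟨q', hq'⟩ := exists_peakRoot_mem_trigPairs n
  set q := peakRoot n
  set m := ∫ x, peak x ^ n ∂AddCircle.haarAddCircle
  have hm : 0 < m := integral_peak_pos n
  have hk : (star q * q, star q * q' - star q' * q) ∈ trigPairs := by
    convert! mul_mem_trigPairs (star_mem_trigPairs hq') hq' using 2
    ring
  obtain ⟨P, Q, hPQ, hP, hQ⟩ := correlation_mem_trigPairs F hk
  refine ⟨_, _, trigPairs.smul_mem ((m⁻¹ : ℝ) : ℂ) hPQ, fun t => ?_, fun t => ?_⟩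
  · rw [ContinuousMap.smul_apply, hP, Complex.coe_smul, mean]
    congr 1
    rw [← integral_add_right_eq_self (μ := AddCircle.haarAddCircle) _ t]
    refine integral_congr_ae (Eventually.of_forall fun x => ?_)
    simp only [ContinuousMap.mul_apply, translate_apply, add_sub_cancel_right]
    rw [← ContinuousMap.mul_apply, star_mul_peakRoot_apply, Complex.real_smul, mul_comm]
  -- The kernel centred at `t` is the square modulus of the translated root, of the same mean.
  · refine ⟨translate t q, translate t q', translate_mem_trigPairs t hq', ?_, ?_⟩
    · have e : star (translate t q) * translate t q = translate t (star q * q) := rfl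
      have e' : mean (star q * q) = (m : ℂ) := by
        rw [mean]
        simp only [q, star_mul_peakRoot_apply]
        exact integral_ofReal
      rw [e, mean_translate, e', Complex.norm_of_nonneg hm.le]
    · rw [ContinuousMap.smul_apply, hQ, norm_smul, norm_neg, Complex.norm_real,
        Real.norm_of_nonneg (by positivity)]
      rfl

theorem tendsto_smoothing {F : Angles → ℂ} (hF : Continuous F) (t : Angles) :
    Tendsto (fun n : ℕ => (∫ x, peak x ^ n ∂AddCircle.haarAddCircle)⁻¹ •
      ∫ x, peak x ^ n • F (x + t) ∂AddCircle.haarAddCircle) atTop (𝓝 (F t)) := by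
  have := tendsto_peak_average (F := fun x => F (x + t)) (by fun_prop)
  rwa [zero_add] at this

end Smoothing

/-! ### The angle as a Lipschitz function and its approximation. -/

section Angle

open InnerProductGeometry

theorem angle_exp_le (x : Angles) (s t : ℝ) :
    angle ((x + s : Angles).toCircle : ℂ) ((x + t : Angles).toCircle : ℂ) ≤ |s - t| := by
  induction x using QuotientAddGroup.induction_on with | H r =>
  have e : angle (AddCircle.toCircle ((r : Angles) + (s : Angles)) : ℂ)
      (AddCircle.toCircle ((r : Angles) + (t : Angles)) : ℂ) = Real.arccos (Real.cos (s - t)) := by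
    rw [angle, Circle.norm_coe, Circle.norm_coe, mul_one, div_one, ← AddCircle.coe_add,
      ← AddCircle.coe_add, coe_toCircle, coe_toCircle, Complex.inner]
    congr 1
    rw [← Complex.exp_conj, ← Complex.exp_add, map_mul, Complex.conj_I, Complex.conj_ofReal]
    have : ((r + s : ℝ) : ℂ) * -Complex.I + ((r + t : ℝ) : ℂ) * Complex.I =
        ((t - s : ℝ) : ℂ) * Complex.I := by push_cast; ring
    rw [add_comm, this, Complex.exp_ofReal_mul_I_re, ← Real.cos_neg, neg_sub]
  refine e.trans_le ?_
  rw [← Real.cos_abs]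
  rcases le_total |s - t| Real.pi with h | h
  · rw [Real.arccos_cos (abs_nonneg _) h]
  · exact (Real.arccos_le_pi _).trans h

theorem abs_angle_sub_angle_le (w : ℂ) (x : Angles) (s t : ℝ) :
    |angle ((x + s : Angles).toCircle : ℂ) w - angle ((x + t : Angles).toCircle : ℂ) w| ≤
      |s - t| := by
  rw [abs_le]
  constructor
  · have h1 := angle_le_angle_add_angle ((x + t : Angles).toCircle : ℂ)
      ((x + s : Angles).toCircle : ℂ) w
    have h2 := angle_exp_le x t s
    rw [abs_sub_comm] at h2
    linarith
  · have h1 := angle_le_angle_add_angle ((x + s : Angles).toCircle : ℂ)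
      ((x + t : Angles).toCircle : ℂ) w
    have h2 := angle_exp_le x s t
    linarith

/-- The angle with a point, as a function on the circle. -/
def angleFrom (w : Circle) : C(Angles, ℂ) :=
  ⟨fun x => (angle (x.toCircle : ℂ) w : ℂ), by
    refine Complex.continuous_ofReal.comp (continuous_iff_continuousAt.2 fun x => ?_)
    have hc : Continuous fun y : Angles => ((y.toCircle : ℂ), (w : ℂ)) := by fun_prop
    exact ContinuousAt.comp (f := fun y : Angles => ((y.toCircle : ℂ), (w : ℂ)))
      (continuousAt_angle (x := ((x.toCircle : ℂ), (w : ℂ)))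
      (Circle.coe_ne_zero _) (Circle.coe_ne_zero _)) hc.continuousAt⟩

/-- Trigonometric polynomials of Lipschitz constant one approximate the arc length distance. -/
theorem exists_approximate_angle (w : Circle) (x x' : Angles) {ε : ℝ} (hε : 0 < ε) :
    ∃ P Q, (P, Q) ∈ trigPairs ∧ ‖Q‖ ≤ 1 ∧
      |angle (x.toCircle : ℂ) w - angle (x'.toCircle : ℂ) w| - ε < ‖P x - P x'‖ := by
  have hlim := ((tendsto_smoothing (angleFrom w).continuous x).sub
    (tendsto_smoothing (angleFrom w).continuous x')).norm
  have hval : ‖angleFrom w x - angleFrom w x'‖ =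
      |angle (x.toCircle : ℂ) w - angle (x'.toCircle : ℂ) w| := by
    rw [← Real.norm_eq_abs, ← Complex.norm_real, Complex.ofReal_sub]; rfl
  rw [hval] at hlim
  obtain ⟨n, hn⟩ := (hlim.eventually_const_lt (sub_lt_self _ hε)).exists
  obtain ⟨P, Q, hPQ, hP, -⟩ := exists_smoothing (angleFrom w) n
  refine ⟨P, Q, hPQ, ?_, by rwa [hP, hP]⟩
  have hm := integral_peak_pos n
  set m := ∫ x, peak x ^ n ∂AddCircle.haarAddCircle
  -- Averaging translates against a positive kernel of mass one preserves the Lipschitz constant,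
  -- which then bounds the derivative `i Q`.
  have hlip : ∀ s t : ℝ, ‖P (s : Angles) - P (t : Angles)‖ ≤ |s - t| := by
    intro s t
    have hi : ∀ r : ℝ, Integrable (fun x => peak x ^ n • angleFrom w (x + r))
        AddCircle.haarAddCircle := fun r => integrable_angles
      ((continuous_peak.pow n).smul ((angleFrom w).continuous.comp (by fun_prop)))
    rw [hP, hP, ← smul_sub, ← integral_sub (hi s) (hi t), norm_smul,
      Real.norm_of_nonneg (by positivity), inv_mul_le_iff₀ hm]
    refine (norm_integral_le_integral_norm _).trans ?_
    have hpk : ∀ x, 0 ≤ peak x ^ n := fun x => by unfold peak; positivity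
    rw [mul_comm m, ← integral_const_mul]
    refine integral_mono (((hi s).sub (hi t)).norm)
      (integrable_angles (continuous_const.mul (continuous_peak.pow n))) fun x => ?_
    simp only
    rw [← smul_sub, norm_smul, Real.norm_of_nonneg (hpk x), mul_comm]
    refine mul_le_mul_of_nonneg_right ?_ (hpk x)
    have := abs_angle_sub_angle_le w x s t
    rw [← Real.norm_eq_abs, ← Complex.norm_real, Complex.ofReal_sub] at this
    exact this
  refine (ContinuousMap.norm_le _ zero_le_one).2 fun x => ?_
  induction x using QuotientAddGroup.induction_on with | H r =>
  have hd := hasDerivAt_of_mem_trigPairs hPQ r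
  have := hd.le_of_lip' (C := 1) zero_le_one (Eventually.of_forall fun s => by
    rw [one_mul, Real.norm_eq_abs]; exact hlip s r)
  rwa [norm_mul, Complex.norm_I, one_mul] at this

end Angle

/-! ### The spectral distance on the circle. -/

section Distance

variable {H : Type*} [NormedAddCommGroup H] [InnerProductSpace ℂ H] [CompleteSpace H]
  {D : H →ₗ.[ℂ] H} {U : H →L[ℂ] H}

namespace IsHeisenbergPair

variable (h : IsHeisenbergPair D U)
include h

/-- `F` need not be differentiable: the mean value inequality is applied to its smoothings, whose
derivatives are controlled by the weak bound, before passing to the limit. -/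
theorem norm_sub_le_of_isCommutator [Nontrivial H] {F : C(Angles, ℂ)} {B : H →L[ℂ] H}
    (hB : IsCommutator D (h.action F) B) (hB1 : ‖B‖ ≤ 1) (s t : ℝ) :
    ‖F (s : Angles) - F (t : Angles)‖ ≤ |s - t| := by
  refine le_of_tendsto ((tendsto_smoothing F.continuous (s : Angles)).sub
    (tendsto_smoothing F.continuous (t : Angles))).norm (Eventually.of_forall fun n => ?_)
  obtain ⟨P, Q, hPQ, hP, hQ⟩ := exists_smoothing F n
  rw [← hP, ← hP]
  have hm := integral_peak_pos n
  set m := ∫ x, peak x ^ n ∂AddCircle.haarAddCircle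
  have hbound : ∀ r : ℝ, ‖Complex.I * Q (r : Angles)‖ ≤ 1 := by
    intro r
    obtain ⟨q, q', hq, hq1, hq2⟩ := hQ r
    rw [norm_mul, Complex.norm_I, one_mul, hq2, inv_mul_le_iff₀ hm, mul_one]
    refine (h.norm_mean_le_of_isCommutator hB hq).trans ?_
    rw [hq1]
    exact mul_le_of_le_one_left hm.le hB1
  have := Convex.norm_image_sub_le_of_norm_hasDerivWithin_le (s := Set.univ)
    (fun r _ => (hasDerivAt_of_mem_trigPairs hPQ r).hasDerivWithinAt) (fun r _ => hbound r)
    convex_univ (Set.mem_univ t) (Set.mem_univ s)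
  rwa [one_mul, Real.norm_eq_abs] at this

/-- The parametrization of the spectrum by the angle. -/
def pointMap [Nontrivial H] : C(Angles, spectrum ℂ U) where
  toFun t := ⟨t.toCircle, h.spectrum_eq ▸ (t.toCircle).2⟩
  continuous_toFun := by fun_prop

theorem pointMap_angleMap [Nontrivial H] (z : spectrum ℂ U) : h.pointMap (h.angleMap z) = z :=
  Subtype.ext (h.toCircle_angleMap z)

theorem norm_sub_le_angle [Nontrivial H] {f : C(spectrum ℂ U, ℂ)} {B : H →L[ℂ] H}
    (hB : IsCommutator D (cfcHom h.isStarNormal f) B) (hB1 : ‖B‖ ≤ 1) (a b : spectrum ℂ U) :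
    ‖f a - f b‖ ≤ InnerProductGeometry.angle (a : ℂ) (b : ℂ) := by
  have hf : (f.comp h.pointMap).comp h.angleMap = f := by
    ext z
    exact congrArg f (h.pointMap_angleMap z)
  have hn : ∀ z : spectrum ℂ U, ‖(z : ℂ)‖ = 1 := fun z =>
    mem_sphere_zero_iff_norm.1 (h.spectrum_subset z.2)
  have hn0 : ∀ z : spectrum ℂ U, (z : ℂ) ≠ 0 := fun z => norm_ne_zero_iff.1 (by rw [hn z]; simp)
  have hexp : ∀ w : ℂ, ‖w‖ = 1 → Complex.exp (w.arg * Complex.I) = w := fun w hw => by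
    simpa [hw] using Complex.norm_mul_exp_arg_mul_I w
  -- These lifts of `a` and `b` to the line differ by the principal argument of `a / b`, so they
  -- realize the shorter arc.
  have key := h.norm_sub_le_of_isCommutator (F := f.comp h.pointMap)
    (by rw [action_apply, hf]; exact hB) hB1
    ((b : ℂ).arg + ((a : ℂ) / b).arg) ((b : ℂ).arg)
  have ea : h.pointMap (((b : ℂ).arg + ((a : ℂ) / b).arg : ℝ) : Angles) = a := by
    refine Subtype.ext ((coe_toCircle _).trans ?_)
    rw [Complex.ofReal_add, add_mul, Complex.exp_add, hexp _ (hn b),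
      hexp _ (by simp [hn]), mul_div_cancel₀ _ (hn0 b)]
  have eb : h.pointMap (((b : ℂ).arg : ℝ) : Angles) = b :=
    Subtype.ext ((coe_toCircle _).trans (hexp _ (hn b)))
  rw [ContinuousMap.comp_apply, ContinuousMap.comp_apply, ea, eb, add_sub_cancel_left] at key
  rwa [Complex.angle_eq_abs_arg (hn0 a) (hn0 b)]

theorem comp_angleMap_mem {𝒜 : StarSubalgebra ℂ C(spectrum ℂ U, ℂ)} (hU : coordinate U ∈ 𝒜)
    {P Q : C(Angles, ℂ)} (hPQ : (P, Q) ∈ trigPairs) : P.comp h.angleMap ∈ 𝒜 := by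
  refine trigPairs_induction (p := fun P _ => P.comp h.angleMap ∈ 𝒜) ?_ ?_ ?_ ?_ hPQ
  · intro k
    rw [← fourier_one_comp_angleMap h] at hU
    have hs := star_mem hU
    obtain ⟨n, rfl | rfl⟩ := k.eq_nat_or_neg
    · convert! pow_mem hU n using 1
      ext z
      simp [AddCircle.toCircle_nsmul]
    · convert! pow_mem hs n using 1
      ext z
      rw [ContinuousMap.comp_apply, fourier_neg]
      simp [AddCircle.toCircle_nsmul]
  · exact zero_mem 𝒜
  · intro P _ P' _ hP hP'
    exact add_mem hP hP'
  · intro c P _ hP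
    exact SMulMemClass.smul_mem c hP

theorem isLUB_spectralDifferences [Nontrivial H] {𝒜 : StarSubalgebra ℂ C(spectrum ℂ U, ℂ)}
    (hU : coordinate U ∈ 𝒜) (a b : spectrum ℂ U) :
    IsLUB (spectralDifferences D U h.isStarNormal 𝒜 a b)
      (InnerProductGeometry.angle (a : ℂ) (b : ℂ)) := by
  constructor
  · rintro _ ⟨f, -, ⟨B, hB, hB1⟩, rfl⟩
    exact h.norm_sub_le_angle hB hB1 a b
  · intro M hM
    -- The supremum need not be attained, since `𝒜` may contain little more than the trigonometric
    -- polynomials.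
    refine le_of_forall_pos_sub_le fun ε hε => ?_
    obtain ⟨P, Q, hPQ, hQ, hlt⟩ := exists_approximate_angle (h.angleMap b).toCircle
      (h.angleMap a) (h.angleMap b) hε
    rw [h.toCircle_angleMap, h.toCircle_angleMap, InnerProductGeometry.angle_self
      (by rw [← h.toCircle_angleMap]; exact Circle.coe_ne_zero _), sub_zero,
      abs_of_nonneg (InnerProductGeometry.angle_nonneg _ _)] at hlt
    refine hlt.le.trans (hM ⟨P.comp h.angleMap, h.comp_angleMap_mem hU hPQ,
      ⟨h.action Q, h.isCommutator_action hPQ, (h.norm_action_le Q).trans hQ⟩, rfl⟩)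

end IsHeisenbergPair
end Distance

/-! ### Regularity of solutions of differential equations. -/

section SmoothODE

/-- Solutions of smooth autonomous differential equations are smooth. -/
theorem contDiffAt_of_hasDerivAt {E : Type*} [NormedAddCommGroup E] [NormedSpace ℝ E] {u : ℝ → E}
    {w : E → E} {t₀ : ℝ} (hw : ContDiffAt ℝ ∞ w (u t₀))
    (hu : ∀ᶠ t in 𝓝 t₀, HasDerivAt u (w (u t)) t) : ContDiffAt ℝ ∞ u t₀ := by
  rw [contDiffAt_infty] at hw ⊢
  intro n
  obtain ⟨W, hW, hwW⟩ := (hw n).contDiffOn le_rfl (by simp)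
  have hc : ContinuousAt u t₀ := hu.self_of_nhds.continuousAt
  obtain ⟨J, hJ, hJo, htJ⟩ := eventually_nhds_iff.1 (hu.and (hc hW))
  -- Bootstrap: if `u` is of class `C^m`, so is its derivative `w ∘ u`.
  have key : ∀ m : ℕ, m ≤ n → ContDiffOn ℝ m u J := by
    intro m
    induction m with
    | zero =>
      intro _
      rw [Nat.cast_zero, contDiffOn_zero]
      exact fun t ht => (hJ t ht).1.continuousAt.continuousWithinAt
    | succ m ih =>
      intro hm
      rw [Nat.cast_add, Nat.cast_one, contDiffOn_succ_iff_deriv_of_isOpen hJo]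
      refine ⟨fun t ht => (hJ t ht).1.differentiableAt.differentiableWithinAt, by simp, ?_⟩
      have h1 : ContDiffOn ℝ m (w ∘ u) J :=
        (hwW.of_le (by exact_mod_cast (Nat.le_of_succ_le hm))).comp (ih (Nat.le_of_succ_le hm))
          fun t ht => (hJ t ht).2
      exact h1.congr fun t ht => (hJ t ht).1.deriv
  exact (key n le_rfl).contDiffAt (hJo.mem_nhds htJ)

end SmoothODE

/-! ### Integral curves on a compact manifold of dimension one. -/

section IntegralCurves

variable {M : Type*} [TopologicalSpace M] [ChartedSpace Line M] [IsManifold (𝓡 1) ∞ M]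
  {e : ∀ x : M, TangentSpace (𝓡 1) x}

/-- An integral curve in a chart is a solution of a smooth differential equation. -/
theorem exists_chart_ode {γ : ℝ → M} {t₀ : ℝ}
    (he : ContMDiffAt (𝓡 1) (𝓡 1).tangent ∞ (fun x => (⟨x, e x⟩ : TangentBundle (𝓡 1) M)) (γ t₀))
    (hγ : IsMIntegralCurveAt γ e t₀) (h0 : e (γ t₀) ≠ 0) :
    ∃ w : Line → Line, ContDiffAt ℝ ∞ w (extChartAt (𝓡 1) (γ t₀) (γ t₀)) ∧
      w (extChartAt (𝓡 1) (γ t₀) (γ t₀)) ≠ 0 ∧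
      ∀ᶠ t in 𝓝 t₀, HasDerivAt (extChartAt (𝓡 1) (γ t₀) ∘ γ)
        (w (extChartAt (𝓡 1) (γ t₀) (γ t))) t := by
  set x₀ := γ t₀ with hx₀
  let w : Line → Line := fun y => tangentCoordChange (𝓡 1) ((extChartAt (𝓡 1) x₀).symm y) x₀
    ((extChartAt (𝓡 1) x₀).symm y) (e ((extChartAt (𝓡 1) x₀).symm y))
  refine ⟨w, ?_, ?_, ?_⟩
  · rw [contMDiffAt_iff] at he
    exact (he.2.contDiffAt (range_mem_nhds_isInteriorPoint
      BoundarylessManifold.isInteriorPoint)).snd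
  · simp only [w]
    rw [extChartAt_to_inv]
    exact fun h => h0 ((tangentCoordChange_self (I := 𝓡 1) (v := (e x₀ : Line))
      (mem_extChartAt_source x₀)).symm.trans h)
  · have hsrc : ∀ᶠ t in 𝓝 t₀, γ t ∈ (extChartAt (𝓡 1) x₀).source :=
      hγ.continuousAt (extChartAt_source_mem_nhds x₀)
    filter_upwards [hγ.eventually_hasDerivAt, hsrc] with t ht hs
    simp only [w]
    rw [(extChartAt (𝓡 1) x₀).left_inv hs]
    exact ht

theorem finrank_line : Module.finrank ℝ Line = 1 := by simp [Line]

/-- A nonzero vector spans the line. -/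
def lineEquiv {v : Line} (hv : v ≠ 0) : ℝ ≃L[ℝ] Line :=
  (LinearEquiv.ofBijective (LinearMap.toSpanSingleton ℝ Line v) (by
    have hinj : Function.Injective (LinearMap.toSpanSingleton ℝ Line v) :=
      fun a b hab => smul_left_injective ℝ hv hab
    exact ⟨hinj, (LinearMap.injective_iff_surjective_of_finrank_eq_finrank
      (by rw [finrank_line, Module.finrank_self])).1 hinj⟩)).toContinuousLinearEquiv

/-- A smooth integral curve of a nowhere vanishing vector field has smooth local inverses. -/
theorem exists_local_section {γ : ℝ → M} {t₀ : ℝ}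
    (he : ContMDiffAt (𝓡 1) (𝓡 1).tangent ∞ (fun x => (⟨x, e x⟩ : TangentBundle (𝓡 1) M)) (γ t₀))
    (hγ : IsMIntegralCurveAt γ e t₀) (h0 : e (γ t₀) ≠ 0) :
    ContMDiffAt 𝓘(ℝ, ℝ) (𝓡 1) ∞ γ t₀ ∧ ∃ S : M → ℝ, ContMDiffAt (𝓡 1) 𝓘(ℝ, ℝ) ∞ S (γ t₀) ∧
      S (γ t₀) = t₀ ∧ (∀ᶠ x in 𝓝 (γ t₀), γ (S x) = x) ∧ ∀ᶠ t in 𝓝 t₀, S (γ t) = t := by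
  obtain ⟨w, hw, hw0, hu⟩ := exists_chart_ode he hγ h0
  set φ := extChartAt (𝓡 1) (γ t₀) with hφ
  have hsm : ContDiffAt ℝ ∞ (φ ∘ γ) t₀ := contDiffAt_of_hasDerivAt hw hu
  refine ⟨?_, ?_⟩
  · exact contMDiffAt_iff_target.2 ⟨hγ.continuousAt, hsm.contMDiffAt⟩
  -- In dimension one a nonzero velocity is an invertible derivative, so the inverse function
  -- theorem applies.
  have hder : HasFDerivAt (φ ∘ γ) (lineEquiv hw0 : ℝ →L[ℝ] Line) t₀ := by
    have := hu.self_of_nhds.hasFDerivAt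
    convert! this using 1
  have hstr := hsm.hasStrictFDerivAt' hder (by simp)
  let g : Line → ℝ := hstr.localInverse (φ ∘ γ) (lineEquiv hw0) t₀
  have hg : ContDiffAt ℝ ∞ g (φ (γ t₀)) := hsm.to_localInverse hder (by simp)
  have hg0 : g (φ (γ t₀)) = t₀ := hstr.localInverse_apply_image
  have hφc : ContMDiffAt (𝓡 1) 𝓘(ℝ, Line) ∞ φ (γ t₀) := contMDiffAt_extChartAt
  refine ⟨g ∘ φ, ContMDiffAt.comp (γ t₀) (hg.contMDiffAt) hφc, hg0, ?_, ?_⟩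
  · have h1 : ∀ᶠ x in 𝓝 (γ t₀), (φ ∘ γ) (g (φ x)) = φ x :=
      hφc.continuousAt.eventually hstr.eventually_right_inverse
    have h2 : ∀ᶠ x in 𝓝 (γ t₀), x ∈ φ.source := extChartAt_source_mem_nhds (γ t₀)
    have h3 : ContinuousAt (fun x => γ (g (φ x))) (γ t₀) := by
      have h4 : ContinuousAt (g ∘ φ) (γ t₀) := ContinuousAt.comp hg.continuousAt hφc.continuousAt
      refine ContinuousAt.comp (f := g ∘ φ) ?_ h4
      simp only [Function.comp_apply, hg0]
      exact hγ.continuousAt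
    have h5 : ∀ᶠ x in 𝓝 (γ t₀), γ (g (φ x)) ∈ φ.source := by
      refine h3.eventually ?_
      change ∀ᶠ y in 𝓝 (γ (g (φ (γ t₀)))), y ∈ φ.source
      rw [hg0]
      exact extChartAt_source_mem_nhds (γ t₀)
    filter_upwards [h1, h2, h5] with x hx1 hx2 hx3
    exact φ.injOn hx3 hx2 hx1
  · exact hstr.eventually_left_inverse

variable (he : ContMDiff (𝓡 1) (𝓡 1).tangent ∞ (fun x => (⟨x, e x⟩ : TangentBundle (𝓡 1) M)))
  (h0 : ∀ x, e x ≠ 0)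

include he h0

/-- Integral curves exist for a time that is locally uniform. -/
theorem exists_uniform_integralCurve (x₀ : M) : ∃ ε > 0, ∀ᶠ x in 𝓝 x₀,
    ∃ γ : ℝ → M, γ 0 = x ∧ IsMIntegralCurveOn γ e (Set.Ioo (-ε) ε) := by
  obtain ⟨γ, rfl, hγ⟩ := exists_isMIntegralCurveAt_of_contMDiffAt_boundaryless 0
    ((he x₀).of_le (by simp))
  obtain ⟨-, S, hS, hS0, hSx, -⟩ := exists_local_section (he _) hγ (h0 _)
  obtain ⟨ε, hε, hon⟩ := isMIntegralCurveAt_iff'.1 hγ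
  refine ⟨ε / 2, half_pos hε, ?_⟩
  have h1 : ∀ᶠ x in 𝓝 (γ 0), S x ∈ Metric.ball 0 (ε / 2) :=
    hS.continuousAt.eventually (by rw [hS0]; exact Metric.ball_mem_nhds _ (half_pos hε))
  filter_upwards [h1, hSx] with x hx1 hx2
  refine ⟨γ ∘ (· + S x), by simp [hx2], (hon.comp_add (S x)).mono fun t ht => ?_⟩
  rw [Real.ball_zero_eq_Ioo, Set.mem_Ioo] at hx1
  simp only [Real.ball_zero_eq_Ioo, Set.mem_Ioo, Set.mem_ofPred_eq] at ht ⊢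
  constructor <;> linarith [ht.1, ht.2]

/-- A smooth nowhere vanishing vector field on a compact manifold of dimension one is complete. -/
theorem exists_integralCurve [CompactSpace M] [T2Space M] (x : M) :
    ∃ γ : ℝ → M, γ 0 = x ∧ IsMIntegralCurve γ e := by
  choose ε hε hev using exists_uniform_integralCurve he h0
  obtain ⟨s, hs⟩ := CompactSpace.elim_nhds_subcover _ hev
  have hne : s.Nonempty := by
    by_contra hs0
    rw [Finset.not_nonempty_iff_eq_empty] at hs0
    have : x ∈ (⊤ : Set M) := trivial
    rw [← hs, hs0] at this
    simp at this
  obtain ⟨i, his, hi⟩ := s.exists_min_image ε hne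
  refine exists_isMIntegralCurve_of_isMIntegralCurveOn (he.of_le (by simp)) (hε i) (fun y => ?_) x
  have : y ∈ (⊤ : Set M) := trivial
  rw [← hs] at this
  simp only [Set.mem_iUnion] at this
  obtain ⟨j, hj, γ, hγ0, hγ⟩ := this
  exact ⟨γ, hγ0, hγ.mono (Set.Ioo_subset_Ioo (neg_le_neg (hi j hj)) (hi j hj))⟩

/-- An integral curve of a nowhere vanishing vector field maps neighbourhoods to neighbourhoods. -/
theorem integralCurve_nhds {γ : ℝ → M} (hγ : IsMIntegralCurve γ e) (t : ℝ) {N : Set ℝ}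
    (hN : N ∈ 𝓝 t) : γ '' N ∈ 𝓝 (γ t) := by
  obtain ⟨-, S, hS, hS0, hSx, -⟩ := exists_local_section (he _) (hγ.isMIntegralCurveAt t) (h0 _)
  have h1 : ∀ᶠ x in 𝓝 (γ t), S x ∈ N := hS.continuousAt.eventually (by rwa [hS0])
  filter_upwards [h1, hSx] with x hx1 hx2
  exact ⟨S x, hx1, hx2⟩

theorem integralCurve_isOpenMap {γ : ℝ → M} (hγ : IsMIntegralCurve γ e) : IsOpenMap γ :=
  IsOpenMap.of_nhds_le fun t => by
    intro N hN
    exact mem_of_superset (integralCurve_nhds he h0 hγ t hN) (Set.image_preimage_subset _ _)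

variable [CompactSpace M] [T2Space M]

/-- Orbits are open, and by uniqueness they are equal or disjoint; so an orbit is also closed, and
connectedness concludes. -/
theorem integralCurve_surjective [ConnectedSpace M] {γ : ℝ → M} (hγ : IsMIntegralCurve γ e) :
    Function.Surjective γ := by
  have hopen : ∀ {η : ℝ → M}, IsMIntegralCurve η e → IsOpen (Set.range η) := fun hη =>
    (integralCurve_isOpenMap he h0 hη).isOpen_range
  have hcl : IsClosed (Set.range γ) := by
    rw [← isOpen_compl_iff, isOpen_iff_mem_nhds]
    intro x hx
    obtain ⟨η, hη0, hη⟩ := exists_integralCurve he h0 x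
    refine mem_of_superset ((hopen hη).mem_nhds ⟨0, hη0⟩) ?_
    rintro _ ⟨t, rfl⟩ ⟨s, hs⟩
    have h1 : γ ∘ (· + s) = η ∘ (· + t) :=
      isMIntegralCurve_Ioo_eq_of_contMDiff_boundaryless (t₀ := 0) (he.of_le (by simp))
        (hγ.comp_add s) (hη.comp_add t) (by simpa using hs)
    have h2 := congrFun h1 (-t)
    simp only [Function.comp_apply, neg_add_cancel, hη0] at h2
    exact hx ⟨_, h2⟩
  exact Set.range_eq_univ.1 ((IsClopen.eq_univ ⟨hcl, hopen hγ⟩) (Set.range_nonempty γ))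

/-- An integral curve that is a periodic parametrization of the manifold. -/
theorem exists_periodic_parametrization [ConnectedSpace M] :
    ∃ (γ : ℝ → M) (L : ℝ), 0 < L ∧ IsMIntegralCurve γ e ∧ Function.Surjective γ ∧
      ∀ s t, γ s = γ t ↔ ∃ k : ℤ, s - t = k * L := by
  obtain ⟨x₀⟩ : Nonempty M := inferInstance
  obtain ⟨γ, -, hγ⟩ := exists_integralCurve he h0 x₀
  have hsurj := integralCurve_surjective he h0 hγ
  have he1 : ContMDiff (𝓡 1) (𝓡 1).tangent 1
    (fun x => (⟨x, e x⟩ : TangentBundle (𝓡 1) M)) := he.of_le (by simp)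
  have hninj : ¬ Function.Injective γ := by
    intro hinj
    have hh : IsHomeomorph γ :=
      ⟨hγ.continuous, integralCurve_isOpenMap he h0 hγ, hinj, hsurj⟩
    have : CompactSpace ℝ := hh.homeomorph.symm.compactSpace
    exact not_compactSpace_iff.2 (inferInstance : NoncompactSpace ℝ) this
  obtain ⟨T, hT, hTp⟩ := (hγ.periodic_xor_injective he1).or.resolve_right hninj
  -- The periods form a closed subgroup of the line, hence a cyclic one unless it is everything; in
  -- that case the curve would be constant.
  let G : AddSubgroup ℝ :=
    { carrier := {c | Function.Periodic γ c}
      zero_mem' := fun x => by simp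
      add_mem' := fun h h' => h.add_period h'
      neg_mem' := fun h => h.neg }
  have hG : ∀ c, c ∈ G ↔ Function.Periodic γ c := fun c => Iff.rfl
  have hGc : IsClosed (G : Set ℝ) := by
    have : (G : Set ℝ) = ⋂ x, {c | γ (x + c) = γ x} := by
      ext c; simp only [SetLike.mem_coe, hG, Function.Periodic, Set.mem_iInter, Set.mem_ofPred_eq]
    rw [this]
    exact isClosed_iInter fun x => isClosed_eq (hγ.continuous.comp (by fun_prop)) continuous_const
  have hGd : ¬ Dense (G : Set ℝ) := by
    intro hd
    have huniv := hGc.closure_eq.symm.trans hd.closure_eq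
    obtain ⟨-, S, -, hS0, -, hSt⟩ :=
      exists_local_section (he _) (hγ.isMIntegralCurveAt 0) (h0 (γ 0))
    have hconst : ∀ t, γ t = γ 0 := fun t => by
      have ht : t ∈ (G : Set ℝ) := by rw [huniv]; trivial
      simpa using (hG t).1 ht 0
    have h1 : ∀ᶠ t : ℝ in 𝓝 0, t = 0 := by
      filter_upwards [hSt] with t ht
      rw [← ht, hconst, hS0]
    obtain ⟨δ, hδ, hball⟩ := Metric.eventually_nhds_iff.1 h1
    have := hball (y := δ / 2) (by rw [Real.dist_0_eq_abs, abs_of_pos (half_pos hδ)]; linarith)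
    linarith
  obtain ⟨a, ha⟩ := G.dense_or_cyclic.resolve_left hGd
  have ha' : ∀ c, c ∈ G ↔ ∃ k : ℤ, c = k * a := by
    intro c
    rw [ha, AddSubgroup.mem_closure_singleton]
    simp only [zsmul_eq_mul, eq_comm]
  have ha0 : a ≠ 0 := by
    rintro rfl
    obtain ⟨k, hk⟩ := (ha' T).1 hTp
    rw [mul_zero] at hk
    exact hT.ne' hk
  refine ⟨γ, |a|, abs_pos.2 ha0, hγ, hsurj, fun s t => ?_⟩
  have h1 : γ s = γ t ↔ ∃ k : ℤ, s - t = k * a := by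
    rw [← ha', hG]
    refine ⟨fun h => hγ.periodic_of_eq he1 h, fun h => ?_⟩
    have := h t
    rwa [add_sub_cancel] at this
  rw [h1]
  rcases abs_choice a with h | h
  · rw [h]
  · rw [h]
    constructor
    · rintro ⟨k, hk⟩; exact ⟨-k, by push_cast; linarith⟩
    · rintro ⟨k, hk⟩; exact ⟨-k, by push_cast; linarith⟩

end IntegralCurves

/-! ### Periodic parametrizations and smooth functions. -/

section Parametrization

variable {M : Type*} [MetricSpace M] [ChartedSpace Line M]

/-- `γ` is a parametrization of `M`, with minimal period `L`, by an integral curve of the vector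
field `e`. -/
structure IsPeriodicParametrization (e : ∀ x : M, TangentSpace (𝓡 1) x) (γ : ℝ → M) (L : ℝ) :
    Prop where
  pos : 0 < L
  curve : IsMIntegralCurve γ e
  surjective : Function.Surjective γ
  eq_iff : ∀ s t, γ s = γ t ↔ ∃ k : ℤ, s - t = k * L

variable {e : ∀ x : M, TangentSpace (𝓡 1) x}

theorem hasDerivAt_comp_integralCurve {γ : ℝ → M} (hγ : IsMIntegralCurve γ e) {f : M → ℂ} {s : ℝ}
    (hf : MDifferentiableAt (𝓡 1) 𝓘(ℝ, ℂ) f (γ s)) :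
    HasDerivAt (f ∘ γ) (derivAlong e f (γ s)) s := by
  have h : HasFDerivAt (f ∘ γ) (ContinuousLinearMap.comp
      (mfderiv (𝓡 1) 𝓘(ℝ, ℂ) f (γ s) : Line →L[ℝ] ℂ)
      ((1 : ℝ →L[ℝ] ℝ).smulRight (e (γ s) : Line))) s :=
    (hf.hasMFDerivAt.comp s (hγ s)).hasFDerivAt
  convert! h.hasDerivAt using 1
  change _ = (mfderiv (𝓡 1) 𝓘(ℝ, ℂ) f (γ s) : Line →L[ℝ] ℂ) ((1 : ℝ) • (e (γ s) : Line))
  rw [one_smul]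
  rfl

namespace IsPeriodicParametrization

variable {γ : ℝ → M} {L : ℝ} (h : IsPeriodicParametrization e γ L)

include h

theorem continuous : Continuous γ := h.curve.continuous

theorem periodic : Function.Periodic γ L := fun s => (h.eq_iff _ _).2 ⟨1, by simp⟩

theorem apply_eq_of_periodic {β : Type*} {F : ℝ → β} (hF : Function.Periodic F L) {s t : ℝ}
    (hst : γ s = γ t) : F s = F t := by
  obtain ⟨k, hk⟩ := (h.eq_iff s t).1 hst
  rw [show s = t + k * L by linarith]
  exact hF.int_mul k t

/-- Smooth periodic functions are the smooth functions on `M`. -/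
theorem exists_contMDiffMap [IsManifold (𝓡 1) ∞ M]
    (he : ContMDiff (𝓡 1) (𝓡 1).tangent ∞ (fun x => (⟨x, e x⟩ : TangentBundle (𝓡 1) M)))
    (h0 : ∀ x, e x ≠ 0) {F : ℝ → ℂ} (hF : ContDiff ℝ ∞ F) (hp : Function.Periodic F L) :
    ∃ f : C^∞⟮𝓡 1, M; 𝓘(ℝ, ℂ), ℂ⟯, ∀ s, f (γ s) = F s := by
  -- This section is merely set-theoretic; by periodicity it may be replaced near each point by a
  -- smooth local section.
  obtain ⟨σ, hσ⟩ := h.surjective.hasRightInverse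
  refine ⟨⟨F ∘ σ, fun x => ?_⟩, fun s => h.apply_eq_of_periodic hp (hσ (γ s))⟩
  obtain ⟨s, rfl⟩ := h.surjective x
  obtain ⟨-, S, hS, hS0, hγS, -⟩ :=
    exists_local_section (he _) (h.curve.isMIntegralCurveAt s) (h0 (γ s))
  have h1 : ContMDiffAt (𝓡 1) 𝓘(ℝ, ℂ) ∞ (F ∘ S) (γ s) :=
    (hF.contMDiff.contMDiffAt (x := S (γ s))).comp (γ s) hS
  refine h1.congr_of_eventuallyEq ?_
  filter_upwards [hγS] with x hx
  exact h.apply_eq_of_periodic hp ((hσ x).trans hx.symm)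

theorem exists_Ioc (a : ℝ) (x : M) : ∃ s ∈ Set.Ioc a (a + L), γ s = x := by
  obtain ⟨s, rfl⟩ := h.surjective x
  obtain ⟨y, hy, hys⟩ := h.periodic.exists_mem_Ioc h.pos s a
  exact ⟨y, hy, hys.symm⟩

theorem injOn_Ioc (a : ℝ) : Set.InjOn γ (Set.Ioc a (a + L)) := by
  intro s hs t ht hst
  obtain ⟨k, hk⟩ := (h.eq_iff s t).1 hst
  have hL := h.pos
  have h1 : |(k : ℝ)| < 1 := by
    rw [abs_lt]
    constructor <;> nlinarith [hs.1, hs.2, ht.1, ht.2]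
  have h2 : k = 0 := by
    rw [← Int.abs_lt_one_iff]
    exact_mod_cast h1
  subst h2
  simp at hk
  linarith

end IsPeriodicParametrization

end Parametrization

/-! ### Lipschitz estimates for the Riemannian distance. -/

section Metric

variable {M : Type*} [MetricSpace M] [ChartedSpace Line M]
  [RiemannianBundle (fun x : M => TangentSpace (𝓡 1) x)]
  [IsRiemannianManifold (𝓡 1) M]
  {e : ∀ x : M, TangentSpace (𝓡 1) x} 

theorem lipschitzWith_integralCurve {γ : ℝ → M} (hγ : IsMIntegralCurve γ e)
    (hs : ContMDiff 𝓘(ℝ, ℝ) (𝓡 1) ∞ γ) (h1 : ∀ x, ‖e x‖ = 1) :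
    LipschitzWith 1 γ := by
  have key : ∀ s t, s ≤ t → edist (γ s) (γ t) ≤ edist s t := by
    intro s t hst
    rw [IsRiemannianManifold.out (I := 𝓡 1) (γ s) (γ t)]
    refine (Manifold.riemannianEDist_le_pathELength (hs.contMDiffOn.of_le (by simp)) rfl rfl
      hst).trans ?_
    rw [Manifold.pathELength_eq_lintegral_mfderiv_Icc]
    have : ∀ r, ‖mfderiv 𝓘(ℝ, ℝ) (𝓡 1) γ r (1 : ℝ)‖ₑ = 1 := by
      intro r
      rw [(hγ r).mfderiv]
      change ‖(1 : ℝ) • e (γ r)‖ₑ = 1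
      rw [one_smul, ← ofReal_norm, h1]
      simp
    refine (setLIntegral_mono' (g := fun _ => 1) measurableSet_Icc fun r _ => (this r).le).trans ?_
    simp only [lintegral_one, Measure.restrict_apply_univ, Real.volume_Icc, edist_dist,
      Real.dist_eq]
    exact ENNReal.ofReal_le_ofReal (by linarith [neg_le_abs (s - t)])
  intro s t
  rw [ENNReal.coe_one, one_mul]
  rcases le_total s t with hst | hst
  · exact key s t hst
  · rw [edist_comm, edist_comm s]; exact key t s hst

/-- The distance is an infimum of path lengths, and in dimension one every velocity is a multiple of
`e`, so a bound along `e` controls `u` along all paths. -/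
theorem lipschitzWith_of_norm_derivAlong_le (h1 : ∀ x, ‖e x‖ = 1) {u : M → ℂ}
    (hu : ContMDiff (𝓡 1) 𝓘(ℝ, ℂ) ∞ u) (hd : ∀ x, ‖derivAlong e u x‖ ≤ 1) :
    LipschitzWith 1 u := by
  intro x y
  rw [ENNReal.coe_one, one_mul, IsRiemannianManifold.out (I := 𝓡 1) x y]
  refine le_of_forall_gt fun r hr => ?_
  obtain ⟨η, rfl, rfl, hη, hl⟩ := Manifold.exists_lt_of_riemannianEDist_lt hr
  refine lt_of_le_of_lt ?_ hl
  have hc : ContMDiffOn 𝓘(ℝ, ℝ) 𝓘(ℝ, ℂ) 1 (u ∘ η) (Set.Icc 0 1) :=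
    (hu.of_le (by simp)).comp_contMDiffOn hη
  rw [edist_comm, edist_eq_enorm_sub]
  refine (enorm_sub_le_lintegral_derivWithin_Icc_of_contDiffOn_Icc
    (contMDiffOn_iff_contDiffOn.1 hc) zero_le_one).trans ?_
  rw [Manifold.pathELength_eq_lintegral_mfderivWithin_Icc]
  refine setLIntegral_mono' measurableSet_Icc fun t ht => ?_
  have hηt := ((hη t ht).mdifferentiableWithinAt one_ne_zero).hasMFDerivWithinAt
  have hut := ((hu (η t)).mdifferentiableAt (by simp)).hasMFDerivAt
  let A : Line →L[ℝ] ℂ := mfderiv (𝓡 1) 𝓘(ℝ, ℂ) u (η t)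
  let B : ℝ →L[ℝ] Line := mfderivWithin 𝓘(ℝ, ℝ) (𝓡 1) η (Set.Icc 0 1) t
  have hcomp : HasFDerivWithinAt (u ∘ η) (A.comp B) (Set.Icc 0 1) t :=
    (hut.comp_hasMFDerivWithinAt t hηt).hasFDerivWithinAt
  rw [hcomp.hasDerivWithinAt.derivWithin (uniqueDiffOn_Icc_zero_one t ht)]
  set v : TangentSpace (𝓡 1) (η t) := mfderivWithin 𝓘(ℝ, ℝ) (𝓡 1) η (Set.Icc 0 1) t (1 : ℝ)
  have h0 : (e (η t) : Line) ≠ 0 := by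
    intro h0
    have := h1 (η t)
    rw [show e (η t) = 0 from h0, norm_zero] at this
    exact zero_ne_one this
  obtain ⟨c, hcv⟩ : ∃ c : ℝ, v = c • e (η t) := by
    obtain ⟨c, hc⟩ := (lineEquiv h0).surjective v
    exact ⟨c, hc.symm⟩
  have h2 : A v = c • derivAlong e u (η t) := by
    rw [hcv]
    exact A.map_smul c (e (η t))
  change ‖A v‖ₑ ≤ ‖v‖ₑ
  rw [h2, hcv, ← ofReal_norm, ← ofReal_norm]
  refine ENNReal.ofReal_le_ofReal ?_
  refine (norm_smul_le _ _).trans ?_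
  rw [norm_smul, h1]
  gcongr
  exact hd _

end Metric

/-! ### The Hausdorff measure in arc length parametrization. -/

section LengthMeasure

theorem mul_volume_le_hausdorffMeasure_image {X : Type*} [MetricSpace X] [MeasurableSpace X]
    [BorelSpace X] {f : ℝ → X} {B : Set ℝ} {a : NNReal}
    (h : ∀ s ∈ B, ∀ t ∈ B, a * |s - t| ≤ dist (f s) (f t)) :
    a * volume B ≤ Measure.hausdorffMeasure 1 (f '' B) := by
  rcases eq_or_ne a 0 with rfl | ha
  · simp
  have ha' : (0 : ℝ) < a := NNReal.coe_pos.2 (pos_iff_ne_zero.2 ha)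
  have hinj : Set.InjOn f B := by
    intro s hs t ht hst
    have := h s hs t ht
    rw [hst, dist_self] at this
    have h0 : |s - t| ≤ 0 := by by_contra hc; push Not at hc; nlinarith
    linarith [abs_nonpos_iff.1 h0]
  let g : X → ℝ := Function.invFunOn f B
  have hg : ∀ s ∈ B, g (f s) = s := fun s hs => hinj.leftInvOn_invFunOn hs
  have hl : LipschitzOnWith a⁻¹ g (f '' B) := by
    refine LipschitzOnWith.of_dist_le_mul ?_
    rintro _ ⟨s, hs, rfl⟩ _ ⟨t, ht, rfl⟩
    rw [hg s hs, hg t ht, Real.dist_eq, NNReal.coe_inv, ← div_eq_inv_mul, le_div_iff₀' ha']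
    exact h s hs t ht
  have h1 := hl.hausdorffMeasure_image_le (d := 1) zero_le_one
  have h2 : g '' (f '' B) = B := by
    rw [Set.image_image]
    exact (Set.image_congr hg).trans (Set.image_id' B)
  rw [h2, hausdorffMeasure_real, ENNReal.rpow_one, ENNReal.coe_inv ha] at h1
  calc (a : ℝ≥0∞) * volume B ≤ a * ((a : ℝ≥0∞)⁻¹ * Measure.hausdorffMeasure 1 (f '' B)) := by
        gcongr
    _ = Measure.hausdorffMeasure 1 (f '' B) := by
        rw [← mul_assoc, ENNReal.mul_inv_cancel (by simpa using ha) ENNReal.coe_ne_top, one_mul]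

variable {M : Type*} [MetricSpace M] [ChartedSpace Line M] [IsManifold (𝓡 1) ∞ M]
  {e : ∀ x : M, TangentSpace (𝓡 1) x}

theorem contMDiff_integralCurve
    (he : ContMDiff (𝓡 1) (𝓡 1).tangent ∞ (fun x => (⟨x, e x⟩ : TangentBundle (𝓡 1) M)))
    (h0 : ∀ x, e x ≠ 0) {γ : ℝ → M} (hγ : IsMIntegralCurve γ e) :
    ContMDiff 𝓘(ℝ, ℝ) (𝓡 1) ∞ γ := fun s =>
  (exists_local_section (he _) (hγ.isMIntegralCurveAt s) (h0 (γ s))).1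

namespace IsPeriodicParametrization

variable {γ : ℝ → M} {L : ℝ} (h : IsPeriodicParametrization e γ L)
  (he : ContMDiff (𝓡 1) (𝓡 1).tangent ∞ (fun x => (⟨x, e x⟩ : TangentBundle (𝓡 1) M)))

include h

theorem exists_character (he : ContMDiff (𝓡 1) (𝓡 1).tangent ∞
      (fun x => (⟨x, e x⟩ : TangentBundle (𝓡 1) M))) (h0 : ∀ x, e x ≠ 0) :
    ∃ u : C^∞⟮𝓡 1, M; 𝓘(ℝ, ℂ), ℂ⟯, ∀ s,
      u (γ s) = Complex.exp ((2 * Real.pi / L * s : ℝ) * Complex.I) := by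
  refine h.exists_contMDiffMap he h0 ?_ fun s => ?_
  · have h1 : ContDiff ℝ ∞ fun s : ℝ => ((2 * Real.pi / L * s : ℝ) : ℂ) :=
      Complex.ofRealCLM.contDiff.comp (contDiff_const.mul contDiff_id)
    exact (h1.mul contDiff_const).cexp
  · have hL := h.pos.ne'
    have h2 : (2 * Real.pi / L * (s + L) : ℝ) = 2 * Real.pi / L * s + 2 * Real.pi := by
      field_simp
    simp only [h2]
    push_cast
    rw [add_mul]
    exact Complex.exp_periodic _

variable [RiemannianBundle (fun x : M => TangentSpace (𝓡 1) x)] [IsRiemannianManifold (𝓡 1) M]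
  (h1 : ∀ x, ‖e x‖ = 1)

include he h1

/-- The character of period `L`, scaled to unit speed, is 1-Lipschitz, so distances are at least the
chords of a round circle of length `L`. -/
theorem le_dist (s t : ℝ) :
    L / Real.pi * |Real.sin (Real.pi * (s - t) / L)| ≤ dist (γ s) (γ t) := by
  have h0 : ∀ x, e x ≠ 0 := fun x hx => by
    have := h1 x
    rw [hx, norm_zero] at this
    exact zero_ne_one this
  have hL := h.pos
  have hpi := Real.pi_pos
  obtain ⟨u, hu⟩ := h.exists_character he h0
  let c : ℂ := ((L / (2 * Real.pi) : ℝ) : ℂ)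
  have hc : ‖c‖ = L / (2 * Real.pi) := by
    rw [Complex.norm_real, Real.norm_of_nonneg (by positivity)]
  have hv : ContMDiff (𝓡 1) 𝓘(ℝ, ℂ) ∞ (fun x => c * u x) :=
    (ContinuousLinearMap.mul ℝ ℂ c).contMDiff.comp u.contMDiff
  have hd : ∀ x, ‖derivAlong e (fun x => c * u x) x‖ ≤ 1 := by
    intro x
    obtain ⟨r, rfl⟩ := h.surjective x
    have h2 := hasDerivAt_comp_integralCurve h.curve ((hv (γ r)).mdifferentiableAt (by simp))
    have h3 : HasDerivAt ((fun x => c * u x) ∘ γ)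
        (c * (Complex.exp ((2 * Real.pi / L * r : ℝ) * Complex.I) *
          ((2 * Real.pi / L * 1 : ℝ) * Complex.I))) r := by
      have : ((fun x => c * u x) ∘ γ) =
          fun s : ℝ => c * Complex.exp ((2 * Real.pi / L * s : ℝ) * Complex.I) := by
        funext s; simp only [Function.comp_apply, hu]
      rw [this]
      exact ((((hasDerivAt_id r).const_mul (2 * Real.pi / L)).ofReal_comp.mul_const _).cexp).const_mul c
    rw [h2.unique h3, norm_mul, norm_mul, norm_mul, hc, Complex.norm_exp_ofReal_mul_I,
      Complex.norm_I, Complex.norm_real, Real.norm_of_nonneg (by positivity)]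
    apply le_of_eq
    field_simp
  have hlip := (lipschitzWith_of_norm_derivAlong_le h1 hv hd).dist_le_mul (γ s) (γ t)
  rw [NNReal.coe_one, one_mul] at hlip
  refine le_trans (le_of_eq ?_) hlip
  rw [dist_eq_norm, ← mul_sub, norm_mul, hc, hu, hu]
  have h4 : Complex.exp ((2 * Real.pi / L * s : ℝ) * Complex.I) -
      Complex.exp ((2 * Real.pi / L * t : ℝ) * Complex.I) =
      Complex.exp ((2 * Real.pi / L * t : ℝ) * Complex.I) *
        (Complex.exp (Complex.I * (2 * Real.pi / L * (s - t) : ℝ)) - 1) := by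
    rw [mul_sub, mul_one, ← Complex.exp_add]
    congr 2
    push_cast; ring
  rw [h4, norm_mul, Complex.norm_exp_ofReal_mul_I, one_mul, Complex.norm_exp_I_mul_ofReal_sub_one,
    norm_mul, Real.norm_eq_abs, Real.norm_eq_abs, abs_two,
    show 2 * Real.pi / L * (s - t) / 2 = Real.pi * (s - t) / L by ring]
  field_simp

variable [MeasurableSpace M] [BorelSpace M]

theorem mul_volume_le (a : NNReal) (ha : a < 1) {B : Set ℝ} (hB : MeasurableSet B) :
    a * volume (B ∩ Set.Ioc 0 L) ≤ lengthMeasure M (γ '' (B ∩ Set.Ioc 0 L)) := by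
  have hL := h.pos
  have hpi := Real.pi_pos
  have ha' : (0 : ℝ) < 1 - a := sub_pos.2 (by exact_mod_cast ha)
  -- Chosen so that `|s - t| ≤ δ` gives `x = π |s - t| / L ≤ 1 - a`, a range where `a * x ≤ sin x`.
  -- Thus `γ` contracts by at most `a` on pieces of length `δ`, and the period is exhausted piece by
  -- piece.
  let δ : ℝ := L / Real.pi * (1 - a)
  have hδ : 0 < δ := by positivity
  have hexp : ∀ s t, |s - t| ≤ δ → a * |s - t| ≤ dist (γ s) (γ t) := by
    intro s t hst
    refine le_trans ?_ (h.le_dist he h1 s t)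
    set x := Real.pi * |s - t| / L with hx
    have hx0 : 0 ≤ x := by positivity
    have hx1 : x ≤ 1 - a := by
      rw [hx, div_le_iff₀ hL]
      calc Real.pi * |s - t| ≤ Real.pi * δ := by gcongr
        _ = (1 - a) * L := by simp only [δ]; field_simp
    have hx2 : a * x ≤ |Real.sin (Real.pi * (s - t) / L)| := by
      have h3 : |Real.sin (Real.pi * (s - t) / L)| = |Real.sin x| := by
        rw [hx]
        rcases abs_choice (s - t) with h | h
        · rw [h]
        · rw [h, mul_neg, neg_div, Real.sin_neg, abs_neg]
      rw [h3]
      refine le_trans ?_ (le_abs_self _)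
      have hx3 : x ≤ 1 := hx1.trans (by linarith [a.coe_nonneg])
      rcases hx0.eq_or_lt with h4 | h4
      · simp [← h4]
      · have := Real.sin_gt_sub_cube h4
        have h5 : x ^ 3 ≤ x * (1 - a) := by nlinarith [mul_nonneg hx0 hx0]
        nlinarith
    calc a * |s - t| = L / Real.pi * (a * x) := by rw [hx]; field_simp
      _ ≤ _ := by gcongr
  have hmeas : ∀ s t, 0 ≤ s → t ≤ L → MeasurableSet (γ '' (B ∩ Set.Ioc s t)) := fun s t hs ht =>
    (hB.inter measurableSet_Ioc).image_of_continuousOn_injOn h.continuous.continuousOn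
      ((h.injOn_Ioc 0).mono fun x hx =>
        Set.mem_Ioc.2 ⟨hs.trans_lt hx.2.1, by linarith [hx.2.2]⟩)
  have key : ∀ n : ℕ, ∀ b, 0 ≤ b → b ≤ L → b ≤ n * δ →
      a * volume (B ∩ Set.Ioc 0 b) ≤ lengthMeasure M (γ '' (B ∩ Set.Ioc 0 b)) := by
    intro n
    induction n with
    | zero =>
      intro b hb _ hb'
      simp only [Nat.cast_zero, zero_mul] at hb'
      simp [Set.Ioc_eq_empty (not_lt.2 hb')]
    | succ n ih =>
      intro b hb hbL hb'
      push_cast at hb'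
      set b₀ := max (b - δ) 0 with hb₀
      have hb0 : 0 ≤ b₀ := le_max_right _ _
      have hb0b : b₀ ≤ b := max_le (by linarith) hb
      have hbδ : b - b₀ ≤ δ := by linarith [le_max_left (b - δ) 0]
      have hun : B ∩ Set.Ioc 0 b = (B ∩ Set.Ioc 0 b₀) ∪ (B ∩ Set.Ioc b₀ b) := by
        rw [← Set.inter_union_distrib_left, Set.Ioc_union_Ioc_eq_Ioc hb0 hb0b]
      have hdisj : Disjoint (B ∩ Set.Ioc 0 b₀) (B ∩ Set.Ioc b₀ b) := by
        rw [Set.disjoint_left]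
        rintro x ⟨-, hx⟩ ⟨-, hx'⟩
        exact absurd hx'.1 (not_lt.2 hx.2)
      have hdisj' : Disjoint (γ '' (B ∩ Set.Ioc 0 b₀)) (γ '' (B ∩ Set.Ioc b₀ b)) := by
        rw [Set.disjoint_left]
        rintro _ ⟨x, hx, rfl⟩ ⟨y, hy, hxy⟩
        have : y = x := h.injOn_Ioc 0 ⟨by linarith [hy.2.1], by linarith [hy.2.2]⟩
          ⟨hx.2.1, by linarith [hx.2.2]⟩ hxy
        exact Set.disjoint_left.1 hdisj hx (this ▸ hy)
      rw [hun, Set.image_union, measure_union hdisj' (hmeas _ _ hb0 hbL),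
        measure_union hdisj (hB.inter measurableSet_Ioc), mul_add]
      refine add_le_add (ih b₀ hb0 (hb0b.trans hbL) ?_)
        (mul_volume_le_hausdorffMeasure_image fun s hs t ht => hexp s t ?_)
      · exact max_le (by linarith) (by positivity)
      · rw [abs_le]
        constructor <;> linarith [hs.2.1, hs.2.2, ht.2.1, ht.2.2]
  obtain ⟨n, hn⟩ := exists_nat_ge (L / δ)
  exact key n L hL.le le_rfl ((div_le_iff₀ hδ).1 hn)

/-- The length measure is the Lebesgue measure in a parametrization by arc length. -/
theorem lengthMeasure_eq_map :
    lengthMeasure M = (volume.restrict (Set.Ioc 0 L)).map γ := by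
  have h0 : ∀ x, e x ≠ 0 := fun x hx => by
    have := h1 x
    rw [hx, norm_zero] at this
    exact zero_ne_one this
  have hγm : Measurable γ := h.continuous.measurable
  have himage : ∀ A : Set M, γ '' (γ ⁻¹' A ∩ Set.Ioc 0 L) = A := by
    intro A
    rw [Set.image_preimage_inter, Set.inter_eq_left]
    intro x _
    obtain ⟨s, hs, rfl⟩ := h.exists_Ioc 0 x
    exact ⟨s, by simpa using hs, rfl⟩
  ext A hA
  rw [Measure.map_apply hγm hA, Measure.restrict_apply (hγm hA)]
  apply le_antisymm
  · have h2 := ((lipschitzWith_integralCurve h.curve (contMDiff_integralCurve he h0 h.curve)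
      h1).lipschitzOnWith (s := γ ⁻¹' A ∩ Set.Ioc 0 L)).hausdorffMeasure_image_le
      (d := 1) zero_le_one
    rw [himage, hausdorffMeasure_real] at h2
    simpa [lengthMeasure] using h2
  -- The opposite bound came from `γ` being 1-Lipschitz; this one holds up to any factor below one.
  · refine ENNReal.le_of_forall_lt_one_mul_le fun a ha => ?_
    lift a to NNReal using (ha.trans ENNReal.one_lt_top).ne
    have := h.mul_volume_le he h1 a (by exact_mod_cast ha) (hγm hA)
    rwa [himage] at this

theorem lengthMeasure_univ : lengthMeasure M Set.univ = ENNReal.ofReal L := by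
  rw [h.lengthMeasure_eq_map he h1, Measure.map_apply h.continuous.measurable .univ]
  simp

theorem isFiniteMeasure_lengthMeasure : IsFiniteMeasure (lengthMeasure M) :=
  ⟨by rw [h.lengthMeasure_univ he h1]; exact ENNReal.ofReal_lt_top⟩

/-- Full support makes `toSpinor` injective, so identities between continuous spinors hold
pointwise. -/
theorem isOpenPosMeasure_lengthMeasure : (lengthMeasure M).IsOpenPosMeasure := by
  refine ⟨fun O hO ⟨x, hx⟩ h2 => ?_⟩
  rw [h.lengthMeasure_eq_map he h1, Measure.map_apply h.continuous.measurable hO.measurableSet,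
    Measure.restrict_apply (h.continuous.measurable hO.measurableSet)] at h2
  obtain ⟨s, hs, rfl⟩ := h.exists_Ioc 0 x
  rw [zero_add] at hs
  have hs' : s ∈ closure (Set.Ioo 0 L) := by
    rw [closure_Ioo h.pos.ne]
    exact Set.Ioc_subset_Icc_self hs
  have hne : (γ ⁻¹' O ∩ Set.Ioo 0 L).Nonempty :=
    mem_closure_iff.1 hs' _ (hO.preimage h.continuous) hx
  exact ((hO.preimage h.continuous).inter isOpen_Ioo).measure_pos volume hne |>.ne'
    (measure_mono_null (Set.inter_subset_inter_right _ Set.Ioo_subset_Ioc_self) h2)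

theorem integral_lengthMeasure {f : M → ℂ} (hf : Continuous f) :
    ∫ x, f x ∂(lengthMeasure M) = ∫ s in (0 : ℝ)..L, f (γ s) := by
  rw [h.lengthMeasure_eq_map he h1, integral_map h.continuous.aemeasurable
    (hf.measurable.aestronglyMeasurable), intervalIntegral.integral_of_le h.pos.le]

end IsPeriodicParametrization

end LengthMeasure

/-! ### Closures of symmetric operators with a Hilbert basis of eigenvectors. -/

section DiagonalOperators

variable {H : Type*} [NormedAddCommGroup H] [InnerProductSpace ℂ H]
  {S : Submodule ℂ (H × H)}

theorem inner_topologicalClosure_symm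
    (hS : ∀ p ∈ S, ∀ q ∈ S, ⟪p.1, q.2⟫_ℂ = ⟪p.2, q.1⟫_ℂ) :
    ∀ p ∈ S.topologicalClosure, ∀ q ∈ S.topologicalClosure, ⟪p.1, q.2⟫_ℂ = ⟪p.2, q.1⟫_ℂ := by
  have hc : ∀ q : H × H, IsClosed {p : H × H | ⟪p.1, q.2⟫_ℂ = ⟪p.2, q.1⟫_ℂ} := fun q =>
    isClosed_eq (by fun_prop) (by fun_prop)
  have hc' : ∀ p : H × H, IsClosed {q : H × H | ⟪p.1, q.2⟫_ℂ = ⟪p.2, q.1⟫_ℂ} := fun p =>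
    isClosed_eq (by fun_prop) (by fun_prop)
  have h1 : ∀ q ∈ S, ∀ p ∈ S.topologicalClosure, ⟪p.1, q.2⟫_ℂ = ⟪p.2, q.1⟫_ℂ := fun q hq p hp =>
    closure_minimal (fun p hp => hS p hp q hq) (hc q) hp
  exact fun p hp q hq => closure_minimal (fun q hq => h1 q hq p hp) (hc' p) hq

variable {ι : Type*} (b : HilbertBasis ι ℂ H) {c : ι → ℝ}
  (hS : ∀ p ∈ S, ∀ q ∈ S, ⟪p.1, q.2⟫_ℂ = ⟪p.2, q.1⟫_ℂ)
  (hb : ∀ i, (b i, (c i : ℂ) • b i) ∈ S)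

include hS hb

theorem eq_zero_of_zero_mem_topologicalClosure :
    ∀ p ∈ S.topologicalClosure, p.1 = 0 → p.2 = 0 := by
  intro p hp h0
  apply b.repr.injective
  ext i
  rw [b.repr_apply_apply, map_zero, lp.coeFn_zero, Pi.zero_apply]
  have := inner_topologicalClosure_symm hS _ (S.le_topologicalClosure (hb i)) p hp
  simpa [h0] using this

/-- `Submodule.toLinearPMap` and `LinearPMap.closure` take default values off graphs and closable
operators; pairing with the eigenvectors `b i` rules both cases out. -/
theorem graph_closure_toLinearPMap :
    S.toLinearPMap.closure.graph = S.topologicalClosure := by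
  have h0 := eq_zero_of_zero_mem_topologicalClosure b hS hb
  have h1 : S.toLinearPMap.graph = S :=
    Submodule.toLinearPMap_graph_eq S fun p hp => h0 p (S.le_topologicalClosure hp)
  have h2 : S.toLinearPMap.IsClosable :=
    ⟨S.topologicalClosure.toLinearPMap, by
      rw [h1, Submodule.toLinearPMap_graph_eq _ fun p hp => h0 p hp]⟩
  rw [← h2.graph_closure_eq_closure_graph, h1]

theorem isSelfAdjoint_closure_toLinearPMap [CompleteSpace H] :
    IsSelfAdjoint S.toLinearPMap.closure := by
  have hg := graph_closure_toLinearPMap b hS hb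
  refine isSelfAdjoint_of_graph ?_ (fun x y x' y' h h' => ?_) fun x y hxy => ?_
  · refine (Submodule.dense_iff_topologicalClosure_eq_top.2 b.dense_span).mono
      (Submodule.span_le.2 ?_)
    rintro _ ⟨i, rfl⟩
    refine LinearPMap.mem_domain_of_mem_graph (y := (c i : ℂ) • b i) ?_
    rw [hg]
    exact S.le_topologicalClosure (hb i)
  · rw [hg] at h h'
    exact inner_topologicalClosure_symm hS _ h _ h'
  · rw [hg] at hxy ⊢
    -- Testing against eigenvectors fixes the coefficients of `y`, so the partial sums of the
    -- expansion of `(x, y)` lie in `S`.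
    have hcoef : ∀ i, ⟪b i, y⟫_ℂ = c i * ⟪b i, x⟫_ℂ := by
      intro i
      have := hxy _ _ (S.le_topologicalClosure (hb i))
      rw [← inner_conj_symm, this, inner_smul_right, map_mul, inner_conj_symm, Complex.conj_ofReal]
    have h1 : HasSum (fun i => (⟪b i, x⟫_ℂ • b i, ⟪b i, y⟫_ℂ • b i)) (x, y) := by
      refine HasSum.prodMk ?_ ?_
      · simpa only [b.repr_apply_apply] using b.hasSum_repr x
      · simpa only [b.repr_apply_apply] using b.hasSum_repr y
    refine S.isClosed_topologicalClosure.mem_of_tendsto h1 (Eventually.of_forall fun s => ?_)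
    refine Submodule.sum_mem _ fun i _ => S.le_topologicalClosure ?_
    have h2 : (⟪b i, x⟫_ℂ • b i, ⟪b i, y⟫_ℂ • b i) =
        ⟪b i, x⟫_ℂ • (b i, (c i : ℂ) • b i) := by
      rw [Prod.smul_mk, smul_smul, hcoef, mul_comm]
    rw [h2]
    exact S.smul_mem _ (hb i)

theorem isCommutator_closure_toLinearPMap {T B : H →L[ℂ] H}
    (hT : ∀ p ∈ S, (T p.1, T p.2 + B p.1) ∈ S) :
    IsCommutator S.toLinearPMap.closure T B := by
  rw [isCommutator_iff_graph]
  intro x y hxy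
  rw [graph_closure_toLinearPMap b hS hb] at hxy ⊢
  have hc : Continuous fun p : H × H => (T p.1, T p.2 + B p.1) := by fun_prop
  have : S.topologicalClosure.carrier ⊆
      (fun p : H × H => (T p.1, T p.2 + B p.1)) ⁻¹' S.topologicalClosure :=
    closure_minimal (fun p hp => S.le_topologicalClosure (hT p hp))
      (S.isClosed_topologicalClosure.preimage hc)
  exact this hxy

end DiagonalOperators

/-! ### Stone–Weierstrass for a group of characters. -/

section Characters

theorem span_topologicalClosure_eq_top_of_characters {X : Type*} [TopologicalSpace X]
    [CompactSpace X] {w : ℤ → C(X, ℂ)} (h0 : w 0 = 1) (hmul : ∀ j k, w j * w k = w (j + k))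
    (hstar : ∀ k, star (w k) = w (-k)) (hsep : Function.Injective (w 1)) :
    (Submodule.span ℂ (Set.range w)).topologicalClosure = ⊤ := by
  let V := Submodule.span ℂ (Set.range w)
  have hVm : ∀ f ∈ V, ∀ g ∈ V, f * g ∈ V := by
    intro f hf g hg
    have := Submodule.mul_mem_mul hf hg
    rw [Submodule.span_mul_span] at this
    refine Submodule.span_mono ?_ this
    rintro _ ⟨_, ⟨j, rfl⟩, _, ⟨k, rfl⟩, rfl⟩
    exact ⟨j + k, (hmul j k).symm⟩
  let A : StarSubalgebra ℂ C(X, ℂ) :=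
    { carrier := V
      mul_mem' := fun {f g} hf hg => hVm f hf g hg
      one_mem' := Submodule.subset_span ⟨0, h0⟩
      add_mem' := V.add_mem
      zero_mem' := V.zero_mem
      algebraMap_mem' := fun r => by
        rw [Algebra.algebraMap_eq_smul_one, ← h0]
        exact V.smul_mem _ (Submodule.subset_span ⟨0, rfl⟩)
      star_mem' := fun {f} hf => by
        refine Submodule.span_induction (p := fun f _ => star f ∈ V) ?_ ?_ ?_ ?_ hf
        · rintro _ ⟨k, rfl⟩
          rw [hstar]
          exact Submodule.subset_span ⟨-k, rfl⟩
        · rw [star_zero]; exact V.zero_mem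
        · intro f g _ _ hf hg
          rw [star_add]; exact V.add_mem hf hg
        · intro c f _ hf
          rw [star_smul]; exact V.smul_mem _ hf }
  have hA := ContinuousMap.starSubalgebra_topologicalClosure_eq_top_of_separatesPoints A
    fun x y hxy => ⟨w 1, ⟨w 1, Submodule.subset_span ⟨1, rfl⟩, rfl⟩, hsep.ne hxy⟩
  rw [eq_top_iff]
  intro f _
  have : f ∈ A.topologicalClosure := by rw [hA]; trivial
  exact this

end Characters

/-! ### Smooth eigenfunctions of the Dirac operator. -/

section Eigenfunctions

variable {M : Type*} [MetricSpace M] [ChartedSpace Line M] [IsManifold (𝓡 1) ∞ M]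
  {e : ∀ x : M, TangentSpace (𝓡 1) x}

omit [IsManifold (𝓡 1) ∞ M] in
theorem contMDiff_mul {f g : M → ℂ} (hf : ContMDiff (𝓡 1) 𝓘(ℝ, ℂ) ∞ f)
    (hg : ContMDiff (𝓡 1) 𝓘(ℝ, ℂ) ∞ g) : ContMDiff (𝓡 1) 𝓘(ℝ, ℂ) ∞ fun x => f x * g x :=
  ((contDiff_fst.mul contDiff_snd).contMDiff (f := fun p : ℂ × ℂ => p.1 * p.2)).comp
    (hf.prodMk_space hg)

namespace IsPeriodicParametrization

variable {γ : ℝ → M} {L : ℝ} (h : IsPeriodicParametrization e γ L)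

include h

omit [IsManifold (𝓡 1) ∞ M] in
theorem hasDerivAt_comp (f : C^∞⟮𝓡 1, M; 𝓘(ℝ, ℂ), ℂ⟯) (s : ℝ) :
    HasDerivAt (fun s => f (γ s)) (derivAlong e f (γ s)) s :=
  hasDerivAt_comp_integralCurve h.curve ((f.contMDiff (γ s)).mdifferentiableAt (by simp))

omit [IsManifold (𝓡 1) ∞ M] in
theorem derivAlong_mul (f g : C^∞⟮𝓡 1, M; 𝓘(ℝ, ℂ), ℂ⟯) (x : M) :
    derivAlong e (fun x => f x * g x) x = derivAlong e f x * g x + f x * derivAlong e g x := by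
  obtain ⟨s, rfl⟩ := h.surjective x
  exact (h.hasDerivAt_comp ⟨fun x => f x * g x, contMDiff_mul f.contMDiff g.contMDiff⟩ s).unique
    ((h.hasDerivAt_comp f s).mul (h.hasDerivAt_comp g s))

variable (he : ContMDiff (𝓡 1) (𝓡 1).tangent ∞ (fun x => (⟨x, e x⟩ : TangentBundle (𝓡 1) M)))
  (h0 : ∀ x, e x ≠ 0)

include he h0

theorem continuous_diracExpr (α : C^∞⟮𝓡 1, M; 𝓘(ℝ, ℝ), ℝ⟯)
    (f : C^∞⟮𝓡 1, M; 𝓘(ℝ, ℂ), ℂ⟯) : Continuous (diracExpr e α f) := by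
  have hγ := contMDiff_integralCurve he h0 h.curve
  have h1 : ContDiff ℝ ∞ fun s => f (γ s) :=
    contMDiff_iff_contDiff.1 (f.contMDiff.comp hγ)
  have h2 : derivAlong e f ∘ γ = deriv fun s => f (γ s) := by
    funext s
    exact (h.hasDerivAt_comp f s).deriv.symm
  have h3 : Continuous (derivAlong e f) := by
    rw [((integralCurve_isOpenMap he h0 h.curve).isQuotientMap h.continuous
      h.surjective).continuous_iff, h2]
    exact h1.continuous_deriv (by simp)
  exact (continuous_const.mul h3).add
    ((Complex.continuous_ofReal.comp α.contMDiff.continuous).mul f.contMDiff.continuous)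

/-- A gauge transformation: with `c` the mean of `α`, the function `c - α` has a periodic primitive,
and `exp (i θ)` reduces `α` to the constant `c`. -/
theorem exists_phase (α : C^∞⟮𝓡 1, M; 𝓘(ℝ, ℝ), ℝ⟯) : ∃ (c : ℝ) (θ : ℝ → ℝ),
    Function.Periodic θ L ∧ ContDiff ℝ ∞ θ ∧ ∀ s, HasDerivAt θ (c - α (γ s)) s := by
  have hL := h.pos.ne'
  have hγ := contMDiff_integralCurve he h0 h.curve
  have hα : ContDiff ℝ ∞ fun s => α (γ s) := contMDiff_iff_contDiff.1 (α.contMDiff.comp hγ)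
  have hper : Function.Periodic (fun s => α (γ s)) L := fun s => congrArg α (h.periodic s)
  have hint : ∀ a b, IntervalIntegrable (fun s => α (γ s)) volume a b := fun a b =>
    hα.continuous.intervalIntegrable a b
  let c := (∫ r in (0 : ℝ)..L, α (γ r)) / L
  let θ : ℝ → ℝ := fun s => c * s - ∫ r in (0 : ℝ)..s, α (γ r)
  have hd : ∀ s, HasDerivAt θ (c - α (γ s)) s := fun s => by
    have h1 := intervalIntegral.integral_hasDerivAt_right (hint 0 s)
      (hα.continuous.stronglyMeasurableAtFilter _ _) hα.continuous.continuousAt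
    have h2 := (hasDerivAt_id s).const_mul c
    rw [mul_one] at h2
    exact h2.sub h1
  refine ⟨c, θ, fun s => ?_, ?_, hd⟩
  · have h1 : ∫ r in (0 : ℝ)..(s + L), α (γ r) =
        (∫ r in (0 : ℝ)..s, α (γ r)) + ∫ r in (0 : ℝ)..L, α (γ r) := by
      rw [← intervalIntegral.integral_add_adjacent_intervals (hint 0 s) (hint s (s + L)),
        hper.intervalIntegral_add_eq s 0, zero_add]
    have h2 : c * L = ∫ r in (0 : ℝ)..L, α (γ r) := div_mul_cancel₀ _ hL
    simp only [θ, h1, mul_add, h2]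
    ring
  · refine contDiff_infty_iff_deriv.2 ⟨fun s => (hd s).differentiableAt, ?_⟩
    rw [show deriv θ = fun s => c - α (γ s) from funext fun s => (hd s).deriv]
    exact contDiff_const.sub hα

/-- The eigenfunctions of the Dirac operator. -/
theorem exists_eigenfunctions [CompactSpace M] (α : C^∞⟮𝓡 1, M; 𝓘(ℝ, ℝ), ℝ⟯) :
    ∃ (E : ℤ → C^∞⟮𝓡 1, M; 𝓘(ℝ, ℂ), ℂ⟯) (w : ℤ → C(M, ℂ)) (l : ℤ → ℝ),
      Function.Injective l ∧ (∀ k x, ‖E k x‖ = 1) ∧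
      (∀ k, diracExpr e α (E k) = fun x => l k * E k x) ∧ (∀ k x, E k x = E 0 x * w k x) ∧
      (Submodule.span ℂ (Set.range w)).topologicalClosure = ⊤ := by
  have hL := h.pos.ne'
  obtain ⟨c, θ, hp, hθ, hd⟩ := h.exists_phase he h0 α
  have hexp : ∀ (φ : ℝ → ℝ), Function.Periodic φ L → ContDiff ℝ ∞ φ → ∀ k : ℤ,
      ∃ f : C^∞⟮𝓡 1, M; 𝓘(ℝ, ℂ), ℂ⟯, ∀ s, f (γ s) =
        Complex.exp ((φ s + 2 * Real.pi / L * k * s : ℝ) * Complex.I) := by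
    intro φ hφ hφ' k
    refine h.exists_contMDiffMap he h0 ?_ fun s => ?_
    · have h1 : ContDiff ℝ ∞ fun s : ℝ => ((φ s + 2 * Real.pi / L * k * s : ℝ) : ℂ) :=
        Complex.ofRealCLM.contDiff.comp (hφ'.add (contDiff_const.mul contDiff_id))
      exact (h1.mul contDiff_const).cexp
    · have h2 : φ (s + L) + 2 * Real.pi / L * k * (s + L) =
          φ s + 2 * Real.pi / L * k * s + k * (2 * Real.pi) := by
        rw [hφ s]; field_simp; ring
      simp only [h2]
      rw [Complex.exp_eq_exp_iff_exists_int]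
      exact ⟨k, by push_cast; ring⟩
  choose E hE using hexp θ hp hθ
  -- Without the phase these are genuine characters, closed under products and conjugation as
  -- Stone–Weierstrass requires.
  choose w hw using hexp (fun _ => 0) (fun _ => rfl) contDiff_const
  refine ⟨E, fun k => ⟨w k, (w k).contMDiff.continuous⟩, fun k => c + 2 * Real.pi / L * k,
    fun j k hjk => ?_, fun k x => ?_, fun k => ?_, fun k x => ?_, ?_⟩
  · have h1 : 2 * Real.pi / L ≠ 0 := by positivity
    simpa [h1, hL, Real.pi_ne_zero] using hjk
  · obtain ⟨s, rfl⟩ := h.surjective x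
    rw [hE, Complex.norm_exp_ofReal_mul_I]
  · funext x
    obtain ⟨s, rfl⟩ := h.surjective x
    have h2 : HasDerivAt (fun s => E k (γ s)) (Complex.exp ((θ s + 2 * Real.pi / L * k * s : ℝ) *
        Complex.I) * ((c - α (γ s) + 2 * Real.pi / L * k * 1 : ℝ) * Complex.I)) s := by
      simp only [hE]
      exact (((hd s).add ((hasDerivAt_id s).const_mul (2 * Real.pi / L * k))).ofReal_comp.mul_const
        Complex.I).cexp
    rw [diracExpr, (h.hasDerivAt_comp (E k) s).unique h2, hE]
    push_cast
    linear_combination (-(Complex.exp ((θ s + 2 * Real.pi / L * k * s) * Complex.I) *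
      (c - α (γ s) + 2 * Real.pi / L * k))) * Complex.I_mul_I
  · obtain ⟨s, rfl⟩ := h.surjective x
    simp only [ContinuousMap.coe_mk, hE, hw]
    rw [← Complex.exp_add]
    congr 1
    push_cast; ring
  · refine span_topologicalClosure_eq_top_of_characters ?_ (fun j k => ?_) (fun k => ?_) ?_
    · ext x
      obtain ⟨s, rfl⟩ := h.surjective x
      simp [hw]
    · ext x
      obtain ⟨s, rfl⟩ := h.surjective x
      simp only [ContinuousMap.mul_apply, ContinuousMap.coe_mk, hw]
      rw [← Complex.exp_add]
      congr 1
      push_cast; ring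
    · ext x
      obtain ⟨s, rfl⟩ := h.surjective x
      simp only [ContinuousMap.star_apply, ContinuousMap.coe_mk, hw, RCLike.star_def]
      rw [← Complex.exp_conj, map_mul, Complex.conj_ofReal, Complex.conj_I]
      congr 1
      push_cast; ring
    · intro x y hxy
      obtain ⟨s, rfl⟩ := h.surjective x
      obtain ⟨t, rfl⟩ := h.surjective y
      simp only [ContinuousMap.coe_mk, hw] at hxy
      obtain ⟨n, hn⟩ := Complex.exp_eq_exp_iff_exists_int.1 hxy
      have hn' : ((0 + 2 * Real.pi / L * (1 : ℤ) * s : ℝ) : ℂ) =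
          ((0 + 2 * Real.pi / L * (1 : ℤ) * t + n * (2 * Real.pi) : ℝ) : ℂ) := by
        apply mul_right_cancel₀ Complex.I_ne_zero
        rw [hn]
        push_cast; ring
      have hn'' := Complex.ofReal_injective hn'
      refine (h.eq_iff s t).2 ⟨n, ?_⟩
      have hpi := Real.pi_ne_zero
      push_cast at hn''
      field_simp at hn''
      have h2 : 2 * Real.pi * (s - t - n * L) = 0 := by linear_combination hn''
      have h3 := (mul_eq_zero.1 h2).resolve_left (by positivity)
      linarith

end IsPeriodicParametrization

end Eigenfunctions

/-! ### Multiplication operators and continuous spinors. -/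

section Multiplication

variable {M : Type*} [MetricSpace M] [ChartedSpace Line M] [MeasurableSpace M] [BorelSpace M]
  [CompactSpace M]

theorem coeFn_mulOp (f : C^∞⟮𝓡 1, M; 𝓘(ℝ, ℂ), ℂ⟯) (x : Spinors M) :
    mulOp f x =ᵐ[lengthMeasure M] fun y => f y * x y := by
  have hf : MemLp (f : M → ℂ) ∞ (lengthMeasure M) := by
    have hc : Continuous f := f.contMDiff.continuous
    obtain ⟨C, hC⟩ := isCompact_univ.exists_bound_of_continuousOn hc.continuousOn
    exact memLp_top_of_bound hc.aestronglyMeasurable C (Eventually.of_forall fun x => hC x trivial)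
  have h1 : mulOp f x = (ContinuousLinearMap.mul ℂ ℂ).holder 2 hf.toLp x := rfl
  rw [h1]
  filter_upwards [(ContinuousLinearMap.mul ℂ ℂ).coeFn_holder (r := 2) hf.toLp x,
    hf.coeFn_toLp] with y h2 h3
  rw [h2, h3]
  rfl

theorem mulOp_unitary (f : C^∞⟮𝓡 1, M; 𝓘(ℝ, ℂ), ℂ⟯) (hf : ∀ x, ‖f x‖ = 1) :
    star (mulOp f) * mulOp f = 1 ∧ mulOp f * star (mulOp f) = 1 := by
  have hleft : star (mulOp f) * mulOp f = 1 := by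
    refine (ContinuousLinearMap.norm_map_iff_adjoint_comp_self (mulOp f)).1 fun x => ?_
    rw [Lp.norm_def, Lp.norm_def]
    congr 1
    refine eLpNorm_congr_norm_ae ?_
    filter_upwards [coeFn_mulOp f x] with y hy
    rw [hy, norm_mul, hf, one_mul]
  let g : C^∞⟮𝓡 1, M; 𝓘(ℝ, ℂ), ℂ⟯ :=
    ⟨fun x => (starRingEnd ℂ) (f x), Complex.conjCLE.contDiff.contMDiff.comp f.contMDiff⟩
  have hg : mulOp f * mulOp g = 1 := by
    ext1 x
    refine Lp.ext ?_
    filter_upwards [coeFn_mulOp f (mulOp g x), coeFn_mulOp g x] with y h1 h2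
    change (mulOp f (mulOp g x)) y = x y
    rw [h1, h2]
    change f y * ((starRingEnd ℂ) (f y) * x y) = x y
    rw [← mul_assoc, Complex.mul_conj', hf]
    simp
  have : star (mulOp f) = mulOp g := by
    calc star (mulOp f) = star (mulOp f) * (mulOp f * mulOp g) := by rw [hg, mul_one]
      _ = mulOp g := by rw [← mul_assoc, hleft, one_mul]
  exact ⟨hleft, by rw [this, hg]⟩

variable [IsFiniteMeasure (lengthMeasure M)]

variable (M) in
/-- A continuous function as a square integrable spinor. -/
abbrev toSpinor : C(M, ℂ) →L[ℂ] Spinors M := ContinuousMap.toLp 2 (lengthMeasure M) ℂ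

theorem mulOp_toSpinor (f : C^∞⟮𝓡 1, M; 𝓘(ℝ, ℂ), ℂ⟯) {g k : C(M, ℂ)}
    (hk : ∀ x, k x = f x * g x) : mulOp f (toSpinor M g) = toSpinor M k := by
  refine Lp.ext ?_
  filter_upwards [coeFn_mulOp f (toSpinor M g), ContinuousMap.coeFn_toLp (p := 2) (𝕜 := ℂ)
    (lengthMeasure M) g, ContinuousMap.coeFn_toLp (p := 2) (𝕜 := ℂ) (lengthMeasure M) k]
    with y h1 h2 h3
  rw [h1, h2, h3, hk]

omit [ChartedSpace Line M] in
theorem eq_toSpinor_iff {x : Spinors M} {g : C(M, ℂ)} :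
    x = toSpinor M g ↔ x =ᵐ[lengthMeasure M] g := by
  have := ContinuousMap.coeFn_toLp (p := 2) (𝕜 := ℂ) (lengthMeasure M) g
  constructor
  · rintro rfl; exact this
  · exact fun h => Lp.ext (h.trans this.symm)

theorem mem_smoothGraph {e : ∀ x : M, TangentSpace (𝓡 1) x} {α : C^∞⟮𝓡 1, M; 𝓘(ℝ, ℝ), ℝ⟯}
    {f : C^∞⟮𝓡 1, M; 𝓘(ℝ, ℂ), ℂ⟯} {g k : C(M, ℂ)} (hg : ⇑g = f) (hk : ⇑k = diracExpr e α f) :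
    (toSpinor M g, toSpinor M k) ∈ smoothGraph e α :=
  ⟨f, hg ▸ eq_toSpinor_iff.1 rfl, hk ▸ eq_toSpinor_iff.1 rfl⟩

end Multiplication

/-! ### The Dirac operator and the length criterion. -/

section Dirac

variable {M : Type*} [MetricSpace M] [ChartedSpace Line M] [IsManifold (𝓡 1) ∞ M]
  {e : ∀ x : M, TangentSpace (𝓡 1) x}
  [RiemannianBundle (fun x : M => TangentSpace (𝓡 1) x)] [IsRiemannianManifold (𝓡 1) M]
  [CompactSpace M] [MeasurableSpace M] [BorelSpace M]

namespace IsPeriodicParametrization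

variable {γ : ℝ → M} {L : ℝ} (h : IsPeriodicParametrization e γ L)
  (he : ContMDiff (𝓡 1) (𝓡 1).tangent ∞ (fun x => (⟨x, e x⟩ : TangentBundle (𝓡 1) M)))
  (h1 : ∀ x, ‖e x‖ = 1)

include h he h1

omit [IsManifold (𝓡 1) ∞ M] [IsRiemannianManifold (𝓡 1) M] [CompactSpace M]
  [MeasurableSpace M] [BorelSpace M] h he in
theorem ne_zero_of_norm_eq_one (x : M) : e x ≠ 0 := fun hx => by
  have := h1 x
  rw [hx, norm_zero] at this
  exact zero_ne_one this

omit [IsRiemannianManifold (𝓡 1) M] in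
theorem exists_toSpinor_of_mem_smoothGraph [IsFiniteMeasure (lengthMeasure M)]
    {α : C^∞⟮𝓡 1, M; 𝓘(ℝ, ℝ), ℝ⟯} {p : Spinors M × Spinors M} (hp : p ∈ smoothGraph e α) :
    ∃ (f : C^∞⟮𝓡 1, M; 𝓘(ℝ, ℂ), ℂ⟯) (g k : C(M, ℂ)), ⇑g = f ∧ ⇑k = diracExpr e α f ∧
      p = (toSpinor M g, toSpinor M k) := by
  obtain ⟨f, hf, hf'⟩ := hp
  refine ⟨f, ⟨f, f.contMDiff.continuous⟩, ⟨diracExpr e α f,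
    h.continuous_diracExpr he (ne_zero_of_norm_eq_one h1) α f⟩, rfl, rfl, ?_⟩
  exact Prod.ext (eq_toSpinor_iff.2 hf) (eq_toSpinor_iff.2 hf')

/-- Integration by parts: the difference of the integrands is the derivative of a function of period
`L`, and the real `α` cancels. -/
theorem inner_smoothGraph_symm [IsFiniteMeasure (lengthMeasure M)]
    (α : C^∞⟮𝓡 1, M; 𝓘(ℝ, ℝ), ℝ⟯) :
    ∀ p ∈ smoothGraph e α, ∀ q ∈ smoothGraph e α, ⟪p.1, q.2⟫_ℂ = ⟪p.2, q.1⟫_ℂ := by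
  intro p hp q hq
  obtain ⟨f, f₀, f₁, hf₀, hf₁, rfl⟩ := h.exists_toSpinor_of_mem_smoothGraph he h1 hp
  obtain ⟨g, g₀, g₁, hg₀, hg₁, rfl⟩ := h.exists_toSpinor_of_mem_smoothGraph he h1 hq
  have hc : ∀ u v : C(M, ℂ), Continuous fun x => u x * (starRingEnd ℂ) (v x) := fun u v =>
    u.continuous.mul (Complex.continuous_conj.comp v.continuous)
  have hi : ∀ u v : C(M, ℂ), IntervalIntegrable
      (fun s => u (γ s) * (starRingEnd ℂ) (v (γ s))) volume 0 L := fun u v =>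
    ((hc u v).comp h.continuous).intervalIntegrable _ _
  rw [ContinuousMap.inner_toLp, ContinuousMap.inner_toLp,
    h.integral_lengthMeasure he h1 (hc _ _), h.integral_lengthMeasure he h1 (hc _ _), ← sub_eq_zero,
    ← intervalIntegral.integral_sub (hi _ _) (hi _ _)]
  have hd : ∀ s, HasDerivAt (fun s => -Complex.I * (g (γ s) * (starRingEnd ℂ) (f (γ s))))
      (g₁ (γ s) * (starRingEnd ℂ) (f₀ (γ s)) - g₀ (γ s) * (starRingEnd ℂ) (f₁ (γ s))) s := by
    intro s
    have h2 := ((h.hasDerivAt_comp g s).mul (h.hasDerivAt_comp f s).star).const_mul (-Complex.I)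
    refine h2.congr_deriv ?_
    rw [hg₁, hf₁, hg₀, hf₀, diracExpr, diracExpr]
    simp only [map_add, map_mul, map_neg, Complex.conj_I, Complex.conj_ofReal, RCLike.star_def]
    ring
  rw [intervalIntegral.integral_eq_sub_of_hasDerivAt (fun s _ => hd s)
    ((hi _ _).sub (hi _ _)), show γ L = γ 0 by simpa using h.periodic 0, sub_self]

/-- The eigenfunctions of the Dirac operator form a Hilbert basis. -/
theorem exists_hilbertBasis [IsFiniteMeasure (lengthMeasure M)]
    (α : C^∞⟮𝓡 1, M; 𝓘(ℝ, ℝ), ℝ⟯) :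
    ∃ (b : HilbertBasis ℤ ℂ (Spinors M)) (l : ℤ → ℝ),
      ∀ k, (b k, (l k : ℂ) • b k) ∈ smoothGraph e α := by
  obtain ⟨E, w, l, hl, hE1, hD, hw, hspan⟩ :=
    h.exists_eigenfunctions he (ne_zero_of_norm_eq_one h1) α
  let E' : ℤ → C(M, ℂ) := fun k => ⟨E k, (E k).contMDiff.continuous⟩
  have hE' : ∀ k x, E' k x = E k x := fun k x => rfl
  have hmem : ∀ k, (toSpinor M (E' k), (l k : ℂ) • toSpinor M (E' k)) ∈ smoothGraph e α := by
    intro k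
    rw [← map_smul]
    exact mem_smoothGraph rfl (hD k).symm
  have hr : 0 < (Real.sqrt L) := Real.sqrt_pos.2 h.pos
  have hr' : ((Real.sqrt L : ℝ) : ℂ) ≠ 0 := Complex.ofReal_ne_zero.2 hr.ne'
  have hnorm : ∀ k, ‖toSpinor M (E' k)‖ = Real.sqrt L := by
    intro k
    have h2 : ⟪toSpinor M (E' k), toSpinor M (E' k)⟫_ℂ = L := by
      rw [ContinuousMap.inner_toLp]
      simp only [hE', Complex.mul_conj', hE1]
      simp [Measure.real, h.lengthMeasure_univ he h1, h.pos.le]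
    rw [@norm_eq_sqrt_re_inner ℂ, h2]
    simp
  let b : ℤ → Spinors M := fun k => ((Real.sqrt L : ℝ) : ℂ)⁻¹ • toSpinor M (E' k)
  have hbE : ∀ k, toSpinor M (E' k) = ((Real.sqrt L : ℝ) : ℂ) • b k := fun k => by
    rw [smul_smul, mul_inv_cancel₀ hr', one_smul]
  have hbmem : ∀ k, (b k, (l k : ℂ) • b k) ∈ smoothGraph e α := by
    intro k
    have := (smoothGraph e α).smul_mem (((Real.sqrt L : ℝ) : ℂ)⁻¹) (hmem k)
    rwa [Prod.smul_mk, smul_comm] at this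
  have horth : Orthonormal ℂ b := by
    refine ⟨fun k => ?_, fun j k hjk => ?_⟩
    · rw [norm_smul, hnorm, norm_inv, Complex.norm_real, Real.norm_of_nonneg hr.le,
        inv_mul_cancel₀ hr.ne']
    · have h2 := h.inner_smoothGraph_symm he h1 α _ (hbmem j) _ (hbmem k)
      simp only [inner_smul_left, inner_smul_right, Complex.conj_ofReal] at h2
      have h3 : ((l k : ℂ) - l j) * ⟪b j, b k⟫_ℂ = 0 := by rw [sub_mul, h2, sub_self]
      refine (mul_eq_zero.1 h3).resolve_left ?_
      exact fun h4 => hjk (hl (Complex.ofReal_injective (sub_eq_zero.1 h4))).symm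
  have hdense : ⊤ ≤ (Submodule.span ℂ (Set.range b)).topologicalClosure := by
    set W := (Submodule.span ℂ (Set.range b)).topologicalClosure
    -- Multiplication by the unimodular `E' 0` sends characters to eigenfunctions and is onto, so
    -- density of characters gives density of eigenfunctions.
    let T : C(M, ℂ) →L[ℂ] Spinors M :=
      (toSpinor M).comp (ContinuousLinearMap.mul ℂ C(M, ℂ) (E' 0))
    have hT : ∀ f, T f ∈ W := by
      have h2 : (Submodule.span ℂ (Set.range w)).topologicalClosure ≤ W.comap (T : _ →ₗ[ℂ] _) := by
        refine Submodule.topologicalClosure_minimal _ (Submodule.span_le.2 ?_)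
          ((Submodule.isClosed_topologicalClosure _).preimage T.continuous)
        rintro _ ⟨k, rfl⟩
        have h3 : T (w k) = ((Real.sqrt L : ℝ) : ℂ) • b k := by
          rw [← hbE]
          change toSpinor M (E' 0 * w k) = toSpinor M (E' k)
          congr 1
          ext x
          exact (hw k x).symm
        change T (w k) ∈ W
        rw [h3]
        exact W.smul_mem _ (Submodule.le_topologicalClosure _ (Submodule.subset_span ⟨k, rfl⟩))
      intro f
      rw [hspan] at h2
      exact h2 trivial
    have hW : Set.range (toSpinor M) ⊆ W := by
      rintro _ ⟨f, rfl⟩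
      have h2 : T (star (E' 0) * f) = toSpinor M f := by
        change toSpinor M (E' 0 * (star (E' 0) * f)) = toSpinor M f
        congr 1
        ext x
        simp only [ContinuousMap.mul_apply, ContinuousMap.star_apply, RCLike.star_def]
        rw [← mul_assoc, Complex.mul_conj', hE', hE1]
        simp
      rw [← h2]
      exact hT _
    intro x _
    have h2 : DenseRange (toSpinor M) :=
      ContinuousMap.toLp_denseRange ℂ (lengthMeasure M) ℂ (by simp)
    exact closure_minimal hW (Submodule.isClosed_topologicalClosure _) (h2 x)
  refine ⟨HilbertBasis.mk horth hdense, l, fun k => ?_⟩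
  rw [HilbertBasis.coe_mk]
  exact hbmem k

theorem isHeisenbergPair_dirac_iff (α : C^∞⟮𝓡 1, M; 𝓘(ℝ, ℝ), ℝ⟯) :
    (∃ U : C^∞⟮𝓡 1, M; 𝓘(ℝ, ℂ), ℂ⟯, IsHeisenbergPair (dirac e α) (mulOp U)) ↔
      ∃ n : ℕ, lengthMeasure M Set.univ = ENNReal.ofReal (2 * Real.pi * n) := by
  have := h.isFiniteMeasure_lengthMeasure he h1
  have := h.isOpenPosMeasure_lengthMeasure he h1
  have h0 := ne_zero_of_norm_eq_one h1
  have hL := h.pos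
  have hpi := Real.pi_pos
  obtain ⟨b, l, hb⟩ := h.exists_hilbertBasis he h1 α
  have hS := h.inner_smoothGraph_symm he h1 α
  have hgraph : (dirac e α).graph = (smoothGraph e α).topologicalClosure :=
    graph_closure_toLinearPMap b hS hb
  have hinj : Function.Injective (toSpinor M) := ContinuousMap.toLp_injective (lengthMeasure M)
  have hsmooth : ∀ (f : C^∞⟮𝓡 1, M; 𝓘(ℝ, ℂ), ℂ⟯) (g k : C(M, ℂ)), ⇑g = f →
      ⇑k = diracExpr e α f → (toSpinor M g, toSpinor M k) ∈ (dirac e α).graph := by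
    intro f g k hg hk
    rw [hgraph]
    exact Submodule.le_topologicalClosure _ (mem_smoothGraph hg hk)
  rw [h.lengthMeasure_univ he h1]
  constructor
  · rintro ⟨U, hU⟩
    let one : C^∞⟮𝓡 1, M; 𝓘(ℝ, ℂ), ℂ⟯ := ⟨fun _ => 1, contMDiff_const⟩
    let U₀ : C(M, ℂ) := ⟨U, U.contMDiff.continuous⟩
    let U₁ : C(M, ℂ) := ⟨diracExpr e α U, h.continuous_diracExpr he h0 α U⟩
    let k : C(M, ℂ) := ⟨diracExpr e α one, h.continuous_diracExpr he h0 α one⟩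
    have hk : ∀ x, k x = α x := by
      intro x
      obtain ⟨s, rfl⟩ := h.surjective x
      have h2 := (h.hasDerivAt_comp one s).unique (hasDerivAt_const s (1 : ℂ))
      change diracExpr e α one (γ s) = α (γ s)
      rw [diracExpr, h2]
      change -Complex.I * 0 + (α (γ s) : ℂ) * 1 = _
      ring
    -- Applying `[D, U] = U` to the constant spinor and comparing with `D` on the smooth function
    -- `U` gives `-i ∂_e U + α U = α U + U`. The potential drops out, so the holonomy plays no role.
    have h2 := hU.graph_apply (hsmooth one 1 k rfl rfl)
    rw [mulOp_toSpinor (k := U₀) U (fun x => by simp [U₀]),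
      mulOp_toSpinor (k := U₀ * k) U (fun x => rfl), ← map_add] at h2
    have h3 := hsmooth U U₀ U₁ rfl rfl
    have h4 : U₁ = U₀ * k + U₀ := hinj ((dirac e α).mem_graph_snd_inj h3 h2 rfl)
    have hder : ∀ s, HasDerivAt (fun s => U (γ s)) (Complex.I * U (γ s)) s := by
      intro s
      refine (h.hasDerivAt_comp U s).congr_deriv ?_
      have h5 : diracExpr e α U (γ s) = U (γ s) * k (γ s) + U (γ s) :=
        congrArg (fun f : C(M, ℂ) => f (γ s)) h4
      rw [hk, diracExpr] at h5
      linear_combination Complex.I * h5 + derivAlong e U (γ s) * Complex.I_mul_I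
    have hsol : ∀ s, U (γ s) = U (γ 0) * Complex.exp (s * Complex.I) := by
      have hd : ∀ s, HasDerivAt (fun s : ℝ => U (γ s) * Complex.exp (-(s * Complex.I))) 0 s := by
        intro s
        have h5 := (hder s).mul (((hasDerivAt_id s).ofReal_comp.mul_const Complex.I).neg.cexp)
        refine h5.congr_deriv ?_
        simp only [id, Complex.ofReal_one]
        ring
      intro s
      have h5 := is_const_of_deriv_eq_zero (fun s => (hd s).differentiableAt)
        (fun s => (hd s).deriv) s 0
      simp only [Complex.ofReal_zero, zero_mul, neg_zero, Complex.exp_zero, mul_one] at h5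
      rw [← h5, mul_assoc, ← Complex.exp_add, neg_add_cancel, Complex.exp_zero, mul_one]
    -- Otherwise `U` vanishes identically, contrary to unitarity.
    have hne : U (γ 0) ≠ 0 := by
      intro hz
      have h5 : toSpinor M U₀ = 0 := by
        rw [← map_zero (toSpinor M)]
        congr 1
        ext x
        obtain ⟨s, rfl⟩ := h.surjective x
        change U (γ s) = 0
        rw [hsol, hz, zero_mul]
      have h6 := hU.norm_apply (toSpinor M 1)
      rw [mulOp_toSpinor (k := U₀) U (fun x => by simp [U₀]), h5, norm_zero] at h6
      have h7 : toSpinor M 1 = toSpinor M 0 := by rw [map_zero]; exact norm_eq_zero.1 h6.symm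
      have h8 := congrArg (fun f : C(M, ℂ) => f (γ 0)) (hinj h7)
      simp at h8
    have h5 := hsol L
    rw [show γ L = γ 0 by simpa using h.periodic 0] at h5
    have h6 : Complex.exp (L * Complex.I) = 1 :=
      mul_left_cancel₀ hne (by rw [← h5, mul_one])
    obtain ⟨n, hn⟩ := Complex.exp_eq_one_iff.1 h6
    have h7 : L = 2 * Real.pi * n := by
      have h8 : (L : ℂ) = ((2 * Real.pi * n : ℝ) : ℂ) := by
        apply mul_right_cancel₀ Complex.I_ne_zero
        rw [hn]
        push_cast; ring
      exact Complex.ofReal_injective h8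
    have h8 : 0 ≤ n := by
      by_contra hneg
      push Not at hneg
      have : (n : ℝ) < 0 := by exact_mod_cast hneg
      nlinarith
    lift n to ℕ using h8
    exact ⟨n, by rw [h7]; simp⟩
  · rintro ⟨n, hn⟩
    have hLn : L = 2 * Real.pi * n := (ENNReal.ofReal_eq_ofReal_iff hL.le (by positivity)).1 hn
    -- The witness `exp (i s)` descends to the manifold because `L` is a multiple of `2 π`.
    obtain ⟨U, hU⟩ := h.exists_contMDiffMap he h0
      (F := fun s : ℝ => Complex.exp ((s : ℂ) * Complex.I))
      (Complex.ofRealCLM.contDiff.mul contDiff_const).cexp fun s => by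
        rw [Complex.exp_eq_exp_iff_exists_int]
        exact ⟨n, by rw [hLn]; push_cast; ring⟩
    have hU1 : ∀ x, ‖U x‖ = 1 := fun x => by
      obtain ⟨s, rfl⟩ := h.surjective x
      rw [hU, Complex.norm_exp_ofReal_mul_I]
    have hder : ∀ x, derivAlong e U x = Complex.I * U x := fun x => by
      obtain ⟨s, rfl⟩ := h.surjective x
      refine (h.hasDerivAt_comp U s).unique ?_
      simp only [hU]
      refine (((hasDerivAt_id s).ofReal_comp.mul_const Complex.I).cexp).congr_deriv ?_
      simp only [id, Complex.ofReal_one]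
      ring
    have hUU := mulOp_unitary U hU1
    refine ⟨U, hUU.1, hUU.2, isSelfAdjoint_closure_toLinearPMap b hS hb, mulOp U,
      isCommutator_closure_toLinearPMap b hS hb fun p hp => ?_, hUU.1⟩
    obtain ⟨f, f₀, f₁, hf₀, hf₁, rfl⟩ := h.exists_toSpinor_of_mem_smoothGraph he h1 hp
    let U₀ : C(M, ℂ) := ⟨U, U.contMDiff.continuous⟩
    rw [mulOp_toSpinor (k := U₀ * f₀) U (fun x => rfl),
      mulOp_toSpinor (k := U₀ * f₁) U (fun x => rfl), ← map_add]
    refine mem_smoothGraph (f := ⟨fun x => U x * f x, contMDiff_mul U.contMDiff f.contMDiff⟩) ?_ ?_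
    · funext x
      simp [U₀, hf₀]
    · funext x
      have h2 : derivAlong e (fun x => U x * f x) x = _ := h.derivAlong_mul U f x
      simp only [ContinuousMap.add_apply, ContinuousMap.mul_apply, hf₁, hf₀, U₀,
        ContinuousMap.coe_mk]
      change U x * diracExpr e α f x + U x * f x = -Complex.I *
        derivAlong e (fun x => U x * f x) x + (α x : ℂ) * (U x * f x)
      rw [h2, hder, diracExpr]
      linear_combination U x * f x * Complex.I_mul_I

end IsPeriodicParametrization

end Dirac
end ConnesCircle

end

theorem mainTheorem5 :
    -- integrality of the integral of the line element
    (∀ (H : Type*) [NormedAddCommGroup H] [InnerProductSpace ℂ H] [CompleteSpace H]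
      (D : H →ₗ.[ℂ] H) (U ds : H →L[ℂ] H), ConnesCircle.IsHeisenbergPair D U →
      ConnesCircle.IsLineElement D ds → IsCompactOperator ds →
      ∃ n : ℕ, ConnesCircle.HasNCIntegral (CFC.abs ds) n) ∧
    -- the spectrum of `U` is the unit circle, with its standard distance
    (∀ (H : Type*) [NormedAddCommGroup H] [InnerProductSpace ℂ H] [CompleteSpace H] [Nontrivial H]
      (D : H →ₗ.[ℂ] H) (U : H →L[ℂ] H) (h : ConnesCircle.IsHeisenbergPair D U),
      spectrum ℂ U = Metric.sphere (0 : ℂ) 1 ∧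
      ∀ 𝒜 : StarSubalgebra ℂ C(spectrum ℂ U, ℂ),
        ConnesCircle.coordinate U ∈ 𝒜 → ∀ a b : spectrum ℂ U,
          IsLUB (ConnesCircle.spectralDifferences D U h.isStarNormal 𝒜 a b)
            (InnerProductGeometry.angle (a : ℂ) (b : ℂ))) ∧
    -- compact Riemannian manifolds of dimension one
    (∀ (M : Type*) [MetricSpace M] [ChartedSpace ConnesCircle.Line M] [IsManifold (𝓡 1) ∞ M]
      [RiemannianBundle (fun x : M => TangentSpace (𝓡 1) x)]
      [IsContMDiffRiemannianBundle (𝓡 1) ∞ ConnesCircle.Line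
        (fun x : M => TangentSpace (𝓡 1) x)]
      [IsRiemannianManifold (𝓡 1) M] [CompactSpace M] [ConnectedSpace M]
      [MeasurableSpace M] [BorelSpace M]
      (e : ∀ x : M, TangentSpace (𝓡 1) x) (α : C^∞⟮𝓡 1, M; 𝓘(ℝ, ℝ), ℝ⟯),
      ContMDiff (𝓡 1) (𝓡 1).tangent ∞
        (fun x => (⟨x, e x⟩ : TangentBundle (𝓡 1) M)) →
      (∀ x, ‖e x‖ = 1) →
      ((∃ U : C^∞⟮𝓡 1, M; 𝓘(ℝ, ℂ), ℂ⟯,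
          ConnesCircle.IsHeisenbergPair (ConnesCircle.dirac e α) (ConnesCircle.mulOp U)) ↔
        ∃ n : ℕ, ConnesCircle.lengthMeasure M Set.univ = ENNReal.ofReal (2 * Real.pi * n))) :=
  ⟨fun H _ _ _ D U ds hU h hc => hU.hasNCIntegral h hc,
    fun H _ _ _ _ D U h =>
      ⟨h.spectrum_eq, fun 𝒜 hU a b => h.isLUB_spectralDifferences hU a b⟩,
    fun M _ _ _ _ _ _ _ _ _ _ e α he h1 => by
      obtain ⟨γ, L, hL, hγ, hsurj, heq⟩ := ConnesCircle.exists_periodic_parametrization he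
        (ConnesCircle.IsPeriodicParametrization.ne_zero_of_norm_eq_one h1)
      exact ConnesCircle.IsPeriodicParametrization.isHeisenbergPair_dirac_iff
        ⟨hL, hγ, hsurj, heq⟩ he h1 α⟩
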